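/- **Setting.** Let $\mathcal U\subseteq\mathbb R^d$ be nonempty and $h_1,h_2:\mathbb R^d\to\mathbb R$. Let $g:\mathcal U\to\mathcal X\subseteq\mathbb R^p$ be a bijection with $h_m=f_m\circ g$ on $\mathcal U$. For $w\in[0,1]$ let $x_w^*$ be the minimizer over $\mathcal X$ of $\mathrm{LS}(x;w)=wf_1(x)+(1-w)f_2(x)$. Assume: 1. (Hidden-space regularity) $f_1,f_2$ are $C^2$ on an open set containing $\mathcal X$ and $\mu$-strongly convex on $\mathcal X$ for some $\mu>0$; the image under $g$ of the Pareto set of $(h_1,h_2)$ on $\mathcal U$ lies in a compact $\mathcal K\subseteq\mathcal X$ on which $\nabla f_1,\nabla f_2$ are Lipschitz. 2. (Constraint regularity) $\mathcal X=\{x: c_1(x)\le 0,\ c_2(x)=0\}$ with finitely many constraints; the components of $c_1$ are convex, twice differentiable and have Lipschitz gradient, and $c_2$ is affine. The set of constraints active at $x_w^*$ does not depend on $w\in[0,1]$, their gradients at $x_w^*$ are linearly independent, and the Hessian of the Lagrangian at $x_w^*$ (with its KKT multipliers) is a Lipschitz function of $w\in[0,1]$. 3. (Nonzero trade-off) With $J_w$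 the Jacobian of the active constraints at $x_w^*$, there is $c_0>0$ with $\|\mathrm{Proj}_{\ker J_w}(\nabla f_1(x_w^*)-\nabla f_2(x_w^*))\|\ge c_0$ for all $w\in[0,1]$. Put $\mathbf f_{\rm PF}(w)=(f_1(x_w^*),f_2(x_w^*))$, $v(w)=\|\mathbf f_{\rm PF}'(w)\|$ (one-sided derivatives at $0,1$), $s(w)=\int_0^w v$, $\Phi=s/s(1)$, $v_{\min}=\inf_{[0,1]}v$, $v_{\max}=\sup_{[0,1]}v$, and $\|F\|_\infty=\sup_{[0,1]}|F|$. **Algorithm (SURF).** Given $N\ge1$, $\alpha$, initial points $u_n^{(-1)}$ ($0\le n\le N$) and a $K$-step inner solver, start from $\Phi_0(w)=w$. At outer iteration $t\ge0$ let $w_n^{(t)}=\Phi_t^{-1}(n/N)$ and let $u_n^{(t)}$ be the output of the solver for weight $w_n^{(t)}$ started at $u_n^{(t-1)}$. Let $\tilde s^{(t)}$ be the PCHIP interpolant (weighted-harmonic-mean slopes at interior knots, limited three-point slopes at the two end knots) in the variable $w$ of the cumulative chord lengths $\sum_{j<n}\|\mathbf h(u_{j+1}^{(t)})-\mathbf h(u_j^{(t)})\|$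 at the knots $w_n^{(t)}$. Put $\tilde\Phi_t=\tilde s^{(t)}/\tilde s^{(t)}(1)$ and $\Phi_{t+1}=\alpha\tilde\Phi_t+(1-\alpha)\Phi_t$. Write $x_n^{(t)}=g(u_n^{(t)})$ and $e_t=\max_{0\le n\le N}\|x_n^{(t)}-x^*_{w_n^{(t)}}\|$. The solver has $K$-step contraction factor $\eta_K\ge 0$ along the run if its outputs lie in $\mathcal U$ and $\|x_n^{(t+1)}-x^*_{w_n^{(t+1)}}\|\le\eta_K\|x_n^{(t)}-x^*_{w_n^{(t+1)}}\|$ for all $t\ge0$ and $0\le n\le N$. **Theorem.** Under 1–3, $\mathbf f_{\rm PF}$ is differentiable on $[0,1]$, $0<v_{\min}\le v\le v_{\max}$ on $[0,1]$, $s(1)>0$, and $\Phi$ is a continuous strictly increasing function on $[0,1]$ with $\Phi(0)=0$, $\Phi(1)=1$. There are constants $C_2,C_3,C_4>0$, depending only on the problem, such that the following holds. **(i)** There are constants $F_1,\dots,F_4>0$, depending only on the problem, and for every $D>0$ a constant $c>0$, depending only on the problem and $D$, such that for all $N\ge1$ and $0<\alpha\le\frac12$: if $$\eta_K\le c\,\min\Big\{\frac{v_{\min}^2}{v_{\max}}N^{-1},\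 \frac{s(1)}{\alpha N}\Big\},$$ the solver has contraction factor $\eta_K$ along the run, and moreover $u_n^{(-1)},u_n^{(0)}\in\mathcal U$, $\|g(u_n^{(-1)})-x^*_{w_n^{(0)}}\|\le D$ and $\|x_n^{(0)}-x^*_{w_n^{(0)}}\|\le\eta_K\|g(u_n^{(-1)})-x^*_{w_n^{(0)}}\|$ for all $0\le n\le N$, then with $C=\big(\frac{4C_2}{s(1)}+\frac{v_{\max}}{v_{\min}^2}\big)N=\Theta(N)$, for all $t\ge0$: $\Phi_t$ is a continuous strictly increasing function on $[0,1]$ with $\Phi_t(0)=0$, $\Phi_t(1)=1$; $$\|\Phi_t-\Phi\|_\infty+Ce_t\le\Big(1-\frac\alpha4\Big)^t\big(\|\Phi_0-\Phi\|_\infty+Ce_0\big)+\frac{F_1}{N^2};$$ $e_t\le F_2\frac{v_{\min}^2}{v_{\max}}N^{-1}$; and whenever $(1-\frac\alpha4)^t(\|\Phi_0-\Phi\|_\infty+Ce_0)\le F_1N^{-2}$, one has $\|\Phi_t-\Phi\|_\infty\le F_3N^{-2}$ and $e_t\le F_4N^{-3}$. **(ii)** For all $a_1,a_2>0$ there are constants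 $c,F_1,\dots,F_4,L>0$, depending only on the problem and $a_1,a_2$, such that for all $N\ge1$ and $\alpha\le1$ with $a_1/N\le\alpha\le a_2/N$: if $u_n^{(0)}\in\mathcal U$ for $0\le n\le N$, $e_0\le c\,\frac{v_{\min}^2}{v_{\max}}N^{-1}$ (warm-up initialization), and the solver has contraction factor $$\eta_K\le\min\Big\{\tfrac12\Big(1+C_3C_4\alpha\tfrac{N}{s(1)}\Big)^{-1},\ \tfrac14\Big(\big(1+\tfrac{4C_2\alpha N}{s(1)}\big)C_3C_4\Big)^{-1}\Big\}=\mathcal O(1)$$ along the run, then with $C=1+\frac{4C_2\alpha N}{s(1)}$, for all $t\ge0$: $\Phi_t$ is a continuous strictly increasing function on $[0,1]$ with $\Phi_t(0)=0$, $\Phi_t(1)=1$, and $$\|\Phi_t-\Phi\|_\infty+Ce_t\le\Big(1-\frac\alpha4\Big)^t\big(\|\Phi_0-\Phi\|_\infty+Ce_0\big)+\frac{F_1}{N^2}.$$ If moreover $(1-\frac\alpha4)^{t_0}(\|\Phi_0-\Phi\|_\infty+Ce_0)\le F_1N^{-2}$, then $\|\Phi_t-\Phi\|_\infty\le F_2N^{-2}$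 for all $t\ge t_0$, and $e_t\le F_3\,\alpha\,\eta_KN^{-2}$ and $e_t\le F_4N^{-3}$ for all $t\ge t_0+L\log(N+1)$. -/

import Mathlib

open Set

namespace SURF

noncomputable section

/-- The Euclidean space `ℝⁿ`. -/
abbrev E (n : ℕ) : Type := EuclideanSpace ℝ (Fin n)

/-! ### The bi-objective problem and its hidden formulation -/

/-- Data of a bi-objective problem `min_{u ∈ U} (h 0 u, h 1 u)` with hidden reformulation
`min_{x ∈ X} (f 0 x, f 1 x)` through `g : U → X`, and of the inequality constraints `c₁ ≤ 0` and
the affine equality constraints `c₂ = 0` that describe `X`. The objectives `h 0`, `h 1` are the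
two objectives `h₁`, `h₂`. -/
structure Problem (d p k q : ℕ) where
  U : Set (E d)
  h : Fin 2 → E d → ℝ
  g : E d → E p
  X : Set (E p)
  f : Fin 2 → E p → ℝ
  c₁ : Fin k → E p → ℝ
  c₂ : Fin q → E p →ᵃ[ℝ] ℝ

namespace Problem

variable {d p k q : ℕ} (P : Problem d p k q)

/-- Pareto set of the original problem. -/
def paretoSet : Set (E d) :=
  {u | u ∈ P.U ∧ ¬ ∃ v ∈ P.U, (∀ m, P.h m v ≤ P.h m u) ∧ ∃ j, P.h j v < P.h j u}

/-- The objective vector `h(u) ∈ ℝ²`. -/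
def hVec (u : E d) : E 2 := WithLp.toLp 2 (fun m => P.h m u)

/-- The linear scalarization `w f₁(x) + (1 - w) f₂(x)`. -/
def LS (w : ℝ) (x : E p) : ℝ := w * P.f 0 x + (1 - w) * P.f 1 x

open Classical in
/-- The minimizer `x_w^*` of the linear scalarization over `X`. -/
def xStar (w : ℝ) : E p :=
  if H : ∃ x ∈ P.X, IsMinOn (P.LS w) P.X x then H.choose else 0

/-- All constraint functions, inequalities first. -/
def con : Fin k ⊕ Fin q → E p → ℝ := Sum.elim P.c₁ (fun j x => P.c₂ j x)

/-- Indices of the constraints that are active at `x_w^*` (all equality constraints are). -/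
def active (w : ℝ) : Set (Fin k ⊕ Fin q) := {a | P.con a (P.xStar w) = 0}

/-- The kernel of the Jacobian `J_w` of the active constraints at `x_w^*`. -/
def kerJ (w : ℝ) : Submodule ℝ (E p) :=
  ⨅ a : P.active w, LinearMap.ker (fderiv ℝ (P.con a) (P.xStar w)).toLinearMap

/-- `ν` is a vector of Lagrange (KKT) multipliers of the scalarized problem at `x_w^*`. -/
structure IsMultiplier (w : ℝ) (ν : Fin k ⊕ Fin q → ℝ) : Prop where
  nonneg : ∀ i, 0 ≤ ν (Sum.inl i)
  slack : ∀ a, a ∉ P.active w → ν a = 0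
  stationary : w • fderiv ℝ (P.f 0) (P.xStar w) + (1 - w) • fderiv ℝ (P.f 1) (P.xStar w)
    + ∑ a, ν a • fderiv ℝ (P.con a) (P.xStar w) = 0

/-- Hessian in `x` of the Lagrangian at `x_w^*` with multipliers `ν`. -/
def lagrangianHessian (w : ℝ) (ν : Fin k ⊕ Fin q → ℝ) : E p →L[ℝ] E p →L[ℝ] ℝ :=
  w • fderiv ℝ (fderiv ℝ (P.f 0)) (P.xStar w)
    + (1 - w) • fderiv ℝ (fderiv ℝ (P.f 1)) (P.xStar w)
    + ∑ a, ν a • fderiv ℝ (fderiv ℝ (P.con a)) (P.xStar w)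

/-- Hidden-space regularity. -/
structure HiddenRegular : Prop where
  nonempty : P.U.Nonempty
  bij : BijOn P.g P.U P.X
  comp : ∀ m, ∀ u ∈ P.U, P.h m u = P.f m (P.g u)
  smooth : ∃ O : Set (E p), IsOpen O ∧ P.X ⊆ O ∧ ∀ m, ContDiffOn ℝ 2 (P.f m) O
  strong : ∃ μ : ℝ, 0 < μ ∧ ∀ m, StrongConvexOn P.X μ (P.f m)
  compact : ∃ K : Set (E p), IsCompact K ∧ K ⊆ P.X ∧ P.g '' P.paretoSet ⊆ K ∧
    ∃ l : NNReal, ∀ m, LipschitzOnWith l (gradient (P.f m)) K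

/-- Constraint regularity: `X = {c₁ ≤ 0, c₂ = 0}` with `c₁` convex, twice differentiable and
Lipschitz-smooth; the active set along the path `w ↦ x_w^*` is fixed, LICQ holds, and the Hessian
of the Lagrangian is Lipschitz along the path. -/
structure ConstraintRegular : Prop where
  feasible : P.X = {x | (∀ i, P.c₁ i x ≤ 0) ∧ ∀ j, P.c₂ j x = 0}
  diff : ∀ i, Differentiable ℝ (P.c₁ i)
  diff_two : ∀ i, Differentiable ℝ (fderiv ℝ (P.c₁ i))
  lipschitz_smooth : ∀ i, ∃ l : NNReal, LipschitzWith l (fderiv ℝ (P.c₁ i))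
  convex : ∀ i, ConvexOn ℝ univ (P.c₁ i)
  fixed : ∀ w ∈ Icc (0 : ℝ) 1, ∀ w' ∈ Icc (0 : ℝ) 1, P.active w = P.active w'
  licq : ∀ w ∈ Icc (0 : ℝ) 1,
    LinearIndependent ℝ (fun a : P.active w => fderiv ℝ (P.con a) (P.xStar w))
  hessian : ∃ L : ℝ, ∀ w ∈ Icc (0 : ℝ) 1, ∀ w' ∈ Icc (0 : ℝ) 1, ∀ ν ν',
    P.IsMultiplier w ν → P.IsMultiplier w' ν' →
      ‖P.lagrangianHessian w ν - P.lagrangianHessian w' ν'‖ ≤ L * |w - w'|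

/-- Nonzero trade-off along the feasible directions. -/
def NonzeroTradeoff : Prop :=
  ∃ c : ℝ, 0 < c ∧ ∀ w ∈ Icc (0 : ℝ) 1,
    c ≤ ‖(P.kerJ w).starProjection
      (gradient (P.f 0) (P.xStar w) - gradient (P.f 1) (P.xStar w))‖

/-! ### Geometry of the Pareto front -/

/-- The Pareto-front path `f_PF(w) = f(x_w^*)`. -/
def fPF (w : ℝ) : E 2 := WithLp.toLp 2 (fun m => P.f m (P.xStar w))

/-- Traversal speed (one-sided derivatives at the end points of `[0,1]`). -/
def speed (w : ℝ) : ℝ := ‖derivWithin P.fPF (Icc 0 1) w‖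

/-- Arc length up to weight `w`. -/
def arc (w : ℝ) : ℝ := ∫ r in (0 : ℝ)..w, P.speed r

/-- The normalized arc-length CDF `Φ`. -/
def Phi (w : ℝ) : ℝ := P.arc w / P.arc 1

/-- Smallest traversal speed. -/
def vMin : ℝ := sInf (P.speed '' Icc 0 1)

/-- Largest traversal speed. -/
def vMax : ℝ := sSup (P.speed '' Icc 0 1)

end Problem

/-! ### PCHIP interpolation

The knots are `z 0 < ⋯ < z N` with values `y 0, …, y N`. -/

/-- Width of the `n`-th knot interval. -/
def gap (z : ℕ → ℝ) (n : ℕ) : ℝ := z (n + 1) - z n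

/-- Secant slope on the `n`-th knot interval. -/
def secant (z y : ℕ → ℝ) (n : ℕ) : ℝ := (y (n + 1) - y n) / gap z n

/-- Slope at an interior knot between intervals of widths `a`, `b` and secants `δ`, `δ'`. -/
def interiorSlope (a b δ δ' : ℝ) : ℝ :=
  if δ * δ' ≤ 0 then 0
  else ((2 * b + a) + (b + 2 * a)) / ((2 * b + a) / δ + (b + 2 * a) / δ')

/-- One-sided three-point end slope before limiting: the end interval has width `a` and secant
`δ`, its neighbour has width `b` and secant `δ'`. -/
def rawEndSlope (a b δ δ' : ℝ) : ℝ := ((2 * a + b) * δ - a * δ') / (a + b)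

/-- Limited end slope. -/
def endSlope (a b δ δ' : ℝ) : ℝ :=
  if rawEndSlope a b δ δ' * δ ≤ 0 then 0
  else if 3 * |δ| < |rawEndSlope a b δ δ'| then 3 * δ
  else rawEndSlope a b δ δ'

/-- Slope of the interpolant at the `n`-th knot, `0 ≤ n ≤ N`. -/
def knotSlope (N : ℕ) (z y : ℕ → ℝ) (n : ℕ) : ℝ :=
  if N = 1 then secant z y 0
  else if n = 0 then endSlope (gap z 0) (gap z 1) (secant z y 0) (secant z y 1)
  else if n = N then
    endSlope (gap z (N - 1)) (gap z (N - 2)) (secant z y (N - 1)) (secant z y (N - 2))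
  else interiorSlope (gap z (n - 1)) (gap z n) (secant z y (n - 1)) (secant z y n)

/-- The cubic Hermite piece on the `n`-th knot interval. -/
def hermitePiece (N : ℕ) (z y : ℕ → ℝ) (n : ℕ) (x : ℝ) : ℝ :=
  let θ := (x - z n) / gap z n
  (2 * θ ^ 3 - 3 * θ ^ 2 + 1) * y n
    + (θ ^ 3 - 2 * θ ^ 2 + θ) * gap z n * knotSlope N z y n
    + (-2 * θ ^ 3 + 3 * θ ^ 2) * y (n + 1)
    + (θ ^ 3 - θ ^ 2) * gap z n * knotSlope N z y (n + 1)

open Classical in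
/-- The PCHIP interpolant: on `[z n, z (n+1)]` it is the `n`-th Hermite piece. -/
def pchip (N : ℕ) (z y : ℕ → ℝ) (x : ℝ) : ℝ :=
  hermitePiece N z y (Nat.findGreatest (fun n => z n ≤ x) (N - 1)) x

/-! ### The SURF iteration -/

/-- `F` is a continuous, strictly increasing CDF on `[0,1]`. -/
structure IsCDF (F : ℝ → ℝ) : Prop where
  cont : ContinuousOn F (Icc 0 1)
  strictMono : StrictMonoOn F (Icc 0 1)
  zero : F 0 = 0
  one : F 1 = 1

/-- The quantile function; it is `F⁻¹` whenever `IsCDF F`. -/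
def quantile (F : ℝ → ℝ) (r : ℝ) : ℝ := sInf {w | w ∈ Icc (0 : ℝ) 1 ∧ r ≤ F w}

/-- Inputs of the algorithm: number `N` of segments, damping `α`, the inner solver with its step
budget `K` fixed (`solver w u` is its output for weight `w` after `K` steps started at `u`), and
the initial iterates `u_n^{(-1)}`. -/
structure Run (d : ℕ) where
  N : ℕ
  α : ℝ
  solver : ℝ → E d → E d
  init : ℕ → E d

namespace Problem

variable {d p k q : ℕ} (P : Problem d p k q)

/-- Cumulative chord lengths of the sampled objective vectors. -/
def chord (u : ℕ → E d) (n : ℕ) : ℝ :=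
  ∑ j ∈ Finset.range n, ‖P.hVec (u (j + 1)) - P.hVec (u j)‖

/-- The rebuilt CDF `s̃ / s̃(1)` from the weights `z` and the sampled points `u`; the value
`s̃(1)` at the last knot is the total chord length. -/
def rebuilt (N : ℕ) (z : ℕ → ℝ) (u : ℕ → E d) (w : ℝ) : ℝ :=
  pchip N z (P.chord u) w / P.chord u N

/-- State `(Φ_t, u^{(t-1)})` at the start of outer iteration `t`. -/
def state (R : Run d) : ℕ → (ℝ → ℝ) × (ℕ → E d)
  | 0 => (fun w => w, R.init)
  | t + 1 =>
    let F := (state R t).1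
    let z : ℕ → ℝ := fun n => quantile F (n / R.N)
    let u : ℕ → E d := fun n => R.solver (z n) ((state R t).2 n)
    (fun w => R.α * P.rebuilt R.N z u w + (1 - R.α) * F w, u)

/-- The CDF iterate `Φ_t`. -/
def cdf (R : Run d) (t : ℕ) : ℝ → ℝ := (P.state R t).1

/-- The sampled weight `w_n^{(t)} = Φ_t⁻¹(n/N)`. -/
def weight (R : Run d) (t n : ℕ) : ℝ := quantile (P.cdf R t) (n / R.N)

/-- The inner iterate `u_n^{(t)}`. -/
def iterate (R : Run d) (t n : ℕ) : E d := (P.state R (t + 1)).2 n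

/-- `‖Φ_t - Φ‖_∞` on `[0,1]`. -/
def cdfErr (R : Run d) (t : ℕ) : ℝ := ⨆ w : Icc (0 : ℝ) 1, |P.cdf R t w - P.Phi w|

/-- `max_{0 ≤ n ≤ N} ‖x_n^{(t)} - x^*_{w_n^{(t)}}‖` with `x_n^{(t)} = g(u_n^{(t)})`. -/
def innerErr (R : Run d) (t : ℕ) : ℝ :=
  (Finset.range (R.N + 1)).sup' Finset.nonempty_range_add_one
    (fun n => ‖P.g (P.iterate R t n) - P.xStar (P.weight R t n)‖)

/-- The Lyapunov quantity with amplification factor `C`. -/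
def lyapunov (R : Run d) (C : ℝ) (t : ℕ) : ℝ := P.cdfErr R t + C * P.innerErr R t

/-- Warm-started `K`-step contraction with factor `η`, from each outer iterate to the next. -/
def WarmContraction (R : Run d) (η : ℝ) : Prop :=
  ∀ t n, n ≤ R.N → P.iterate R (t + 1) n ∈ P.U ∧
    ‖P.g (P.iterate R (t + 1) n) - P.xStar (P.weight R (t + 1) n)‖
      ≤ η * ‖P.g (P.iterate R t n) - P.xStar (P.weight R (t + 1) n)‖

/-- The first inner solve contracts with the same factor `η` from initial iterates that are
feasible and at distance at most `D` from their targets. -/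
def InitialContraction (R : Run d) (η D : ℝ) : Prop :=
  ∀ n, n ≤ R.N → R.init n ∈ P.U ∧ P.iterate R 0 n ∈ P.U ∧
    ‖P.g (R.init n) - P.xStar (P.weight R 0 n)‖ ≤ D ∧
    ‖P.g (P.iterate R 0 n) - P.xStar (P.weight R 0 n)‖
      ≤ η * ‖P.g (R.init n) - P.xStar (P.weight R 0 n)‖

end Problem

end

end SURF

/-! The proof has three layers: regularity of the front, consistency of one rebuilding step, and a
recursion for two error sequences.

Regularity. LICQ and coercivity of the Lagrangian Hessian on the tangent space make the saddle
operator of the KKT system injective, uniformly in the weight by compactness. Multipliers and the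
candidate derivative of the path solve saddle equations with Lipschitz data, so they are Lipschitz;
linearizing the KKT system along the path identifies the derivative (`exists_path_derivative`).
Pairing the differentiated system with this derivative shows that `f₂ - f₁` grows along the path at
the rate given by the Hessian quadratic form, and the nonzero trade-off makes this rate positive.
Hence the front is a curve with Lipschitz derivative that advances in one fixed direction
(`exists_frontBounds`).

Consistency. For such a curve chord and arc length differ by `O(h³)` (`FrontBounds.chord_arc`). On a
quasi-uniform grid these errors sum to `O(N⁻²)`. Inner errors of size `e` perturb secants by `O(N
e)`, because gaps are at least of order `1/N`. PCHIP slopes stay as close to the secants as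
neighbouring secants are to each other, so the rebuilt function errs by `O(N⁻² + N e)`
(`Sample.rebuilt_error`). Its increments lie between two fixed multiples of the step when `N` is
large and `N e` is small, and damping preserves such bounds, so the grids stay quasi-uniform
(`FrontBounds.exists_outer_step`).

Recursion. With `D` the distribution error and `e` the inner error, for large `N` one gets `D ←
(1-α) D + α (A/N² + B N e)` and `e ← η (e + Q α (D + A/N² + B N e))`, valid while `N e ≤ c₁`. A
weight `C` on `e` balances the two feedbacks, so that `D + C e` contracts by `1 - α/4` up to `O(α
N⁻²)`: `C` is of order `N` if `η` is of order `1/N`, and of order one if `α` is of order `1/N`. The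
bound `N e ≤ c₁` is bootstrapped along the way, and boundedly many knots are absorbed into the
constants. -/

namespace SURF

open Filter Topology

/-! ### Strong convexity -/

section StrongConvexity

variable {V : Type*} [NormedAddCommGroup V] [NormedSpace ℝ V]

/-- The first-order lower bound of a strongly convex function. -/
theorem strongConvexOn_first_order {s : Set V} {μ : ℝ} {f : V → ℝ} (hf : StrongConvexOn s μ f)
    {x y : V} (hx : x ∈ s) (hy : y ∈ s) {f' : V →L[ℝ] ℝ} (hd : HasFDerivAt f f' x) :
    f x + f' (y - x) + μ / 2 * ‖y - x‖ ^ 2 ≤ f y := by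
  have hline : HasDerivAt (fun t : ℝ => x + t • (y - x)) (y - x) 0 := by
    simpa using ((hasDerivAt_id (0 : ℝ)).smul_const (y - x)).const_add x
  have hd' : HasDerivAt (fun t : ℝ => f (x + t • (y - x))) (f' (y - x)) 0 := by
    have : HasFDerivAt f f' (x + (0 : ℝ) • (y - x)) := by simpa using hd
    exact this.comp_hasDerivAt (0 : ℝ) hline
  have hlim := hd'.tendsto_slope_zero_right
  have hlim2 : Tendsto (fun t : ℝ => f y - f x - (1 - t) * (μ / 2 * ‖y - x‖ ^ 2)) (𝓝[>] 0)
      (𝓝 (f y - f x - (1 - 0) * (μ / 2 * ‖y - x‖ ^ 2))) := by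
    apply Tendsto.mono_left _ nhdsWithin_le_nhds
    apply Continuous.tendsto
    fun_prop
  have hle := le_of_tendsto_of_tendsto hlim hlim2 ?_
  · linarith
  · filter_upwards [Ioo_mem_nhdsGT (zero_lt_one (α := ℝ))] with t ht
    have h1 := hf.2 hx hy (by linarith [ht.2] : 0 ≤ 1 - t) ht.1.le (by ring)
    have e : (1 - t) • x + t • y = x + t • (y - x) := by
      rw [smul_sub, sub_smul, one_smul]; abel
    rw [e, norm_sub_rev] at h1
    simp only [smul_eq_mul, zero_add, zero_smul, add_zero] at h1 ⊢
    rw [inv_mul_le_iff₀ ht.1]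
    nlinarith

/-- The second derivative of a strongly convex function along a feasible direction. -/
theorem strongConvexOn_second_order {s : Set V} {μ : ℝ} {f : V → ℝ} (hf : StrongConvexOn s μ f)
    {x z : V} {f' : V → V →L[ℝ] ℝ} {f'' : V →L[ℝ] V →L[ℝ] ℝ}
    (hs : ∀ y ∈ s, HasFDerivAt f (f' y) y) (hd : HasFDerivAt f' f'' x) (hx : x ∈ s)
    (hz : ∀ᶠ t in 𝓝[>] (0 : ℝ), x + t • z ∈ s) :
    μ * ‖z‖ ^ 2 ≤ f'' z z := by
  have hline : HasDerivAt (fun t : ℝ => x + t • z) z 0 := by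
    simpa using ((hasDerivAt_id (0 : ℝ)).smul_const z).const_add x
  have hd' : HasDerivAt (fun t : ℝ => f' (x + t • z) z) (f'' z z) 0 := by
    have : HasFDerivAt f' f'' (x + (0 : ℝ) • z) := by simpa using hd
    have h1 : HasDerivAt (fun t : ℝ => f' (x + t • z)) (f'' z) 0 :=
      this.comp_hasDerivAt (0 : ℝ) hline
    simpa using h1.clm_apply (hasDerivAt_const (0 : ℝ) z)
  refine ge_of_tendsto hd'.tendsto_slope_zero_right ?_
  filter_upwards [hz, self_mem_nhdsWithin] with t ht (h0 : 0 < t)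
  -- Adding the first-order bounds in both directions cancels the function values and gives strong
  -- monotonicity of the derivative; two divisions by `t` remain.
  have h1 := strongConvexOn_first_order hf hx ht (hs x hx)
  have h2 := strongConvexOn_first_order hf ht hx (hs _ ht)
  simp only [add_sub_cancel_left, sub_add_cancel_left, norm_neg, norm_smul, map_smul, map_neg,
    Real.norm_eq_abs, mul_pow, sq_abs, smul_eq_mul, zero_add, zero_smul, add_zero] at h1 h2 ⊢
  rw [inv_mul_eq_div, le_div_iff₀ h0]
  have : t * (μ * ‖z‖ ^ 2 * t) ≤ t * (f' (x + t • z) z - f' x z) := by nlinarith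
  exact le_of_mul_le_mul_left this h0

/-- Quadratic growth of a strongly convex function at a minimizer. -/
theorem strongConvexOn_growth {s : Set V} {μ : ℝ} {f : V → ℝ} (hf : StrongConvexOn s μ f)
    {x y : V} (hx : x ∈ s) (hy : y ∈ s) (hmin : IsMinOn f s x) :
    f x + μ / 2 * ‖y - x‖ ^ 2 ≤ f y := by
  have key : ∀ t ∈ Ioo (0 : ℝ) 1, (1 - t) * (μ / 2 * ‖y - x‖ ^ 2) ≤ f y - f x := by
    intro t ht
    have h1 := hf.2 hx hy (by linarith [ht.2] : 0 ≤ 1 - t) ht.1.le (by ring)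
    have h2 : f x ≤ f ((1 - t) • x + t • y) :=
      hmin (hf.1 hx hy (by linarith [ht.2] : 0 ≤ 1 - t) ht.1.le (by ring))
    rw [norm_sub_rev] at h1
    simp only [smul_eq_mul] at h1
    have : t * ((1 - t) * (μ / 2 * ‖y - x‖ ^ 2)) ≤ t * (f y - f x) := by nlinarith
    exact le_of_mul_le_mul_left this ht.1
  have hlim : Tendsto (fun t : ℝ => (1 - t) * (μ / 2 * ‖y - x‖ ^ 2)) (𝓝[>] 0)
      (𝓝 ((1 - 0) * (μ / 2 * ‖y - x‖ ^ 2))) := by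
    apply Tendsto.mono_left _ nhdsWithin_le_nhds
    apply Continuous.tendsto
    fun_prop
  have := le_of_tendsto hlim (by
    filter_upwards [Ioo_mem_nhdsGT (zero_lt_one (α := ℝ))] with t ht using key t ht)
  linarith

/-- A differentiable strongly convex function attains its minimum on a closed set. -/
theorem strongConvexOn_exists_isMinOn [ProperSpace V] {s : Set V} {μ : ℝ} {f : V → ℝ}
    (hμ : 0 < μ) (hf : StrongConvexOn s μ f) (hclosed : IsClosed s) (hne : s.Nonempty)
    (hd : ∀ x ∈ s, DifferentiableAt ℝ f x) : ∃ x ∈ s, IsMinOn f s x := by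
  obtain ⟨x₀, hx₀⟩ := hne
  -- Beyond this radius the quadratic term of the first-order bound dominates the linear one, so
  -- values exceed `f x₀`.
  set r := 2 * ‖fderiv ℝ f x₀‖ / μ with hr
  have hr0 : 0 ≤ r := by positivity
  have hcont : ContinuousOn f (s ∩ Metric.closedBall x₀ r) :=
    fun x hx => (hd x hx.1).continuousAt.continuousWithinAt
  obtain ⟨x, hx, hmin⟩ := ((isCompact_closedBall x₀ r).inter_left hclosed).exists_isMinOn
    ⟨x₀, hx₀, Metric.mem_closedBall_self hr0⟩ hcont
  refine ⟨x, hx.1, fun y hy => ?_⟩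
  by_cases hyr : y ∈ Metric.closedBall x₀ r
  · exact hmin ⟨hy, hyr⟩
  · have h1 : f x ≤ f x₀ := hmin ⟨hx₀, Metric.mem_closedBall_self hr0⟩
    have h2 := strongConvexOn_first_order hf hx₀ hy (hd x₀ hx₀).hasFDerivAt
    have h3 : -(‖fderiv ℝ f x₀‖ * ‖y - x₀‖) ≤ fderiv ℝ f x₀ (y - x₀) :=
      (abs_le.1 ((fderiv ℝ f x₀).le_opNorm (y - x₀))).1
    rw [Metric.mem_closedBall, dist_eq_norm, not_le, hr, div_lt_iff₀ hμ] at hyr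
    have h4 : 0 ≤ ‖y - x₀‖ := norm_nonneg _
    simp only [mem_ofPred_eq]
    nlinarith

end StrongConvexity

/-! ### Auxiliary facts on Lipschitz bounds and linear functionals. -/

/-- A function that is `C¹` on a neighbourhood of a compact set is Lipschitz on it. -/
theorem exists_lipschitz_of_contDiffOn {V W : Type*} [NormedAddCommGroup V] [NormedSpace ℝ V]
    [NormedAddCommGroup W] [NormedSpace ℝ W] {O S : Set V} {F : V → W} (hO : IsOpen O)
    (hF : ContDiffOn ℝ 1 F O) (hS : IsCompact S) (hSO : S ⊆ O) :
    ∃ C : ℝ, 0 ≤ C ∧ ∀ x ∈ S, ∀ y ∈ S, ‖F x - F y‖ ≤ C * ‖x - y‖ := by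
  have hloc : LocallyLipschitzOn S F := by
    intro x hx
    obtain ⟨K, t, ht, hK⟩ := (hF.contDiffAt (hO.mem_nhds (hSO hx))).exists_lipschitzOnWith
    exact ⟨K, t, mem_nhdsWithin_of_mem_nhds ht, hK⟩
  obtain ⟨K, hK⟩ := hloc.exists_lipschitzOnWith_of_compact hS
  refine ⟨K, K.2, fun x hx y hy => ?_⟩
  simpa [dist_eq_norm] using! hK.dist_le_mul x hx y hy

/-- Linearly independent functionals take arbitrary values simultaneously. -/
theorem exists_forall_apply_eq {ι V : Type*} [Finite ι] [NormedAddCommGroup V] [NormedSpace ℝ V]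
    {a : ι → V →L[ℝ] ℝ} (ha : LinearIndependent ℝ a) (r : ι → ℝ) : ∃ z, ∀ i, a i z = r i := by
  classical
  have := Fintype.ofFinite ι
  let T : V →ₗ[ℝ] (ι → ℝ) := LinearMap.pi fun i => (a i).toLinearMap
  suffices h : LinearMap.range T = ⊤ by
    obtain ⟨z, hz⟩ : r ∈ LinearMap.range T := h ▸ Submodule.mem_top
    exact ⟨z, fun i => congrFun hz i⟩
  -- A proper range lies in the kernel of a nonzero functional, whose coordinates are the
  -- coefficients of a vanishing combination of the `a i`.
  by_contra hne
  obtain ⟨φ, hφ, hle⟩ := (LinearMap.range T).exists_le_ker_of_lt_top (lt_top_iff_ne_top.2 hne)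
  have hφe : ∀ y, φ y = ∑ i, y i * φ (Pi.single i 1) := by
    intro y
    conv_lhs => rw [← Finset.univ_sum_single y, map_sum]
    refine Finset.sum_congr rfl fun i _ => ?_
    rw [← smul_eq_mul, ← map_smul, ← Pi.single_smul, smul_eq_mul, mul_one]
  have hsum : ∑ i, φ (Pi.single i 1) • a i = 0 := by
    ext z
    have h1 : φ (T z) = 0 := hle ⟨z, rfl⟩
    rw [hφe] at h1
    simpa [T, mul_comm] using! h1
  have h0 := Fintype.linearIndependent_iff.1 ha _ hsum
  exact hφ (LinearMap.ext fun y => by rw [hφe]; simp [h0])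

end SURF

namespace SURF

namespace Problem

open Filter Topology

variable {d p k q : ℕ} {P : Problem d p k q}

/-! ### Elementary properties of the constraints -/

theorem con_inr_hasFDerivAt (j : Fin q) (x : E p) :
    HasFDerivAt (P.con (Sum.inr j)) (LinearMap.toContinuousLinearMap (P.c₂ j).linear) x := by
  have h : P.con (Sum.inr j) =
      fun x => LinearMap.toContinuousLinearMap (P.c₂ j).linear x + P.c₂ j 0 := by
    funext x
    change P.c₂ j x = _
    rw [AffineMap.decomp (P.c₂ j)]
    simp
  rw [h]
  exact (ContinuousLinearMap.hasFDerivAt _).add_const _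

theorem fderiv_con_inr (j : Fin q) :
    fderiv ℝ (P.con (Sum.inr j)) = fun _ => LinearMap.toContinuousLinearMap (P.c₂ j).linear :=
  funext fun x => (con_inr_hasFDerivAt j x).fderiv

theorem con_inr_add (j : Fin q) (x z : E p) :
    P.con (Sum.inr j) (x + z) = P.con (Sum.inr j) x + fderiv ℝ (P.con (Sum.inr j)) x z := by
  rw [fderiv_con_inr]
  change P.c₂ j (x + z) = P.c₂ j x + (P.c₂ j).linear z
  have := (P.c₂ j).map_vadd x z
  simp only [vadd_eq_add] at this
  rw [add_comm x, this, add_comm]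

theorem ConstraintRegular.differentiable_con (hcon : P.ConstraintRegular) (a : Fin k ⊕ Fin q) :
    Differentiable ℝ (P.con a) := by
  rcases a with i | j
  · exact hcon.diff i
  · exact fun x => (con_inr_hasFDerivAt j x).differentiableAt

theorem ConstraintRegular.differentiable_fderiv_con (hcon : P.ConstraintRegular)
    (a : Fin k ⊕ Fin q) : Differentiable ℝ (fderiv ℝ (P.con a)) := by
  rcases a with i | j
  · exact hcon.diff_two i
  · rw [fderiv_con_inr]; exact differentiable_const _

theorem ConstraintRegular.lipschitz_fderiv_con (hcon : P.ConstraintRegular) :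
    ∃ l : ℝ, 0 ≤ l ∧ ∀ a x y,
      ‖fderiv ℝ (P.con a) x - fderiv ℝ (P.con a) y‖ ≤ l * ‖x - y‖ := by
  choose l hl using hcon.lipschitz_smooth
  refine ⟨∑ i, (l i : ℝ), Finset.sum_nonneg fun i _ => (l i).2, ?_⟩
  rintro (i | j) x y
  · have h1 : ‖fderiv ℝ (P.c₁ i) x - fderiv ℝ (P.c₁ i) y‖ ≤ l i * ‖x - y‖ := by
      simpa [dist_eq_norm] using! (hl i).dist_le_mul x y
    refine h1.trans (mul_le_mul_of_nonneg_right ?_ (norm_nonneg _))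
    exact Finset.single_le_sum (f := fun i => (l i : ℝ)) (fun i _ => (l i).2) (Finset.mem_univ i)
  · rw [fderiv_con_inr]
    simp only [sub_self, norm_zero]
    exact mul_nonneg (Finset.sum_nonneg fun i _ => (l i).2) (norm_nonneg _)

theorem ConstraintRegular.mem_X (hcon : P.ConstraintRegular) {x : E p} :
    x ∈ P.X ↔ (∀ i, P.con (Sum.inl i) x ≤ 0) ∧ ∀ j, P.con (Sum.inr j) x = 0 := by
  rw [hcon.feasible]; rfl

theorem ConstraintRegular.isClosed_X (hcon : P.ConstraintRegular) : IsClosed P.X := by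
  have : P.X = (⋂ i, {x | P.con (Sum.inl i) x ≤ 0}) ∩ ⋂ j, {x | P.con (Sum.inr j) x = 0} := by
    ext x
    rw [hcon.mem_X]
    simp
  rw [this]
  exact (isClosed_iInter fun i => isClosed_le (hcon.differentiable_con _).continuous
    continuous_const).inter (isClosed_iInter fun j =>
      isClosed_eq (hcon.differentiable_con _).continuous continuous_const)

/-! ### The scalarized problem -/

theorem HiddenRegular.nonempty_X (hreg : P.HiddenRegular) : P.X.Nonempty := by
  obtain ⟨u, hu⟩ := hreg.nonempty
  exact ⟨P.g u, hreg.bij.mapsTo hu⟩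

theorem HiddenRegular.differentiableAt_f (hreg : P.HiddenRegular) (m : Fin 2) {x : E p}
    (hx : x ∈ P.X) : DifferentiableAt ℝ (P.f m) x := by
  obtain ⟨O, hO, hXO, hf⟩ := hreg.smooth
  exact ((hf m).contDiffAt (hO.mem_nhds (hXO hx))).differentiableAt (by norm_num)

theorem HiddenRegular.differentiableAt_fderiv_f (hreg : P.HiddenRegular) (m : Fin 2) {x : E p}
    (hx : x ∈ P.X) : DifferentiableAt ℝ (fderiv ℝ (P.f m)) x := by
  obtain ⟨O, hO, hXO, hf⟩ := hreg.smooth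
  exact (((hf m).fderiv_of_isOpen hO (m := 1) (by norm_num)).contDiffAt
    (hO.mem_nhds (hXO hx))).differentiableAt (by norm_num)

theorem strongConvexOn_LS {μ : ℝ} (hs : ∀ m, StrongConvexOn P.X μ (P.f m)) {w : ℝ}
    (hw : w ∈ Icc (0 : ℝ) 1) : StrongConvexOn P.X μ (P.LS w) := by
  refine ⟨(hs 0).1, fun x hx y hy a b ha hb hab => ?_⟩
  have h0 := mul_le_mul_of_nonneg_left ((hs 0).2 hx hy ha hb hab) hw.1
  have h1 := mul_le_mul_of_nonneg_left ((hs 1).2 hx hy ha hb hab) (sub_nonneg.2 hw.2)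
  simp only [LS, smul_eq_mul] at *
  linarith

theorem HiddenRegular.hasFDerivAt_LS (hreg : P.HiddenRegular) (w : ℝ) {x : E p} (hx : x ∈ P.X) :
    HasFDerivAt (P.LS w) (w • fderiv ℝ (P.f 0) x + (1 - w) • fderiv ℝ (P.f 1) x) x :=
  ((hreg.differentiableAt_f 0 hx).hasFDerivAt.const_mul w).add
    ((hreg.differentiableAt_f 1 hx).hasFDerivAt.const_mul (1 - w))

theorem exists_isMinOn_LS (hreg : P.HiddenRegular) (hcon : P.ConstraintRegular) {w : ℝ}
    (hw : w ∈ Icc (0 : ℝ) 1) : ∃ x ∈ P.X, IsMinOn (P.LS w) P.X x := by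
  obtain ⟨μ, hμ, hs⟩ := hreg.strong
  exact strongConvexOn_exists_isMinOn hμ (strongConvexOn_LS hs hw) hcon.isClosed_X hreg.nonempty_X
    fun x hx => (hreg.hasFDerivAt_LS w hx).differentiableAt

theorem xStar_mem (hreg : P.HiddenRegular) (hcon : P.ConstraintRegular) {w : ℝ}
    (hw : w ∈ Icc (0 : ℝ) 1) : P.xStar w ∈ P.X := by
  have H := exists_isMinOn_LS hreg hcon hw
  rw [xStar, dif_pos H]
  exact H.choose_spec.1

theorem xStar_isMinOn (hreg : P.HiddenRegular) (hcon : P.ConstraintRegular) {w : ℝ}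
    (hw : w ∈ Icc (0 : ℝ) 1) : IsMinOn (P.LS w) P.X (P.xStar w) := by
  have H := exists_isMinOn_LS hreg hcon hw
  rw [xStar, dif_pos H]
  exact H.choose_spec.2

/-- Quadratic growth at each of the two minimizers, added: the two scalarizations differ by `w - w'`
times `f₁ - f₂`, which is all that survives on the right. -/
theorem xStar_dist (hreg : P.HiddenRegular) (hcon : P.ConstraintRegular) :
    ∃ μ : ℝ, 0 < μ ∧ ∀ w ∈ Icc (0 : ℝ) 1, ∀ w' ∈ Icc (0 : ℝ) 1,
      μ * ‖P.xStar w - P.xStar w'‖ ^ 2 ≤ (w - w') *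
        ((P.f 0 (P.xStar w') - P.f 1 (P.xStar w')) - (P.f 0 (P.xStar w) - P.f 1 (P.xStar w))) := by
  obtain ⟨μ, hμ, hs⟩ := hreg.strong
  refine ⟨μ, hμ, fun w hw w' hw' => ?_⟩
  have h1 := strongConvexOn_growth (strongConvexOn_LS hs hw) (xStar_mem hreg hcon hw)
    (xStar_mem hreg hcon hw') (xStar_isMinOn hreg hcon hw)
  have h2 := strongConvexOn_growth (strongConvexOn_LS hs hw') (xStar_mem hreg hcon hw')
    (xStar_mem hreg hcon hw) (xStar_isMinOn hreg hcon hw')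
  rw [norm_sub_rev] at h1
  simp only [LS] at h1 h2
  nlinarith

/-- Boundedness has to precede Lipschitz continuity, since Lipschitz constants of the objectives
exist only on compact sets. It follows from the first-order bound at `P.xStar 0`, whose gradients
are bounded uniformly in the weight. -/
theorem xStar_bounded (hreg : P.HiddenRegular) (hcon : P.ConstraintRegular) :
    ∃ r : ℝ, 0 ≤ r ∧ ∀ w ∈ Icc (0 : ℝ) 1, ‖P.xStar w - P.xStar 0‖ ≤ r := by
  obtain ⟨μ, hμ, hs⟩ := hreg.strong
  have h0 : (0 : ℝ) ∈ Icc (0 : ℝ) 1 := by simp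
  set x₀ := P.xStar 0
  have hx₀ : x₀ ∈ P.X := xStar_mem hreg hcon h0
  set G := ‖fderiv ℝ (P.f 0) x₀‖ + ‖fderiv ℝ (P.f 1) x₀‖ with hG
  have hG0 : 0 ≤ G := by positivity
  refine ⟨2 * G / μ, by positivity, fun w hw => ?_⟩
  have h1 := strongConvexOn_first_order (strongConvexOn_LS hs hw) hx₀ (xStar_mem hreg hcon hw)
    (hreg.hasFDerivAt_LS w hx₀)
  have h2 : P.LS w (P.xStar w) ≤ P.LS w x₀ := xStar_isMinOn hreg hcon hw hx₀
  set y := P.xStar w - x₀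
  have h3 : -(G * ‖y‖) ≤ (w • fderiv ℝ (P.f 0) x₀ + (1 - w) • fderiv ℝ (P.f 1) x₀) y := by
    refine (abs_le.1 ?_).1
    rw [← Real.norm_eq_abs]
    refine (ContinuousLinearMap.le_opNorm _ y).trans
      (mul_le_mul_of_nonneg_right ?_ (norm_nonneg _))
    refine (norm_add_le _ _).trans (add_le_add ?_ ?_) <;>
      rw [norm_smul, Real.norm_eq_abs] <;>
      refine mul_le_of_le_one_left (norm_nonneg _) (abs_le.2 ⟨?_, ?_⟩) <;>
      linarith [hw.1, hw.2]
  rw [le_div_iff₀ hμ]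
  by_contra hc
  have : 0 < ‖y‖ := by
    by_contra h
    have : ‖y‖ = 0 := le_antisymm (not_lt.1 h) (norm_nonneg _)
    rw [this] at hc
    simp only [zero_mul, not_le] at hc
    linarith
  nlinarith

/-- The part of the feasible set within distance `1` of a ball containing the path. -/
theorem exists_compact_tube (hreg : P.HiddenRegular) (hcon : P.ConstraintRegular) :
    ∃ S : Set (E p), IsCompact S ∧ S ⊆ P.X ∧
      ∀ w ∈ Icc (0 : ℝ) 1, ∀ x ∈ P.X, ‖x - P.xStar w‖ ≤ 1 → x ∈ S := by
  obtain ⟨r, -, hr⟩ := xStar_bounded hreg hcon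
  refine ⟨P.X ∩ Metric.closedBall (P.xStar 0) (1 + r),
    (isCompact_closedBall _ _).inter_left hcon.isClosed_X, inter_subset_left, ?_⟩
  intro w hw x hx h
  refine ⟨hx, ?_⟩
  rw [Metric.mem_closedBall, dist_eq_norm]
  calc ‖x - P.xStar 0‖ = ‖(x - P.xStar w) + (P.xStar w - P.xStar 0)‖ := by congr 1; abel
    _ ≤ _ := (norm_add_le _ _).trans (add_le_add h (hr w hw))

/-- Lipschitz bounds for the objectives and their derivatives near the path. -/
theorem exists_lipschitz_tube (hreg : P.HiddenRegular) (hcon : P.ConstraintRegular) :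
    ∃ S : Set (E p), S ⊆ P.X ∧
      (∀ w ∈ Icc (0 : ℝ) 1, ∀ x ∈ P.X, ‖x - P.xStar w‖ ≤ 1 → x ∈ S) ∧
      ∃ C : ℝ, 0 ≤ C ∧ ∀ m, ∀ x ∈ S, ∀ y ∈ S, |P.f m x - P.f m y| ≤ C * ‖x - y‖ ∧
        ‖fderiv ℝ (P.f m) x - fderiv ℝ (P.f m) y‖ ≤ C * ‖x - y‖ ∧ ‖fderiv ℝ (P.f m) x‖ ≤ C := by
  obtain ⟨S, hS, hSX, hmem⟩ := exists_compact_tube hreg hcon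
  obtain ⟨O, hO, hXO, hf⟩ := hreg.smooth
  have hSO := hSX.trans hXO
  have h1 : ∀ m, ∃ C : ℝ, 0 ≤ C ∧ ∀ x ∈ S, ∀ y ∈ S, ‖P.f m x - P.f m y‖ ≤ C * ‖x - y‖ :=
    fun m => exists_lipschitz_of_contDiffOn hO ((hf m).of_le (by norm_num)) hS hSO
  have hd : ∀ m, ContDiffOn ℝ 1 (fderiv ℝ (P.f m)) O :=
    fun m => (hf m).fderiv_of_isOpen hO (m := 1) (by norm_num)
  have h2 := fun m => exists_lipschitz_of_contDiffOn hO (hd m) hS hSO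
  have h3 := fun m => hS.exists_bound_of_continuousOn ((hd m).continuousOn.mono hSO)
  choose C₁ hC₁ H₁ using h1
  choose C₂ hC₂ H₂ using h2
  choose C₃ H₃ using h3
  have hle : ∀ m, C₁ m ≤ ∑ m, (C₁ m + C₂ m + |C₃ m|) ∧ C₂ m ≤ ∑ m, (C₁ m + C₂ m + |C₃ m|) ∧
      C₃ m ≤ ∑ m, (C₁ m + C₂ m + |C₃ m|) := by
    intro m
    have : C₁ m + C₂ m + |C₃ m| ≤ ∑ m, (C₁ m + C₂ m + |C₃ m|) :=
      Finset.single_le_sum (f := fun m => C₁ m + C₂ m + |C₃ m|)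
        (fun m _ => add_nonneg (add_nonneg (hC₁ m) (hC₂ m)) (abs_nonneg _)) (Finset.mem_univ m)
    refine ⟨?_, ?_, ?_⟩ <;>
      linarith [hC₁ m, hC₂ m, le_abs_self (C₃ m), abs_nonneg (C₃ m)]
  refine ⟨S, hSX, hmem, ∑ m, (C₁ m + C₂ m + |C₃ m|),
    Finset.sum_nonneg fun m _ => add_nonneg (add_nonneg (hC₁ m) (hC₂ m)) (abs_nonneg _), ?_⟩
  exact fun m x hx y hy =>
    ⟨(H₁ m x hx y hy).trans (mul_le_mul_of_nonneg_right (hle m).1 (norm_nonneg _)),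
    (H₂ m x hx y hy).trans (mul_le_mul_of_nonneg_right (hle m).2.1 (norm_nonneg _)),
    (H₃ m x hx).trans (hle m).2.2⟩

/-- The right side of `xStar_dist` is at most `|w - w'|` times `2 C` times the distance of the two
minimizers, so one factor of that distance cancels. -/
theorem xStar_lipschitz (hreg : P.HiddenRegular) (hcon : P.ConstraintRegular) :
    ∃ L : ℝ, 0 ≤ L ∧ ∀ w ∈ Icc (0 : ℝ) 1, ∀ w' ∈ Icc (0 : ℝ) 1,
      ‖P.xStar w - P.xStar w'‖ ≤ L * |w - w'| := by
  obtain ⟨μ, hμ, hdist⟩ := xStar_dist hreg hcon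
  obtain ⟨S, hSX, hmem, C, hC, hlip⟩ := exists_lipschitz_tube hreg hcon
  refine ⟨2 * C / μ, by positivity, fun w hw w' hw' => ?_⟩
  have hm : ∀ w ∈ Icc (0 : ℝ) 1, P.xStar w ∈ S :=
    fun w hw => hmem w hw _ (xStar_mem hreg hcon hw) (by simp)
  have h0 := (hlip 0 _ (hm w hw) _ (hm w' hw')).1
  have h1 := (hlip 1 _ (hm w hw) _ (hm w' hw')).1
  have h2 := hdist w hw w' hw'
  set D := ‖P.xStar w - P.xStar w'‖
  have h3 : |(P.f 0 (P.xStar w') - P.f 1 (P.xStar w')) -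
      (P.f 0 (P.xStar w) - P.f 1 (P.xStar w))| ≤ 2 * C * D := by
    rw [abs_le] at *
    constructor <;> linarith
  have h4 : μ * D ^ 2 ≤ |w - w'| * (2 * C * D) :=
    h2.trans ((le_abs_self _).trans (by
      rw [abs_mul]; exact mul_le_mul_of_nonneg_left h3 (abs_nonneg _)))
  have hD : 0 ≤ D := norm_nonneg _
  rw [div_mul_eq_mul_div, le_div_iff₀ hμ]
  rcases hD.eq_or_lt with h | h
  · rw [← h, zero_mul]; positivity
  · refine le_of_mul_le_mul_left ?_ h
    linarith

/-! ### Multipliers -/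

theorem sum_eq_sum_subtype {ι M : Type*} [Fintype ι] [AddCommMonoid M] {s : Set ι} [Fintype s]
    {F : ι → M} (h : ∀ a, a ∉ s → F a = 0) : ∑ a, F a = ∑ a : s, F a := by
  classical
  rw [← Finset.sum_subtype (Finset.univ.filter (· ∈ s)) (by simp) F]
  refine (Finset.sum_subset (Finset.filter_subset _ _) fun a _ ha => h a ?_).symm
  simpa using ha

theorem inr_mem_active (hreg : P.HiddenRegular) (hcon : P.ConstraintRegular) {w : ℝ}
    (hw : w ∈ Icc (0 : ℝ) 1) (j : Fin q) : Sum.inr j ∈ P.active w :=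
  (hcon.mem_X.1 (xStar_mem hreg hcon hw)).2 j

/-- Directions that strictly decrease the active inequality constraints and preserve the equality
constraints are feasible. -/
theorem eventually_feasible (hreg : P.HiddenRegular) (hcon : P.ConstraintRegular) {w : ℝ}
    (hw : w ∈ Icc (0 : ℝ) 1) {z : E p}
    (hz₁ : ∀ i, Sum.inl i ∈ P.active w → fderiv ℝ (P.con (Sum.inl i)) (P.xStar w) z < 0)
    (hz₂ : ∀ j, fderiv ℝ (P.con (Sum.inr j)) (P.xStar w) z = 0) :
    ∀ᶠ t in 𝓝[>] (0 : ℝ), P.xStar w + t • z ∈ P.X := by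
  have hx := hcon.mem_X.1 (xStar_mem hreg hcon hw)
  have hline : HasDerivAt (fun t : ℝ => P.xStar w + t • z) z 0 := by
    simpa using ((hasDerivAt_id (0 : ℝ)).smul_const z).const_add (P.xStar w)
  have h1 : ∀ i, ∀ᶠ t in 𝓝[>] (0 : ℝ), P.con (Sum.inl i) (P.xStar w + t • z) ≤ 0 := by
    intro i
    by_cases ha : Sum.inl i ∈ P.active w
    · have hd : HasDerivAt (fun t : ℝ => P.con (Sum.inl i) (P.xStar w + t • z))
          (fderiv ℝ (P.con (Sum.inl i)) (P.xStar w) z) 0 := by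
        have : HasFDerivAt (P.con (Sum.inl i)) (fderiv ℝ (P.con (Sum.inl i)) (P.xStar w))
            (P.xStar w + (0 : ℝ) • z) := by
          simpa using (hcon.differentiable_con (Sum.inl i) (P.xStar w)).hasFDerivAt
        exact this.comp_hasDerivAt (0 : ℝ) hline
      have h := hd.tendsto_slope_zero_right.eventually_lt_const (hz₁ i ha)
      filter_upwards [h, self_mem_nhdsWithin] with t ht (ht0 : 0 < t)
      have h0 : P.con (Sum.inl i) (P.xStar w) = 0 := ha
      simp only [zero_add, zero_smul, add_zero, h0, sub_zero, smul_eq_mul] at ht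
      by_contra hc
      exact absurd ht (not_lt.2 (mul_nonneg (inv_nonneg.2 ht0.le) (not_le.1 hc).le))
    · have hlt : P.con (Sum.inl i) (P.xStar w) < 0 := lt_of_le_of_ne (hx.1 i) ha
      have hc : ContinuousAt (fun t : ℝ => P.con (Sum.inl i) (P.xStar w + t • z)) 0 :=
        ((hcon.differentiable_con (Sum.inl i)).continuous.comp (by fun_prop)).continuousAt
      have h := hc.eventually_lt_const (u := 0) (by simpa using hlt)
      exact (h.filter_mono nhdsWithin_le_nhds).mono fun t ht => ht.le
  filter_upwards [eventually_all.2 h1] with t ht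
  refine hcon.mem_X.2 ⟨ht, fun j => ?_⟩
  rw [con_inr_add, map_smul, hz₂ j, hx.2 j]
  simp

/-- A direction along which every active inequality constraint decreases at unit rate. -/
theorem exists_interior_direction (hcon : P.ConstraintRegular) {w : ℝ}
    (hw : w ∈ Icc (0 : ℝ) 1) : ∃ z : E p,
      (∀ i, Sum.inl i ∈ P.active w → fderiv ℝ (P.con (Sum.inl i)) (P.xStar w) z = -1) ∧
      ∀ j, Sum.inr j ∈ P.active w → fderiv ℝ (P.con (Sum.inr j)) (P.xStar w) z = 0 := by
  obtain ⟨z, hz⟩ := exists_forall_apply_eq (hcon.licq w hw)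
    (fun a => Sum.elim (fun _ => -1) (fun _ => 0) a.1)
  exact ⟨z, fun i hi => hz ⟨_, hi⟩, fun j hj => hz ⟨_, hj⟩⟩

/-- First-order optimality along the linearized feasible cone. -/
theorem stationary_nonneg (hreg : P.HiddenRegular) (hcon : P.ConstraintRegular) {w : ℝ}
    (hw : w ∈ Icc (0 : ℝ) 1) {z : E p}
    (hz₁ : ∀ i, Sum.inl i ∈ P.active w → fderiv ℝ (P.con (Sum.inl i)) (P.xStar w) z ≤ 0)
    (hz₂ : ∀ j, fderiv ℝ (P.con (Sum.inr j)) (P.xStar w) z = 0) :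
    0 ≤ (w • fderiv ℝ (P.f 0) (P.xStar w) + (1 - w) • fderiv ℝ (P.f 1) (P.xStar w)) z := by
  obtain ⟨z₀, hz₀, hz₀'⟩ := exists_interior_direction hcon hw
  set ℓ := w • fderiv ℝ (P.f 0) (P.xStar w) + (1 - w) • fderiv ℝ (P.f 1) (P.xStar w)
  have hxm := xStar_mem hreg hcon hw
  -- A direction in the linearized cone need not be feasible; tilting it by the interior direction
  -- makes it so, and `ε → 0` removes the tilt.
  have key : ∀ ε : ℝ, 0 < ε → 0 ≤ ℓ (z + ε • z₀) := by
    intro ε hε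
    have hfeas := eventually_feasible hreg hcon hw (z := z + ε • z₀)
      (fun i hi => by
        rw [map_add, map_smul, hz₀ i hi, smul_eq_mul]; linarith [hz₁ i hi])
      (fun j => by
        rw [map_add, map_smul, hz₂ j, hz₀' j (inr_mem_active hreg hcon hw j)]; simp)
    have hline : HasDerivAt (fun t : ℝ => P.xStar w + t • (z + ε • z₀)) (z + ε • z₀) 0 := by
      simpa using ((hasDerivAt_id (0 : ℝ)).smul_const (z + ε • z₀)).const_add (P.xStar w)
    have hd : HasDerivAt (fun t : ℝ => P.LS w (P.xStar w + t • (z + ε • z₀)))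
        (ℓ (z + ε • z₀)) 0 := by
      have : HasFDerivAt (P.LS w) ℓ (P.xStar w + (0 : ℝ) • (z + ε • z₀)) := by
        simpa using hreg.hasFDerivAt_LS w hxm
      exact this.comp_hasDerivAt (0 : ℝ) hline
    refine ge_of_tendsto hd.tendsto_slope_zero_right ?_
    filter_upwards [hfeas, self_mem_nhdsWithin] with t ht (ht0 : 0 < t)
    have hm : P.LS w (P.xStar w) ≤ P.LS w (P.xStar w + t • (z + ε • z₀)) :=
      xStar_isMinOn hreg hcon hw ht
    simp only [zero_add, zero_smul, add_zero, smul_eq_mul]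
    exact mul_nonneg (inv_nonneg.2 ht0.le) (sub_nonneg.2 hm)
  have hlim : Tendsto (fun ε : ℝ => ℓ (z + ε • z₀)) (𝓝[>] 0) (𝓝 (ℓ (z + (0 : ℝ) • z₀))) := by
    apply Tendsto.mono_left _ nhdsWithin_le_nhds
    apply Continuous.tendsto
    fun_prop
  have := ge_of_tendsto hlim (by filter_upwards [self_mem_nhdsWithin] with ε hε using key ε hε)
  simpa using this

/-- Existence of Karush–Kuhn–Tucker multipliers. -/
theorem exists_isMultiplier (hreg : P.HiddenRegular) (hcon : P.ConstraintRegular) {w : ℝ}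
    (hw : w ∈ Icc (0 : ℝ) 1) : ∃ ν, P.IsMultiplier w ν := by
  classical
  set ℓ := w • fderiv ℝ (P.f 0) (P.xStar w) + (1 - w) • fderiv ℝ (P.f 1) (P.xStar w) with hℓ
  have hinr := inr_mem_active hreg hcon hw
  -- Stationarity for both `z` and `-z` makes `ℓ` vanish on the common kernel of the active
  -- gradients, so it is a combination of them.
  have hspan : ℓ.toLinearMap ∈ Submodule.span ℝ (range fun a : P.active w =>
      (fderiv ℝ (P.con a) (P.xStar w)).toLinearMap) := by
    refine mem_span_of_iInf_ker_le_ker fun z hz => ?_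
    have hz' : ∀ a ∈ P.active w, fderiv ℝ (P.con a) (P.xStar w) z = 0 := fun a ha => by
      have := (Submodule.mem_iInf _).1 hz ⟨a, ha⟩
      simpa using this
    have h1 := stationary_nonneg hreg hcon hw (z := z) (fun i hi => (hz' _ hi).le)
      (fun j => hz' _ (hinr j))
    have h2 := stationary_nonneg hreg hcon hw (z := -z)
      (fun i hi => by rw [map_neg, hz' _ hi, neg_zero])
      (fun j => by rw [map_neg, hz' _ (hinr j), neg_zero])
    rw [map_neg] at h2
    exact le_antisymm (neg_nonneg.1 h2) h1
  obtain ⟨c, hc⟩ := (Submodule.mem_span_range_iff_exists_fun ℝ).1 hspan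
  let ν : Fin k ⊕ Fin q → ℝ := fun a => if h : a ∈ P.active w then -c ⟨a, h⟩ else 0
  have hsum : ∑ a, ν a • fderiv ℝ (P.con a) (P.xStar w) = -ℓ := by
    have h1 : ∑ a, ν a • fderiv ℝ (P.con a) (P.xStar w)
        = ∑ a : P.active w, ν a • fderiv ℝ (P.con a) (P.xStar w) :=
      sum_eq_sum_subtype fun a ha => by simp [ν, ha]
    have h2 : ∑ a : P.active w, c a • fderiv ℝ (P.con a) (P.xStar w) = ℓ := by
      ext z
      have := congrArg (fun T : E p →ₗ[ℝ] ℝ => T z) hc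
      simpa using this
    rw [h1, ← h2, ← Finset.sum_neg_distrib]
    refine Finset.sum_congr rfl fun a _ => ?_
    simp [ν]
  refine ⟨ν, fun i => ?_, fun a ha => by simp [ν, ha], by rw [hsum, ← hℓ, add_neg_cancel]⟩
  by_cases hi : Sum.inl i ∈ P.active w
  -- A direction that decreases only the `i`-th active constraint isolates the sign of `ν (Sum.inl
  -- i)`.
  · obtain ⟨z, hz⟩ := exists_forall_apply_eq (hcon.licq w hw)
      (fun a => if a.1 = Sum.inl i then -1 else 0)
    have h1 := stationary_nonneg hreg hcon hw (z := z)
      (fun i' hi' => by rw [hz ⟨_, hi'⟩]; dsimp only; split_ifs <;> norm_num)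
      (fun j => by rw [hz ⟨_, hinr j⟩]; simp)
    have h2 := congrArg (fun T : E p →L[ℝ] ℝ => T z) hsum
    simp only [sum_apply, smul_apply,
      neg_apply, smul_eq_mul] at h2
    rw [Finset.sum_eq_single (Sum.inl i), hz ⟨_, hi⟩] at h2
    · simp only [if_true] at h2
      linarith
    · intro b _ hb
      by_cases hb' : b ∈ P.active w
      · rw [hz ⟨b, hb'⟩]; simp [hb]
      · simp [ν, hb']
    · simp
  · simp [ν, hi]

end Problem

end SURF

namespace SURF

open Filter Topology

/-! ### Lipschitz families on the unit interval -/

/-- `F` is Lipschitz on `[0,1]`. -/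
def LipOn {V : Type*} [NormedAddCommGroup V] (F : ℝ → V) : Prop :=
  ∃ L : ℝ, 0 ≤ L ∧ ∀ w ∈ Icc (0 : ℝ) 1, ∀ w' ∈ Icc (0 : ℝ) 1, ‖F w - F w'‖ ≤ L * |w - w'|

section LipOn

variable {V W Z : Type*} [NormedAddCommGroup V] [NormedAddCommGroup W] [NormedAddCommGroup Z]

theorem LipOn.continuousOn {F : ℝ → V} (h : LipOn F) : ContinuousOn F (Icc 0 1) := by
  obtain ⟨L, hL, h⟩ := h
  refine (LipschitzOnWith.of_dist_le_mul (K := ⟨L, hL⟩) fun x hx y hy => ?_).continuousOn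
  simpa [dist_eq_norm] using! h x hx y hy

theorem LipOn.bounded {F : ℝ → V} (h : LipOn F) :
    ∃ B : ℝ, 0 ≤ B ∧ ∀ w ∈ Icc (0 : ℝ) 1, ‖F w‖ ≤ B := by
  obtain ⟨B, hB⟩ := isCompact_Icc.exists_bound_of_continuousOn h.continuousOn
  exact ⟨B, (norm_nonneg _).trans (hB 0 (by simp)), hB⟩

theorem LipOn.add {F G : ℝ → V} (hF : LipOn F) (hG : LipOn G) : LipOn fun w => F w + G w := by
  obtain ⟨L, hL, h⟩ := hF
  obtain ⟨L', hL', h'⟩ := hG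
  refine ⟨L + L', add_nonneg hL hL', fun w hw w' hw' => ?_⟩
  rw [add_sub_add_comm, add_mul]
  exact (norm_add_le _ _).trans (add_le_add (h w hw w' hw') (h' w hw w' hw'))

theorem LipOn.neg {F : ℝ → V} (hF : LipOn F) : LipOn fun w => -F w := by
  obtain ⟨L, hL, h⟩ := hF
  refine ⟨L, hL, fun w hw w' hw' => ?_⟩
  rw [← neg_sub', norm_neg]
  exact h w hw w' hw'

theorem LipOn.sub {F G : ℝ → V} (hF : LipOn F) (hG : LipOn G) : LipOn fun w => F w - G w := by
  simpa [sub_eq_add_neg] using hF.add hG.neg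

theorem LipOn.const (v : V) : LipOn fun _ => v := ⟨0, le_rfl, by simp⟩

theorem LipOn.id : LipOn fun w : ℝ => w := ⟨1, zero_le_one, by simp⟩

theorem LipOn.prodMk {F : ℝ → V} {G : ℝ → W} (hF : LipOn F) (hG : LipOn G) :
    LipOn fun w => (F w, G w) := by
  obtain ⟨L, hL, h⟩ := hF
  obtain ⟨L', hL', h'⟩ := hG
  refine ⟨L + L', add_nonneg hL hL', fun w hw w' hw' => ?_⟩
  rw [Prod.mk_sub_mk, Prod.norm_mk]
  refine max_le ((h w hw w' hw').trans ?_) ((h' w hw w' hw').trans ?_) <;>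
    exact mul_le_mul_of_nonneg_right (by linarith) (abs_nonneg _)

theorem LipOn.pi {ι : Type*} [Fintype ι] {F : ι → ℝ → V} (hF : ∀ i, LipOn (F i)) :
    LipOn fun w i => F i w := by
  choose L hL h using hF
  refine ⟨∑ i, L i, Finset.sum_nonneg fun i _ => hL i, fun w hw w' hw' => ?_⟩
  refine (pi_norm_le_iff_of_nonneg
    (mul_nonneg (Finset.sum_nonneg fun i _ => hL i) (abs_nonneg _))).2 fun i => ?_
  refine (h i w hw w' hw').trans (mul_le_mul_of_nonneg_right ?_ (abs_nonneg _))
  exact Finset.single_le_sum (fun i _ => hL i) (Finset.mem_univ i)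

theorem LipOn.comp_norm_le {F : ℝ → V} {G : ℝ → W} (hF : LipOn F) {C : ℝ} (hC : 0 ≤ C)
    (h : ∀ w ∈ Icc (0 : ℝ) 1, ∀ w' ∈ Icc (0 : ℝ) 1, ‖G w - G w'‖ ≤ C * ‖F w - F w'‖) :
    LipOn G := by
  obtain ⟨L, hL, hF⟩ := hF
  refine ⟨C * L, mul_nonneg hC hL, fun w hw w' hw' => (h w hw w' hw').trans ?_⟩
  rw [mul_assoc]
  exact mul_le_mul_of_nonneg_left (hF w hw w' hw') hC

variable [NormedSpace ℝ V] [NormedSpace ℝ W] [NormedSpace ℝ Z]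

theorem LipOn.clm (T : V →L[ℝ] W) {F : ℝ → V} (hF : LipOn F) : LipOn fun w => T (F w) :=
  hF.comp_norm_le (norm_nonneg T) fun w _ w' _ => by
    rw [← map_sub]; exact T.le_opNorm _

theorem LipOn.clm_apply {T : ℝ → V →L[ℝ] W} {F : ℝ → V} (hT : LipOn T) (hF : LipOn F) :
    LipOn fun w => T w (F w) := by
  obtain ⟨B, hB, hTB⟩ := hT.bounded
  obtain ⟨B', hB', hFB⟩ := hF.bounded
  obtain ⟨L, hL, hT⟩ := hT
  obtain ⟨L', hL', hF⟩ := hF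
  refine ⟨L * B' + B * L', by positivity, fun w hw w' hw' => ?_⟩
  have e : T w (F w) - T w' (F w') = (T w - T w') (F w) + T w' (F w - F w') := by
    rw [sub_apply, map_sub]; abel
  rw [e]
  refine (norm_add_le _ _).trans ?_
  have h1 := ((T w - T w').le_opNorm (F w)).trans
    (mul_le_mul (hT w hw w' hw') (hFB w hw) (norm_nonneg _) (by positivity))
  have h2 := ((T w').le_opNorm (F w - F w')).trans
    (mul_le_mul (hTB w' hw') (hF w hw w' hw') (norm_nonneg _) hB)
  linarith

theorem LipOn.smul {c : ℝ → ℝ} {F : ℝ → V} (hc : LipOn c) (hF : LipOn F) :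
    LipOn fun w => c w • F w :=
  LipOn.clm_apply (hc.clm (ContinuousLinearMap.lsmul ℝ ℝ : ℝ →L[ℝ] V →L[ℝ] V)) hF

/-- A continuous family of injective operators on a finite-dimensional space is uniformly bounded
below on `[0,1]`. -/
theorem exists_uniform_lower_bound [FiniteDimensional ℝ V] {T : ℝ → V →L[ℝ] W}
    (hT : ContinuousOn T (Icc 0 1)) (hinj : ∀ w ∈ Icc (0 : ℝ) 1, ∀ y, T w y = 0 → y = 0) :
    ∃ κ : ℝ, 0 < κ ∧ ∀ w ∈ Icc (0 : ℝ) 1, ∀ y, κ * ‖y‖ ≤ ‖T w y‖ := by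
  have : ProperSpace V := FiniteDimensional.proper ℝ V
  -- The constant is the minimum of `‖T w y‖` over this compact set. The sphere is empty only in the
  -- trivial space, where any constant serves.
  by_cases hne : (Icc (0 : ℝ) 1 ×ˢ Metric.sphere (0 : V) 1).Nonempty
  · have hcont : ContinuousOn (fun z : ℝ × V => ‖T z.1 z.2‖)
        (Icc (0 : ℝ) 1 ×ˢ Metric.sphere (0 : V) 1) := by
      refine ContinuousOn.norm (ContinuousOn.clm_apply ?_ continuousOn_snd)
      exact hT.comp continuousOn_fst fun z hz => hz.1
    obtain ⟨z, hz, hmin⟩ := (isCompact_Icc.prod (isCompact_sphere _ _)).exists_isMinOn hne hcont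
    have hz2 : ‖z.2‖ = 1 := by simpa using hz.2
    refine ⟨‖T z.1 z.2‖, norm_pos_iff.2 fun h => ?_, fun w hw y => ?_⟩
    · rw [hinj _ hz.1 _ h, norm_zero] at hz2
      exact zero_ne_one hz2
    · rcases eq_or_ne y 0 with rfl | hy
      · simp
      · have hy' : 0 < ‖y‖ := norm_pos_iff.2 hy
        have h := hmin (show (w, ‖y‖⁻¹ • y) ∈ Icc (0 : ℝ) 1 ×ˢ Metric.sphere (0 : V) 1 from
          ⟨hw, by simp [norm_smul, hy'.ne']⟩)
        simp only [mem_ofPred_eq, map_smul, norm_smul, norm_inv, norm_norm] at h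
        rwa [inv_mul_eq_div, le_div_iff₀ hy'] at h
  · refine ⟨1, one_pos, fun w hw y => ?_⟩
    rcases eq_or_ne y 0 with rfl | hy
    · simp
    · exact absurd ⟨(w, ‖y‖⁻¹ • y), hw, by simp [norm_smul, hy]⟩ hne

/-- Solutions of a Lipschitz family of uniformly invertible linear equations are Lipschitz. -/
theorem LipOn.of_linear_eq {T : ℝ → V →L[ℝ] W} {b : ℝ → W} {y : ℝ → V} (hT : LipOn T)
    (hb : LipOn b) {κ : ℝ} (hκ : 0 < κ) (hlow : ∀ w ∈ Icc (0 : ℝ) 1, ∀ y, κ * ‖y‖ ≤ ‖T w y‖)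
    (hy : ∀ w ∈ Icc (0 : ℝ) 1, T w (y w) = b w) : LipOn y := by
  obtain ⟨B, hB, hbB⟩ := hb.bounded
  obtain ⟨L, hL, hT⟩ := hT
  obtain ⟨L', hL', hb⟩ := hb
  refine ⟨(L' + L * (B / κ)) / κ, by positivity, fun w hw w' hw' => ?_⟩
  have hyB : ‖y w'‖ ≤ B / κ := by
    rw [le_div_iff₀ hκ, mul_comm]
    exact (hlow w' hw' _).trans (by rw [hy w' hw']; exact hbB w' hw')
  have e : T w (y w - y w') = (b w - b w') - (T w - T w') (y w') := by
    rw [map_sub, hy w hw, sub_apply, hy w' hw']; abel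
  have h1 := hlow w hw (y w - y w')
  rw [e] at h1
  have h2 := (h1.trans (norm_sub_le _ _)).trans (add_le_add (hb w hw w' hw')
    (((T w - T w').le_opNorm (y w')).trans
      (mul_le_mul (hT w hw w' hw') hyB (norm_nonneg _) (by positivity))))
  rw [div_mul_eq_mul_div, le_div_iff₀ hκ]
  linarith

end LipOn

/-! ### Saddle-point operators -/

section Saddle

variable {ι V : Type*} [Fintype ι] [NormedAddCommGroup V] [NormedSpace ℝ V]

/-- The saddle-point operator `(x, ν) ↦ (H x + ∑ νᵢ aᵢ, (aᵢ x)ᵢ)`. -/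
noncomputable def saddle (H : V →L[ℝ] V →L[ℝ] ℝ) (a : ι → V →L[ℝ] ℝ) :
    (V × (ι → ℝ)) →L[ℝ] ((V →L[ℝ] ℝ) × (ι → ℝ)) :=
  (H.comp (ContinuousLinearMap.fst ℝ V (ι → ℝ)) + ∑ i, ContinuousLinearMap.smulRight
    ((ContinuousLinearMap.proj i).comp (ContinuousLinearMap.snd ℝ V (ι → ℝ))) (a i)).prod
    (ContinuousLinearMap.pi fun i => (a i).comp (ContinuousLinearMap.fst ℝ V (ι → ℝ)))

theorem saddle_apply (H : V →L[ℝ] V →L[ℝ] ℝ) (a : ι → V →L[ℝ] ℝ) (y : V × (ι → ℝ)) :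
    saddle H a y = (H y.1 + ∑ i, y.2 i • a i, fun i => a i y.1) := by
  ext <;> simp [saddle]

/-- Pairing the first equation with `y.1` kills the multiplier terms by the second equation;
coercivity then gives `y.1 = 0`, and independence gives `y.2 = 0`. -/
theorem saddle_injective {H : V →L[ℝ] V →L[ℝ] ℝ} {a : ι → V →L[ℝ] ℝ}
    (ha : LinearIndependent ℝ a) {μ : ℝ} (hμ : 0 < μ)
    (hH : ∀ z, (∀ i, a i z = 0) → μ * ‖z‖ ^ 2 ≤ H z z) (y : V × (ι → ℝ))
    (hy : saddle H a y = 0) : y = 0 := by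
  rw [saddle_apply, Prod.mk_eq_zero] at hy
  have h2 : ∀ i, a i y.1 = 0 := fun i => congrFun hy.2 i
  have h1 := congrArg (fun T : V →L[ℝ] ℝ => T y.1) hy.1
  simp [h2] at h1
  have h3 := hH y.1 h2
  rw [h1] at h3
  have hx : y.1 = 0 := by
    by_contra h
    have : 0 < ‖y.1‖ := norm_pos_iff.2 h
    have : 0 < μ * ‖y.1‖ ^ 2 := by positivity
    linarith
  have h4 := hy.1
  rw [hx, map_zero, zero_add] at h4
  exact Prod.ext hx (funext (Fintype.linearIndependent_iff.1 ha _ h4))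

theorem LipOn.saddle {H : ℝ → V →L[ℝ] V →L[ℝ] ℝ} {a : ℝ → ι → V →L[ℝ] ℝ} (hH : LipOn H)
    (ha : LipOn a) : LipOn fun w => saddle (H w) (a w) := by
  obtain ⟨L, hL, hH⟩ := hH
  obtain ⟨L', hL', ha⟩ := ha
  refine ⟨L + (Fintype.card ι + 1) * L', by positivity, fun w hw w' hw' => ?_⟩
  refine ContinuousLinearMap.opNorm_le_bound _ (by positivity) fun y => ?_
  have hai : ∀ i, ‖a w i - a w' i‖ ≤ L' * |w - w'| := fun i =>
    (norm_le_pi_norm (a w - a w') i).trans (ha w hw w' hw')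
  have hy1 : ‖y.1‖ ≤ ‖y‖ := norm_fst_le y
  have hy2 : ∀ i, ‖y.2 i‖ ≤ ‖y‖ := fun i => (norm_le_pi_norm y.2 i).trans (norm_snd_le y)
  rw [sub_apply, saddle_apply, saddle_apply, Prod.mk_sub_mk, Prod.norm_mk]
  refine max_le ?_ ?_
  · have e : H w y.1 + ∑ i, y.2 i • a w i - (H w' y.1 + ∑ i, y.2 i • a w' i)
        = (H w - H w') y.1 + ∑ i, y.2 i • (a w i - a w' i) := by
      simp only [smul_sub, Finset.sum_sub_distrib, sub_apply]; abel
    rw [e]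
    have h1 := ((H w - H w').le_opNorm y.1).trans
      (mul_le_mul (hH w hw w' hw') hy1 (norm_nonneg _) (by positivity))
    have h2 : ‖∑ i, y.2 i • (a w i - a w' i)‖ ≤ ∑ _i : ι, ‖y‖ * (L' * |w - w'|) :=
      norm_sum_le_of_le _ fun i _ => by
        rw [norm_smul]
        exact mul_le_mul (hy2 i) (hai i) (norm_nonneg _) (norm_nonneg _)
    rw [Finset.sum_const, Finset.card_univ, nsmul_eq_mul] at h2
    have h3 : 0 ≤ L' * |w - w'| * ‖y‖ := by positivity
    refine (norm_add_le _ _).trans ?_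
    linarith
  · refine (pi_norm_le_iff_of_nonneg (by positivity)).2 fun i => ?_
    have h1 := ((a w i - a w' i).le_opNorm y.1).trans
      (mul_le_mul (hai i) hy1 (norm_nonneg _) (by positivity))
    have h2 : 0 ≤ L * |w - w'| * ‖y‖ := by positivity
    have h3 : 0 ≤ Fintype.card ι * (L' * |w - w'| * ‖y‖) := by positivity
    have h4 : ‖a w i y.1 - a w' i y.1‖ ≤ L' * |w - w'| * ‖y‖ := h1
    simp only [Pi.sub_apply]
    linarith

/-- Injectivity suffices because domain and codomain have equal dimension. -/
theorem saddle_surjective {V : Type*} [NormedAddCommGroup V] [InnerProductSpace ℝ V]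
    [FiniteDimensional ℝ V] {H : V →L[ℝ] V →L[ℝ] ℝ} {a : ι → V →L[ℝ] ℝ}
    (hinj : ∀ y, saddle H a y = 0 → y = 0) (b : (V →L[ℝ] ℝ) × (ι → ℝ)) :
    ∃ y, saddle H a y = b := by
  have hV : Module.finrank ℝ (V →L[ℝ] ℝ) = Module.finrank ℝ V := by
    rw [← (LinearMap.toContinuousLinearMap : (V →ₗ[ℝ] ℝ) ≃ₗ[ℝ] V →L[ℝ] ℝ).finrank_eq]
    exact Subspace.dual_finrank_eq
  have hfin : Module.finrank ℝ (V × (ι → ℝ)) = Module.finrank ℝ ((V →L[ℝ] ℝ) × (ι → ℝ)) := by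
    rw [Module.finrank_prod, Module.finrank_prod, hV]
  have h := (LinearMap.injective_iff_surjective_of_finrank_eq_finrank hfin
    (f := (saddle H a).toLinearMap)).1
    ((injective_iff_map_eq_zero _).2 hinj)
  exact h b

end Saddle

end SURF

namespace SURF

namespace Problem

open Filter Topology

variable {d p k q : ℕ} {P : Problem d p k q}

/-! ### Regularity of the solution path -/

noncomputable instance fintypeActive (w : ℝ) : Fintype (P.active w) := Fintype.ofFinite _

theorem lipOn_xStar (hreg : P.HiddenRegular) (hcon : P.ConstraintRegular) : LipOn P.xStar :=
  xStar_lipschitz hreg hcon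

theorem lipOn_fderiv_f (hreg : P.HiddenRegular) (hcon : P.ConstraintRegular) (m : Fin 2) :
    LipOn fun w => fderiv ℝ (P.f m) (P.xStar w) := by
  obtain ⟨S, hSX, hmem, C, hC, hlip⟩ := exists_lipschitz_tube hreg hcon
  have hm : ∀ w ∈ Icc (0 : ℝ) 1, P.xStar w ∈ S :=
    fun w hw => hmem w hw _ (xStar_mem hreg hcon hw) (by simp)
  exact (lipOn_xStar hreg hcon).comp_norm_le hC fun w hw w' hw' =>
    (hlip m _ (hm w hw) _ (hm w' hw')).2.1

theorem lipOn_fderiv_con (hreg : P.HiddenRegular) (hcon : P.ConstraintRegular) :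
    LipOn fun w (a : P.active 0) => fderiv ℝ (P.con a) (P.xStar w) := by
  obtain ⟨l, hl, h⟩ := hcon.lipschitz_fderiv_con
  exact LipOn.pi (F := fun (a : P.active 0) w => fderiv ℝ (P.con a) (P.xStar w)) fun a =>
    (lipOn_xStar hreg hcon).comp_norm_le hl fun w _ w' _ => h a _ _

/-- Indexing by `P.active 0` puts multipliers and saddle operators of all weights into the same
spaces, so that they can be compared. -/
theorem active_eq (hcon : P.ConstraintRegular) {w : ℝ} (hw : w ∈ Icc (0 : ℝ) 1) :
    P.active w = P.active 0 :=
  hcon.fixed w hw 0 (by simp)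

theorem licq_zero (hcon : P.ConstraintRegular) {w : ℝ} (hw : w ∈ Icc (0 : ℝ) 1) :
    LinearIndependent ℝ (fun a : P.active 0 => fderiv ℝ (P.con a) (P.xStar w)) := by
  have h := hcon.licq w hw
  rwa [active_eq hcon hw] at h

/-- The Hessians of the objectives are coercive on tangent directions. -/
theorem hessian_f_coercive (hreg : P.HiddenRegular) (hcon : P.ConstraintRegular) {μ : ℝ}
    (hs : ∀ m, StrongConvexOn P.X μ (P.f m)) {w : ℝ} (hw : w ∈ Icc (0 : ℝ) 1) {z : E p}
    (hz : ∀ a ∈ P.active w, fderiv ℝ (P.con a) (P.xStar w) z = 0) (m : Fin 2) :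
    μ * ‖z‖ ^ 2 ≤ fderiv ℝ (fderiv ℝ (P.f m)) (P.xStar w) z z := by
  obtain ⟨z₀, hz₀, hz₀'⟩ := exists_interior_direction hcon hw
  have hxm := xStar_mem hreg hcon hw
  set Q := fderiv ℝ (fderiv ℝ (P.f m)) (P.xStar w)
  -- Strong convexity is available on `P.X` only, so the tangent direction is first tilted into it
  -- and the tilt is then removed.
  have key : ∀ ε : ℝ, 0 < ε → μ * ‖z + ε • z₀‖ ^ 2 ≤ Q (z + ε • z₀) (z + ε • z₀) := by
    intro ε hε
    refine strongConvexOn_second_order (hs m)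
      (fun y hy => (hreg.differentiableAt_f m hy).hasFDerivAt)
      (hreg.differentiableAt_fderiv_f m hxm).hasFDerivAt hxm
      (eventually_feasible hreg hcon hw (fun i hi => ?_) fun j => ?_)
    · rw [map_add, map_smul, hz _ hi, hz₀ i hi, smul_eq_mul]; linarith
    · have hj := inr_mem_active hreg hcon hw j
      rw [map_add, map_smul, hz _ hj, hz₀' j hj]; simp
  have hlim1 : Tendsto (fun ε : ℝ => Q (z + ε • z₀) (z + ε • z₀)) (𝓝[>] 0)
      (𝓝 (Q (z + (0 : ℝ) • z₀) (z + (0 : ℝ) • z₀))) := by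
    apply Tendsto.mono_left _ nhdsWithin_le_nhds
    apply Continuous.tendsto
    fun_prop
  have hlim2 : Tendsto (fun ε : ℝ => μ * ‖z + ε • z₀‖ ^ 2) (𝓝[>] 0)
      (𝓝 (μ * ‖z + (0 : ℝ) • z₀‖ ^ 2)) := by
    apply Tendsto.mono_left _ nhdsWithin_le_nhds
    apply Continuous.tendsto
    fun_prop
  have := le_of_tendsto_of_tendsto hlim2 hlim1
    (by filter_upwards [self_mem_nhdsWithin] with ε hε using key ε hε)
  simpa using this

/-- Convexity is strong convexity with modulus zero. -/
theorem hessian_con_nonneg (hcon : P.ConstraintRegular) (i : Fin k) (x z : E p) :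
    0 ≤ fderiv ℝ (fderiv ℝ (P.con (Sum.inl i))) x z z := by
  have h := strongConvexOn_second_order (μ := 0) (z := z)
    (strongConvexOn_zero.2 (hcon.convex i))
    (fun y _ => (hcon.differentiable_con (Sum.inl i) y).hasFDerivAt)
    (hcon.differentiable_fderiv_con (Sum.inl i) x).hasFDerivAt (mem_univ x)
    (Eventually.of_forall fun t => mem_univ _)
  simpa using h

/-- The Hessian of the Lagrangian is coercive on the tangent space. -/
theorem lagrangianHessian_coercive (hreg : P.HiddenRegular) (hcon : P.ConstraintRegular) :
    ∃ μ : ℝ, 0 < μ ∧ ∀ w ∈ Icc (0 : ℝ) 1, ∀ ν, P.IsMultiplier w ν → ∀ z : E p,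
      (∀ a ∈ P.active w, fderiv ℝ (P.con a) (P.xStar w) z = 0) →
        μ * ‖z‖ ^ 2 ≤ P.lagrangianHessian w ν z z := by
  obtain ⟨μ, hμ, hs⟩ := hreg.strong
  refine ⟨μ, hμ, fun w hw ν hν z hz => ?_⟩
  have h0 := mul_le_mul_of_nonneg_left (hessian_f_coercive hreg hcon hs hw hz 0) hw.1
  have h1 := mul_le_mul_of_nonneg_left (hessian_f_coercive hreg hcon hs hw hz 1)
    (sub_nonneg.2 hw.2)
  have h2 : 0 ≤ ∑ a, ν a * fderiv ℝ (fderiv ℝ (P.con a)) (P.xStar w) z z := by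
    refine Finset.sum_nonneg fun a _ => ?_
    rcases a with i | j
    · exact mul_nonneg (hν.nonneg i) (hessian_con_nonneg hcon i _ z)
    · rw [fderiv_con_inr]; simp
  simp only [lagrangianHessian, add_apply, smul_apply, sum_apply, smul_eq_mul]
  linarith

/-- The map whose zeros are the stationary pairs of the scalarized problem. -/
noncomputable def kktMap (P : Problem d p k q) (y : (E p × (P.active 0 → ℝ)) × ℝ) :
    (E p →L[ℝ] ℝ) × (P.active 0 → ℝ) :=
  (y.2 • fderiv ℝ (P.f 0) y.1.1 + (1 - y.2) • fderiv ℝ (P.f 1) y.1.1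
    + ∑ a : P.active 0, y.1.2 a • fderiv ℝ (P.con a) y.1.1, fun a => P.con a y.1.1)

theorem lagrangianHessian_eq (hcon : P.ConstraintRegular) {w : ℝ} (hw : w ∈ Icc (0 : ℝ) 1)
    {ν : Fin k ⊕ Fin q → ℝ} (hν : P.IsMultiplier w ν) :
    P.lagrangianHessian w ν = w • fderiv ℝ (fderiv ℝ (P.f 0)) (P.xStar w)
      + (1 - w) • fderiv ℝ (fderiv ℝ (P.f 1)) (P.xStar w)
      + ∑ a : P.active 0, ν a • fderiv ℝ (fderiv ℝ (P.con a)) (P.xStar w) := by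
  rw [lagrangianHessian, sum_eq_sum_subtype (s := P.active 0)]
  intro a ha
  rw [hν.slack a (by rwa [active_eq hcon hw]), zero_smul]

/-- The constraints are only twice differentiable, so strict differentiability, as the usual
implicit function theorem needs, is not given. Differentiability at points of the path is enough,
because the path is already known to be Lipschitz. -/
theorem hasFDerivAt_kktMap (hreg : P.HiddenRegular) (hcon : P.ConstraintRegular) {w : ℝ}
    (hw : w ∈ Icc (0 : ℝ) 1) {ν : Fin k ⊕ Fin q → ℝ} (hν : P.IsMultiplier w ν) :
    ∃ T : (E p × (P.active 0 → ℝ)) × ℝ →L[ℝ] (E p →L[ℝ] ℝ) × (P.active 0 → ℝ),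
      HasFDerivAt P.kktMap T ((P.xStar w, fun a => ν a), w) ∧
      ∀ y t, T (y, t) = saddle (P.lagrangianHessian w ν)
        (fun a : P.active 0 => fderiv ℝ (P.con a) (P.xStar w)) y
        + t • (fderiv ℝ (P.f 0) (P.xStar w) - fderiv ℝ (P.f 1) (P.xStar w), 0) := by
  have hxm := xStar_mem hreg hcon hw
  set c : (E p × (P.active 0 → ℝ)) × ℝ := ((P.xStar w, fun a => ν a), w) with hc
  have hx : HasFDerivAt (fun y : (E p × (P.active 0 → ℝ)) × ℝ => y.1.1)
      ((ContinuousLinearMap.fst ℝ (E p) (P.active 0 → ℝ)).comp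
        (ContinuousLinearMap.fst ℝ (E p × (P.active 0 → ℝ)) ℝ)) c :=
    ContinuousLinearMap.hasFDerivAt ((ContinuousLinearMap.fst ℝ (E p) (P.active 0 → ℝ)).comp
      (ContinuousLinearMap.fst ℝ (E p × (P.active 0 → ℝ)) ℝ))
  have ht : HasFDerivAt (fun y : (E p × (P.active 0 → ℝ)) × ℝ => y.2)
      (ContinuousLinearMap.snd ℝ (E p × (P.active 0 → ℝ)) ℝ) c :=
    ContinuousLinearMap.hasFDerivAt (ContinuousLinearMap.snd ℝ (E p × (P.active 0 → ℝ)) ℝ)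
  have hn : ∀ a, HasFDerivAt (fun y : (E p × (P.active 0 → ℝ)) × ℝ => y.1.2 a)
      ((ContinuousLinearMap.proj a).comp ((ContinuousLinearMap.snd ℝ (E p) (P.active 0 → ℝ)).comp
        (ContinuousLinearMap.fst ℝ (E p × (P.active 0 → ℝ)) ℝ))) c :=
    fun a => ContinuousLinearMap.hasFDerivAt
      ((ContinuousLinearMap.proj a).comp ((ContinuousLinearMap.snd ℝ (E p) (P.active 0 → ℝ)).comp
        (ContinuousLinearMap.fst ℝ (E p × (P.active 0 → ℝ)) ℝ)))
  have hf : ∀ m, HasFDerivAt (fderiv ℝ (P.f m)) (fderiv ℝ (fderiv ℝ (P.f m)) (P.xStar w)) c.1.1 :=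
    fun m => (hreg.differentiableAt_fderiv_f m hxm).hasFDerivAt
  have hk : ∀ a : P.active 0, HasFDerivAt (fderiv ℝ (P.con a))
      (fderiv ℝ (fderiv ℝ (P.con a)) (P.xStar w)) c.1.1 :=
    fun a => (hcon.differentiable_fderiv_con a _).hasFDerivAt
  have hk' : ∀ a : P.active 0, HasFDerivAt (P.con a) (fderiv ℝ (P.con a) (P.xStar w)) c.1.1 :=
    fun a => (hcon.differentiable_con a _).hasFDerivAt
  have h1 := ((ht.smul ((hf 0).comp c hx)).add ((ht.const_sub 1).smul ((hf 1).comp c hx))).add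
    (HasFDerivAt.fun_sum (u := Finset.univ) fun a _ => (hn a).smul ((hk a).comp c hx))
  have h2 := hasFDerivAt_pi.2 fun a => (hk' a).comp c hx
  refine ⟨_, h1.prodMk h2, fun y t => ?_⟩
  rw [saddle_apply, lagrangianHessian_eq hcon hw hν]
  refine Prod.ext ?_ ?_
  · ext z
    simp [hc, Finset.sum_add_distrib]
    ring
  · ext a
    simp

end Problem

end SURF

namespace SURF

namespace Problem

open Filter Topology Asymptotics

variable {d p k q : ℕ} {P : Problem d p k q}

/-! ### Differentiability of the solution path. -/

/-- A gradient difference that is combined from active constraint gradients has zero projection. -/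
theorem starProjection_kerJ_eq_zero {w : ℝ}
    (h : ∀ z, (∀ a : P.active w, fderiv ℝ (P.con a) (P.xStar w) z = 0) →
      (fderiv ℝ (P.f 0) (P.xStar w) - fderiv ℝ (P.f 1) (P.xStar w)) z = 0) :
    (P.kerJ w).starProjection
      (gradient (P.f 0) (P.xStar w) - gradient (P.f 1) (P.xStar w)) = 0 := by
  refine Submodule.eq_starProjection_of_mem_of_inner_eq_zero (Submodule.zero_mem _) fun z hz => ?_
  have hz' : ∀ a : P.active w, fderiv ℝ (P.con a) (P.xStar w) z = 0 := fun a => by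
    have := (Submodule.mem_iInf _).1 hz a
    simpa using this
  have := h z hz'
  rw [sub_zero, inner_sub_left, gradient, gradient, InnerProductSpace.toDual_symm_apply,
    InnerProductSpace.toDual_symm_apply]
  exact this

/-- The solution path has a Lipschitz derivative, along which the two objectives trade off at a
uniformly positive rate. -/
theorem exists_path_derivative (hreg : P.HiddenRegular) (hcon : P.ConstraintRegular)
    (htrade : P.NonzeroTradeoff) :
    ∃ D : ℝ → E p, LipOn D ∧
      (∀ w ∈ Icc (0 : ℝ) 1, HasDerivWithinAt P.xStar (D w) (Icc 0 1) w) ∧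
      ∃ r : ℝ, 0 < r ∧ ∀ w ∈ Icc (0 : ℝ) 1,
        r ≤ (fderiv ℝ (P.f 1) (P.xStar w) - fderiv ℝ (P.f 0) (P.xStar w)) (D w) := by
  have hex : ∀ w : ℝ, ∃ ν, w ∈ Icc (0 : ℝ) 1 → P.IsMultiplier w ν := fun w => by
    by_cases hw : w ∈ Icc (0 : ℝ) 1
    · obtain ⟨ν, hν⟩ := exists_isMultiplier hreg hcon hw
      exact ⟨ν, fun _ => hν⟩
    · exact ⟨0, fun h => absurd h hw⟩
  choose ν hν using hex
  obtain ⟨μ, hμ, hcoer⟩ := lagrangianHessian_coercive hreg hcon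
  set a : ℝ → P.active 0 → E p →L[ℝ] ℝ := fun w a => fderiv ℝ (P.con a) (P.xStar w) with ha
  set T := fun w => saddle (P.lagrangianHessian w (ν w)) (a w) with hT
  set g := fun w => fderiv ℝ (P.f 0) (P.xStar w) - fderiv ℝ (P.f 1) (P.xStar w) with hg
  have hcoer' : ∀ w ∈ Icc (0 : ℝ) 1, ∀ z, (∀ i, a w i z = 0) →
      μ * ‖z‖ ^ 2 ≤ P.lagrangianHessian w (ν w) z z := fun w hw z hz =>
    hcoer w hw _ (hν w hw) z fun b hb => hz ⟨b, active_eq hcon hw ▸ hb⟩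
  have hH : LipOn fun w => P.lagrangianHessian w (ν w) := by
    obtain ⟨L, hL⟩ := hcon.hessian
    refine ⟨|L|, abs_nonneg _, fun w hw w' hw' => ?_⟩
    exact (hL w hw w' hw' _ _ (hν w hw) (hν w' hw')).trans
      (mul_le_mul_of_nonneg_right (le_abs_self L) (abs_nonneg _))
  have hTlip : LipOn T := LipOn.saddle hH (lipOn_fderiv_con hreg hcon)
  have hinj : ∀ w ∈ Icc (0 : ℝ) 1, ∀ y, T w y = 0 → y = 0 := fun w hw y hy =>
    saddle_injective (licq_zero hcon hw) hμ (hcoer' w hw) y hy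
  obtain ⟨κ, hκ, hlow⟩ := exists_uniform_lower_bound hTlip.continuousOn hinj
  have hglip : LipOn g := (lipOn_fderiv_f hreg hcon 0).sub (lipOn_fderiv_f hreg hcon 1)
  -- stationarity in terms of the constraints active along the path
  have hstat : ∀ w ∈ Icc (0 : ℝ) 1, w • fderiv ℝ (P.f 0) (P.xStar w)
      + (1 - w) • fderiv ℝ (P.f 1) (P.xStar w) + ∑ i : P.active 0, ν w i • a w i = 0 := by
    intro w hw
    rw [← (hν w hw).stationary, sum_eq_sum_subtype (s := P.active 0)]
    intro b hb
    rw [(hν w hw).slack b (by rwa [active_eq hcon hw]), zero_smul]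
  -- The pair `(0, ν)` solves a saddle equation: the zero component removes the Hessian, and what
  -- remains is stationarity. The uniform lower bound then makes the multipliers Lipschitz.
  have hνlip : LipOn fun w => ((0 : E p), fun i : P.active 0 => ν w i) := by
    refine LipOn.of_linear_eq hTlip (b := fun w => (-(w • fderiv ℝ (P.f 0) (P.xStar w)
      + (1 - w) • fderiv ℝ (P.f 1) (P.xStar w)), 0)) ?_ hκ hlow fun w hw => ?_
    · exact ((LipOn.id.smul (lipOn_fderiv_f hreg hcon 0)).add
        (((LipOn.const 1).sub LipOn.id).smul (lipOn_fderiv_f hreg hcon 1))).neg.prodMk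
        (LipOn.const 0)
    · rw [hT, saddle_apply]
      refine Prod.ext ?_ ?_
      · simp only [map_zero, zero_add]
        exact eq_neg_of_add_eq_zero_right (hstat w hw)
      · ext i; simp
  have hνlip' : LipOn fun w => fun i : P.active 0 => ν w i :=
    hνlip.clm (ContinuousLinearMap.snd ℝ (E p) (P.active 0 → ℝ))
  -- This equation is the KKT system formally differentiated in `w`; its solution is the candidate
  -- derivative of the pair of minimizer and multipliers.
  have hsol : ∀ w : ℝ, ∃ y, w ∈ Icc (0 : ℝ) 1 → T w y = (-g w, 0) := fun w => by
    by_cases hw : w ∈ Icc (0 : ℝ) 1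
    · obtain ⟨y, hy⟩ := saddle_surjective (hinj w hw) (-g w, 0)
      exact ⟨y, fun _ => hy⟩
    · exact ⟨0, fun h => absurd h hw⟩
  choose Y hY using hsol
  have hYlip : LipOn Y := LipOn.of_linear_eq hTlip (hglip.neg.prodMk (LipOn.const 0)) hκ hlow hY
  set D := fun w => (Y w).1 with hD
  have hDlip : LipOn D := hYlip.clm (ContinuousLinearMap.fst ℝ (E p) (P.active 0 → ℝ))
  have hDker : ∀ w ∈ Icc (0 : ℝ) 1, ∀ i, a w i (D w) = 0 := fun w hw i => by
    have := hY w hw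
    rw [hT, saddle_apply] at this
    exact congrFun (congrArg Prod.snd this) i
  have hDeq : ∀ w ∈ Icc (0 : ℝ) 1,
      P.lagrangianHessian w (ν w) (D w) + ∑ i, (Y w).2 i • a w i = -g w := fun w hw => by
    have := hY w hw
    rw [hT, saddle_apply] at this
    exact congrArg Prod.fst this
  -- Testing the differentiated system with `D w` itself eliminates the multipliers and leaves the
  -- Hessian quadratic form.
  have hpos : ∀ w ∈ Icc (0 : ℝ) 1, 0 < -(g w (D w)) := by
    intro w hw
    have h1 := congrArg (fun F : E p →L[ℝ] ℝ => F (D w)) (hDeq w hw)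
    simp only [add_apply, sum_apply, smul_apply, hDker w hw, smul_zero, Finset.sum_const_zero,
      add_zero, neg_apply] at h1
    rw [← h1]
    refine lt_of_lt_of_le ?_ (hcoer' w hw _ (hDker w hw))
    -- Otherwise the differentiated system writes `g w` as a combination of active constraint
    -- gradients, whose projection to the kernel vanishes.
    have hD0 : D w ≠ 0 := by
      intro h0
      obtain ⟨c, hc, hcw⟩ := htrade
      have h2 := hDeq w hw
      rw [h0, map_zero, zero_add] at h2
      have := hcw w hw
      rw [starProjection_kerJ_eq_zero, norm_zero] at this
      · linarith
      · intro z hz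
        have h3 := congrArg (fun F : E p →L[ℝ] ℝ => F z) h2
        have hz' : ∀ i : P.active 0, a w i z = 0 := fun i => hz ⟨i, (active_eq hcon hw).symm ▸ i.2⟩
        simp only [sum_apply, smul_apply, hz', smul_zero, Finset.sum_const_zero, neg_apply] at h3
        exact neg_eq_zero.1 h3.symm
    have := norm_pos_iff.2 hD0
    positivity
  refine ⟨D, hDlip, fun w hw => ?_, ?_⟩
  · -- linearize the stationarity system along the path
    obtain ⟨Q, hQ, hQe⟩ := hasFDerivAt_kktMap hreg hcon hw (hν w hw)
    set c : ℝ → (E p × (P.active 0 → ℝ)) × ℝ := fun t => ((P.xStar t, fun i => ν t i), t) with hc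
    have hclip : LipOn c := ((lipOn_xStar hreg hcon).prodMk hνlip').prodMk LipOn.id
    have hzero : ∀ t ∈ Icc (0 : ℝ) 1, P.kktMap (c t) = 0 := by
      intro t ht
      refine Prod.ext (hstat t ht) (funext fun i => ?_)
      have : (i : Fin k ⊕ Fin q) ∈ P.active t := by
        rw [active_eq hcon ht]
        exact i.2
      exact this
    have hcO : (fun t => c t - c w) =O[𝓝[Icc 0 1] w] fun t => t - w := by
      obtain ⟨L, hL, h⟩ := hclip
      refine IsBigO.of_bound L ?_
      filter_upwards [self_mem_nhdsWithin] with t ht using h t ht w hw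
    have hlit : (fun t => P.kktMap (c t) - P.kktMap (c w) - Q (c t - c w))
        =o[𝓝[Icc 0 1] w] fun t => t - w :=
      ((hQ.isLittleO).comp_tendsto (hclip.continuousOn w hw)).trans_isBigO hcO
    -- Since `P.kktMap` vanishes along the path, `Q (c t - c w)` is a pure linearization error. It
    -- equals the saddle operator applied to the deviation from the candidate derivative, and the
    -- lower bound `κ` transfers its smallness.
    have hlit2 : (fun t => ((c t).1 - (c w).1) - (t - w) • Y w)
        =o[𝓝[Icc 0 1] w] fun t => t - w := by
      refine IsBigO.trans_isLittleO (IsBigO.of_bound κ⁻¹ ?_) hlit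
      filter_upwards [self_mem_nhdsWithin] with t ht
      rw [hzero t ht, hzero w hw, sub_zero, zero_sub, norm_neg, inv_mul_eq_div, le_div_iff₀ hκ,
        mul_comm]
      refine (hlow w hw _).trans (le_of_eq ?_)
      have e : Q (c t - c w) = T w ((c t).1 - (c w).1) + (t - w) • (g w, 0) :=
        hQe ((c t).1 - (c w).1) (t - w)
      rw [e, map_sub, map_smul, hY w hw]
      rw [sub_eq_add_neg]
      congr 2
      refine Prod.ext ?_ ?_
      · change -((t - w) • -g w) = (t - w) • g w
        rw [smul_neg, neg_neg]
      · change -((t - w) • (0 : P.active 0 → ℝ)) = (t - w) • (0 : P.active 0 → ℝ)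
        rw [smul_zero, neg_zero]
    have hder : HasDerivWithinAt (fun t => (c t).1) (Y w) (Icc 0 1) w :=
      hasDerivWithinAt_iff_isLittleO.2 hlit2
    exact ((ContinuousLinearMap.fst ℝ (E p) (P.active 0 → ℝ)).hasFDerivAt.comp_hasDerivWithinAt w
      hder)
  · have hcont : ContinuousOn (fun w => -(g w (D w))) (Icc 0 1) :=
      (hglip.clm_apply hDlip).neg.continuousOn
    obtain ⟨w₀, hw₀, hmin⟩ := isCompact_Icc.exists_isMinOn (nonempty_Icc.2 zero_le_one) hcont
    refine ⟨_, hpos w₀ hw₀, fun w hw => ?_⟩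
    refine (hmin hw).trans (le_of_eq ?_)
    simp [hg]

/-! ### Quantitative bounds for the front. -/

/-- Quantitative regularity of the Pareto-front path, with derivative `G`. -/
structure FrontBounds (P : Problem d p k q) (G : ℝ → E 2) (Lx Lf K c : ℝ) : Prop where
  Lx_nonneg : 0 ≤ Lx
  Lf_nonneg : 0 ≤ Lf
  K_nonneg : 0 ≤ K
  c_pos : 0 < c
  deriv : ∀ w ∈ Icc (0 : ℝ) 1, HasDerivWithinAt P.fPF (G w) (Icc 0 1) w
  lip : ∀ w ∈ Icc (0 : ℝ) 1, ∀ w' ∈ Icc (0 : ℝ) 1, ‖G w - G w'‖ ≤ K * |w - w'|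
  lower : ∀ w ∈ Icc (0 : ℝ) 1, c ≤ ‖G w‖
  chord : ∀ a ∈ Icc (0 : ℝ) 1, ∀ b ∈ Icc (0 : ℝ) 1, a ≤ b →
    c * (b - a) ≤ ‖P.fPF b - P.fPF a‖
  xStar_lip : ∀ w ∈ Icc (0 : ℝ) 1, ∀ w' ∈ Icc (0 : ℝ) 1,
    ‖P.xStar w - P.xStar w'‖ ≤ Lx * |w - w'|
  objective : ∀ u ∈ P.U, ∀ w ∈ Icc (0 : ℝ) 1, ‖P.g u - P.xStar w‖ ≤ 1 →
    ‖P.hVec u - P.fPF w‖ ≤ Lf * ‖P.g u - P.xStar w‖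

theorem sub_le_two_mul_norm (x : E 2) : |x 1 - x 0| ≤ 2 * ‖x‖ := by
  have h : ∀ i, |x i| ≤ ‖x‖ := fun i => PiLp.norm_apply_le x i
  have := abs_sub (x 1) (x 0)
  linarith [h 0, h 1]

theorem norm_le_abs_add_abs (x : E 2) : ‖x‖ ≤ |x 0| + |x 1| := by
  rw [EuclideanSpace.norm_eq, Real.sqrt_le_left (by positivity)]
  simp only [Fin.sum_univ_two, Real.norm_eq_abs]
  nlinarith [abs_nonneg (x 0), abs_nonneg (x 1)]

/-- The scalar `f₂ - f₁` increases along the path at rate at least `r`. As it is at most twice the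
norm of the objective vector, speed and chords are bounded below with constant `r / 2`; in
particular the front cannot fold back. -/
theorem exists_frontBounds (hreg : P.HiddenRegular) (hcon : P.ConstraintRegular)
    (htrade : P.NonzeroTradeoff) : ∃ G Lx Lf K c, P.FrontBounds G Lx Lf K c := by
  obtain ⟨D, hDlip, hD, r, hr, hpos⟩ := exists_path_derivative hreg hcon htrade
  obtain ⟨Lx, hLx, hx⟩ := xStar_lipschitz hreg hcon
  obtain ⟨S, hSX, hmem, C, hC, hlip⟩ := exists_lipschitz_tube hreg hcon
  set G : ℝ → E 2 := fun w => WithLp.toLp 2 fun m => fderiv ℝ (P.f m) (P.xStar w) (D w) with hG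
  have hGlip : LipOn G := by
    have h := fun m => (lipOn_fderiv_f hreg hcon m).clm_apply hDlip
    obtain ⟨L₀, hL₀, h₀⟩ := h 0
    obtain ⟨L₁, hL₁, h₁⟩ := h 1
    refine ⟨L₀ + L₁, add_nonneg hL₀ hL₁, fun w hw w' hw' => ?_⟩
    refine (norm_le_abs_add_abs _).trans ?_
    rw [add_mul]
    exact add_le_add (h₀ w hw w' hw') (h₁ w hw w' hw')
  have hderiv : ∀ w ∈ Icc (0 : ℝ) 1, HasDerivWithinAt P.fPF (G w) (Icc 0 1) w := by
    intro w hw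
    rw [hasDerivWithinAt_iff_hasFDerivWithinAt, hasFDerivWithinAt_euclidean]
    intro m
    have h := (hreg.differentiableAt_f m (xStar_mem hreg hcon hw)).hasFDerivAt.comp_hasDerivWithinAt
      w (hD w hw)
    refine (h.hasFDerivWithinAt).congr_fderiv ?_
    ext
    simp [hG]
  have hdiff : ∀ w ∈ Icc (0 : ℝ) 1, r ≤ G w 1 - G w 0 := hpos
  obtain ⟨K, hK, hGK⟩ := hGlip
  refine ⟨G, Lx, 2 * C, K, r / 2, hLx, by positivity, hK, by positivity, hderiv, hGK, ?_, ?_, hx,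
    ?_⟩
  · intro w hw
    have := (le_abs_self _).trans (sub_le_two_mul_norm (G w))
    linarith [hdiff w hw]
  · have hφ : ∀ w ∈ Icc (0 : ℝ) 1, HasDerivWithinAt (fun w => P.fPF w 1 - P.fPF w 0 - r * w)
        (G w 1 - G w 0 - r) (Icc 0 1) w := by
      intro w hw
      have h := fun m => hasFDerivWithinAt_euclidean.1 (hderiv w hw).hasFDerivWithinAt m
      have h0 : ∀ m, HasDerivWithinAt (fun w => P.fPF w m) (G w m) (Icc 0 1) w := fun m => by
        have := (h m).hasDerivWithinAt
        simpa using! this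
      have h1 : HasDerivWithinAt (fun w : ℝ => r * w) r (Icc 0 1) w := by
        simpa using ((hasDerivAt_id w).const_mul r).hasDerivWithinAt
      exact ((h0 1).sub (h0 0)).sub h1
    have hmono : MonotoneOn (fun w => P.fPF w 1 - P.fPF w 0 - r * w) (Icc 0 1) := by
      refine monotoneOn_of_hasDerivWithinAt_nonneg (convex_Icc 0 1)
        (fun w hw => (hφ w hw).continuousWithinAt)
        (fun w hw => (hφ w (interior_subset hw)).mono interior_subset) fun w hw => ?_
      linarith [hdiff w (interior_subset hw)]
    intro a ha b hb hab
    have h1 := hmono ha hb hab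
    have h2 := (le_abs_self _).trans (sub_le_two_mul_norm (P.fPF b - P.fPF a))
    simp only [PiLp.sub_apply] at h1 h2
    linarith
  · intro u hu w hw h1
    have hgm := hreg.bij.mapsTo hu
    have hS1 := hmem w hw _ hgm h1
    have hS2 := hmem w hw _ (xStar_mem hreg hcon hw) (by simp)
    have h := fun m => (hlip m _ hS1 _ hS2).1
    refine (norm_le_abs_add_abs _).trans ?_
    have e : ∀ m, (P.hVec u - P.fPF w) m = P.f m (P.g u) - P.f m (P.xStar w) := fun m => by
      rw [← hreg.comp m u hu]; rfl
    rw [e, e]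
    linarith [h 0, h 1]

end Problem

end SURF

namespace SURF

/-! ### Arc length of the front -/

theorem sub_le_of_hasDerivWithinAt_le {F F' : ℝ → ℝ} {a b C : ℝ} (hab : a ≤ b)
    (hF : ∀ w ∈ Icc a b, HasDerivWithinAt F (F' w) (Icc a b) w)
    (hC : ∀ w ∈ Icc a b, F' w ≤ C) : F b - F a ≤ C * (b - a) := by
  have hφ : ∀ w ∈ Icc a b, HasDerivWithinAt (fun w => C * w - F w) (C - F' w) (Icc a b) w := by
    intro w hw
    have h1 : HasDerivWithinAt (fun w : ℝ => C * w) C (Icc a b) w := by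
      simpa using ((hasDerivAt_id w).const_mul C).hasDerivWithinAt
    exact h1.sub (hF w hw)
  have hmono : MonotoneOn (fun w => C * w - F w) (Icc a b) :=
    monotoneOn_of_hasDerivWithinAt_nonneg (convex_Icc a b)
      (fun w hw => (hφ w hw).continuousWithinAt)
      (fun w hw => (hφ w (interior_subset hw)).mono interior_subset)
      fun w hw => sub_nonneg.2 (hC w (interior_subset hw))
  have := hmono (left_mem_Icc.2 hab) (right_mem_Icc.2 hab) hab
  simp only at this
  linarith

theorem le_sub_of_le_hasDerivWithinAt {F F' : ℝ → ℝ} {a b C : ℝ} (hab : a ≤ b)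
    (hF : ∀ w ∈ Icc a b, HasDerivWithinAt F (F' w) (Icc a b) w)
    (hC : ∀ w ∈ Icc a b, C ≤ F' w) : C * (b - a) ≤ F b - F a := by
  have := sub_le_of_hasDerivWithinAt_le (F := fun w => -F w) (F' := fun w => -F' w) (C := -C) hab
    (fun w hw => (hF w hw).neg) fun w hw => neg_le_neg (hC w hw)
  linarith

namespace Problem

open Filter Topology

variable {d p k q : ℕ} {P : Problem d p k q} {G : ℝ → E 2} {Lx Lf K c : ℝ}

theorem FrontBounds.speed_eq (hB : P.FrontBounds G Lx Lf K c) {w : ℝ} (hw : w ∈ Icc (0 : ℝ) 1) :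
    P.speed w = ‖G w‖ := by
  rw [speed, (hB.deriv w hw).derivWithin (uniqueDiffOn_Icc zero_lt_one w hw)]

theorem FrontBounds.speed_lipschitz (hB : P.FrontBounds G Lx Lf K c) {w w' : ℝ}
    (hw : w ∈ Icc (0 : ℝ) 1) (hw' : w' ∈ Icc (0 : ℝ) 1) :
    |P.speed w - P.speed w'| ≤ K * |w - w'| := by
  rw [hB.speed_eq hw, hB.speed_eq hw']
  exact (abs_norm_sub_norm_le _ _).trans (hB.lip w hw w' hw')

theorem FrontBounds.continuousOn_speed (hB : P.FrontBounds G Lx Lf K c) :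
    ContinuousOn P.speed (Icc 0 1) :=
  LipOn.continuousOn ⟨K, hB.K_nonneg, fun _ hw _ hw' => hB.speed_lipschitz hw hw'⟩

theorem FrontBounds.bddBelow (hB : P.FrontBounds G Lx Lf K c) : BddBelow (P.speed '' Icc 0 1) :=
  (isCompact_Icc.image_of_continuousOn hB.continuousOn_speed).bddBelow

theorem FrontBounds.bddAbove (hB : P.FrontBounds G Lx Lf K c) : BddAbove (P.speed '' Icc 0 1) :=
  (isCompact_Icc.image_of_continuousOn hB.continuousOn_speed).bddAbove

theorem FrontBounds.vMin_le (hB : P.FrontBounds G Lx Lf K c) {w : ℝ} (hw : w ∈ Icc (0 : ℝ) 1) :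
    P.vMin ≤ P.speed w :=
  csInf_le hB.bddBelow (mem_image_of_mem _ hw)

theorem FrontBounds.le_vMax (hB : P.FrontBounds G Lx Lf K c) {w : ℝ} (hw : w ∈ Icc (0 : ℝ) 1) :
    P.speed w ≤ P.vMax :=
  le_csSup hB.bddAbove (mem_image_of_mem _ hw)

theorem FrontBounds.c_le_speed (hB : P.FrontBounds G Lx Lf K c) {w : ℝ}
    (hw : w ∈ Icc (0 : ℝ) 1) : c ≤ P.speed w := by
  rw [hB.speed_eq hw]; exact hB.lower w hw

theorem FrontBounds.vMin_pos (hB : P.FrontBounds G Lx Lf K c) : 0 < P.vMin := by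
  refine hB.c_pos.trans_le (le_csInf ((nonempty_Icc.2 zero_le_one).image _) ?_)
  rintro _ ⟨w, hw, rfl⟩
  exact hB.c_le_speed hw

theorem FrontBounds.vMax_pos (hB : P.FrontBounds G Lx Lf K c) : 0 < P.vMax :=
  hB.vMin_pos.trans_le ((hB.vMin_le (w := 0) (by simp)).trans (hB.le_vMax (by simp)))

theorem FrontBounds.hasDerivWithinAt_arc (hB : P.FrontBounds G Lx Lf K c) {w : ℝ}
    (hw : w ∈ Icc (0 : ℝ) 1) : HasDerivWithinAt P.arc (P.speed w) (Icc 0 1) w := by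
  -- Extending the speed continuously beyond `[0,1]` lets the fundamental theorem of calculus apply
  -- at the end points as well.
  set V : ℝ → ℝ := IccExtend zero_le_one ((Icc (0 : ℝ) 1).domRestrict P.speed) with hV
  have hVc : Continuous V := (hB.continuousOn_speed.domRestrict).Icc_extend'
  have hVe : ∀ x ∈ Icc (0 : ℝ) 1, V x = P.speed x := fun x hx => by
    rw [hV, IccExtend_of_mem _ _ hx]; rfl
  have harc : ∀ x ∈ Icc (0 : ℝ) 1, P.arc x = ∫ r in (0 : ℝ)..x, V r := fun x hx => by
    refine intervalIntegral.integral_congr fun r hr => ?_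
    rw [uIcc_of_le hx.1] at hr
    exact (hVe r ⟨hr.1, hr.2.trans hx.2⟩).symm
  have h := (hVc.integral_hasStrictDerivAt 0 w).hasDerivAt.hasDerivWithinAt (s := Icc (0 : ℝ) 1)
  rw [← hVe w hw]
  exact h.congr harc (harc w hw)

theorem FrontBounds.deriv_arc_sub (hB : P.FrontBounds G Lx Lf K c) {a b w : ℝ}
    (ha : a ∈ Icc (0 : ℝ) 1) (hb : b ∈ Icc (0 : ℝ) 1) (hw : w ∈ Icc a b) :
    HasDerivWithinAt P.arc (P.speed w) (Icc a b) w :=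
  (hB.hasDerivWithinAt_arc ⟨ha.1.trans hw.1, hw.2.trans hb.2⟩).mono (Icc_subset_Icc ha.1 hb.2)

theorem FrontBounds.arc_lower (hB : P.FrontBounds G Lx Lf K c) {a b : ℝ}
    (ha : a ∈ Icc (0 : ℝ) 1) (hb : b ∈ Icc (0 : ℝ) 1) (hab : a ≤ b) :
    c * (b - a) ≤ P.arc b - P.arc a :=
  le_sub_of_le_hasDerivWithinAt hab (fun _ hw => hB.deriv_arc_sub ha hb hw)
    fun _ hw => hB.c_le_speed ⟨ha.1.trans hw.1, hw.2.trans hb.2⟩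

theorem FrontBounds.arc_taylor (hB : P.FrontBounds G Lx Lf K c) {a b x : ℝ}
    (ha : a ∈ Icc (0 : ℝ) 1) (hb : b ∈ Icc (0 : ℝ) 1) (hx : x ∈ Icc a b) :
    |P.arc b - P.arc a - P.speed x * (b - a)| ≤ K * (b - a) ^ 2 := by
  have hab := hx.1.trans hx.2
  have hx' : x ∈ Icc (0 : ℝ) 1 := ⟨ha.1.trans hx.1, hx.2.trans hb.2⟩
  have hsp : ∀ w ∈ Icc a b, |P.speed w - P.speed x| ≤ K * (b - a) := fun w hw =>
    (hB.speed_lipschitz ⟨ha.1.trans hw.1, hw.2.trans hb.2⟩ hx').trans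
      (mul_le_mul_of_nonneg_left
        (abs_le.2 ⟨by linarith [hw.1, hx.2], by linarith [hw.2, hx.1]⟩) hB.K_nonneg)
  have h1 := sub_le_of_hasDerivWithinAt_le (C := P.speed x + K * (b - a)) hab
    (fun _ hw => hB.deriv_arc_sub ha hb hw) fun w hw => by linarith [(abs_le.1 (hsp w hw)).2]
  have h2 := le_sub_of_le_hasDerivWithinAt (C := P.speed x - K * (b - a)) hab
    (fun _ hw => hB.deriv_arc_sub ha hb hw) fun w hw => by linarith [(abs_le.1 (hsp w hw)).1]
  rw [abs_le]
  constructor <;> nlinarith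

/-- Chord length and arc length agree up to third order. -/
theorem FrontBounds.chord_arc (hB : P.FrontBounds G Lx Lf K c) {a b : ℝ}
    (ha : a ∈ Icc (0 : ℝ) 1) (hb : b ∈ Icc (0 : ℝ) 1) (hab : a < b) :
    |‖P.fPF b - P.fPF a‖ - (P.arc b - P.arc a)| ≤ K ^ 2 / (2 * c) * (b - a) ^ 3 := by
  have hba : 0 < b - a := sub_pos.2 hab
  have hsub : ∀ {w}, w ∈ Icc a b → w ∈ Icc (0 : ℝ) 1 := fun hw =>
    ⟨ha.1.trans hw.1, hw.2.trans hb.2⟩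
  set Δ := P.fPF b - P.fPF a with hΔ
  have hn : c * (b - a) ≤ ‖Δ‖ := hB.chord a ha b hb hab.le
  have hn0 : 0 < ‖Δ‖ := (mul_pos hB.c_pos hba).trans_le hn
  have hγ : ∀ w ∈ Icc a b, HasDerivWithinAt P.fPF (G w) (Icc a b) w := fun w hw =>
    (hB.deriv w (hsub hw)).mono (Icc_subset_Icc ha.1 hb.2)
  -- Projecting the curve on the unit chord direction turns arc minus chord into an increment of
  -- `F`. Its derivative is nonnegative by Cauchy–Schwarz and of second order in `b - a`.
  set F : ℝ → ℝ := fun w => P.arc w - inner ℝ (‖Δ‖⁻¹ • Δ) (P.fPF w)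
  have hF : ∀ w ∈ Icc a b, HasDerivWithinAt F (‖G w‖ - inner ℝ (‖Δ‖⁻¹ • Δ) (G w)) (Icc a b) w := by
    intro w hw
    have h1 := hB.deriv_arc_sub ha hb hw
    rw [hB.speed_eq (hsub hw)] at h1
    exact h1.sub ((innerSL ℝ (‖Δ‖⁻¹ • Δ)).hasFDerivAt.comp_hasDerivWithinAt w (hγ w hw))
  have hFe : F b - F a = (P.arc b - P.arc a) - ‖Δ‖ := by
    have : inner ℝ (‖Δ‖⁻¹ • Δ) (P.fPF b) - inner ℝ (‖Δ‖⁻¹ • Δ) (P.fPF a) = ‖Δ‖ := by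
      rw [← inner_sub_right, ← hΔ, real_inner_smul_left, real_inner_self_eq_norm_sq]
      field_simp
    simp only [F]
    linarith
  have hlow := le_sub_of_le_hasDerivWithinAt (C := 0) hab.le hF fun w _ => by
    have h := real_inner_le_norm (‖Δ‖⁻¹ • Δ) (G w)
    rw [norm_smul, norm_inv, norm_norm, inv_mul_cancel₀ hn0.ne', one_mul] at h
    linarith
  have hup := sub_le_of_hasDerivWithinAt_le (C := K ^ 2 / (2 * c) * (b - a) ^ 2) hab.le hF
    fun w hw => by
    have hdist : ‖Δ - (b - a) • G w‖ ≤ K * (b - a) * (b - a) := by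
      have h := (convex_Icc a b).norm_image_sub_le_of_norm_hasDerivWithin_le
        (f := fun t => P.fPF t - t • G w) (f' := fun t => G t - G w) (C := K * (b - a))
        (fun t ht => by
          have := (hγ t ht).sub ((hasDerivAt_id t).smul_const (G w)).hasDerivWithinAt
          simpa using! this)
        (fun t ht => (hB.lip t (hsub ht) w (hsub hw)).trans
          (mul_le_mul_of_nonneg_left
            (abs_le.2 ⟨by linarith [hw.2, ht.1], by linarith [hw.1, ht.2]⟩) hB.K_nonneg))
        (left_mem_Icc.2 hab.le) (right_mem_Icc.2 hab.le)
      rw [Real.norm_of_nonneg hba.le] at h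
      refine le_trans (le_of_eq ?_) h
      congr 1
      rw [hΔ, sub_smul]
      abel
    -- The expanded square is `(n - h g)²` plus `2 h (n g - I)`, with `I` the inner product of chord
    -- and velocity. This isolates the angular defect, and division by `n ≥ c h` costs one order.
    have hsq : ‖Δ - (b - a) • G w‖ ^ 2 ≤ (K * (b - a) * (b - a)) ^ 2 :=
      pow_le_pow_left₀ (norm_nonneg _) hdist 2
    rw [norm_sub_sq_real, real_inner_smul_right, norm_smul, Real.norm_of_nonneg hba.le] at hsq
    rw [real_inner_smul_left]
    set I := inner ℝ Δ (G w)
    set n := ‖Δ‖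
    set g := ‖G w‖
    set h := b - a
    have h1 : 0 ≤ (n - h * g) ^ 2 := sq_nonneg _
    have h2 : h * (2 * (n * g - I)) ≤ h * (K ^ 2 * h ^ 3) := by nlinarith
    have h3 : 2 * (n * g - I) ≤ K ^ 2 * h ^ 3 := le_of_mul_le_mul_left h2 hba
    have h4 : g - n⁻¹ * I = (n * g - I) / n := by field_simp
    rw [h4, div_le_iff₀ hn0, div_mul_eq_mul_div, div_mul_eq_mul_div,
      le_div_iff₀ (mul_pos two_pos hB.c_pos)]
    have h5 : c * (K ^ 2 * h ^ 3) ≤ K ^ 2 * h ^ 2 * n := by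
      have := mul_le_mul_of_nonneg_left hn (by positivity : 0 ≤ K ^ 2 * h ^ 2)
      linarith
    have h6 := mul_le_mul_of_nonneg_left h3 hB.c_pos.le
    linarith
  rw [abs_le]
  constructor <;> nlinarith

theorem arc_zero : P.arc 0 = 0 := by simp [arc]

theorem FrontBounds.arc_one_pos (hB : P.FrontBounds G Lx Lf K c) : 0 < P.arc 1 := by
  have := hB.arc_lower (a := 0) (b := 1) (by simp) (by simp) zero_le_one
  rw [arc_zero] at this
  linarith [hB.c_pos]

theorem FrontBounds.isCDF_Phi (hB : P.FrontBounds G Lx Lf K c) : IsCDF P.Phi := by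
  have h1 := hB.arc_one_pos
  refine ⟨?_, ?_, by simp [Phi, arc_zero], div_self h1.ne'⟩
  · exact (ContinuousOn.div_const (fun w hw => (hB.hasDerivWithinAt_arc hw).continuousWithinAt) _)
  · intro a ha b hb hab
    refine div_lt_div_of_pos_right ?_ h1
    have := hB.arc_lower ha hb hab.le
    linarith [mul_pos hB.c_pos (sub_pos.2 hab)]

theorem FrontBounds.geometry (hB : P.FrontBounds G Lx Lf K c) :
    DifferentiableOn ℝ P.fPF (Icc 0 1) ∧ 0 < P.vMin ∧
      (∀ w ∈ Icc (0 : ℝ) 1, P.vMin ≤ P.speed w ∧ P.speed w ≤ P.vMax) ∧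
      0 < P.arc 1 ∧ IsCDF P.Phi :=
  ⟨fun w hw => (hB.deriv w hw).differentiableWithinAt, hB.vMin_pos,
    fun _ hw => ⟨hB.vMin_le hw, hB.le_vMax hw⟩, hB.arc_one_pos, hB.isCDF_Phi⟩

end Problem

end SURF

namespace SURF

/-! ### Quantiles -/

theorem IsCDF.quantile_eq {F : ℝ → ℝ} (hF : IsCDF F) {w : ℝ} (hw : w ∈ Icc (0 : ℝ) 1) :
    quantile F (F w) = w := by
  refine IsLeast.csInf_eq ⟨⟨hw, le_rfl⟩, fun x hx => ?_⟩
  exact (hF.strictMono.le_iff_le hw hx.1).1 hx.2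

theorem IsCDF.exists_eq {F : ℝ → ℝ} (hF : IsCDF F) {r : ℝ} (hr : r ∈ Icc (0 : ℝ) 1) :
    ∃ w ∈ Icc (0 : ℝ) 1, F w = r := by
  have h := intermediate_value_Icc zero_le_one hF.cont
  rw [hF.zero, hF.one] at h
  exact h hr

theorem IsCDF.quantile_mem {F : ℝ → ℝ} (hF : IsCDF F) {r : ℝ} (hr : r ∈ Icc (0 : ℝ) 1) :
    quantile F r ∈ Icc (0 : ℝ) 1 := by
  obtain ⟨w, hw, rfl⟩ := hF.exists_eq hr
  rwa [hF.quantile_eq hw]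

theorem IsCDF.apply_quantile {F : ℝ → ℝ} (hF : IsCDF F) {r : ℝ} (hr : r ∈ Icc (0 : ℝ) 1) :
    F (quantile F r) = r := by
  obtain ⟨w, hw, rfl⟩ := hF.exists_eq hr
  rw [hF.quantile_eq hw]

theorem IsCDF.mem_Icc {F : ℝ → ℝ} (hF : IsCDF F) {w : ℝ} (hw : w ∈ Icc (0 : ℝ) 1) :
    F w ∈ Icc (0 : ℝ) 1 := by
  constructor
  · rw [← hF.zero]; exact hF.strictMono.monotoneOn (by simp) hw hw.1
  · rw [← hF.one]; exact hF.strictMono.monotoneOn hw (by simp) hw.2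

theorem IsCDF.convexComb {F F' : ℝ → ℝ} (hF : IsCDF F) (hF' : IsCDF F') {α : ℝ} (h0 : 0 ≤ α)
    (h1 : α ≤ 1) : IsCDF fun w => α * F w + (1 - α) * F' w := by
  refine ⟨(hF.cont.const_mul α).add (hF'.cont.const_mul _), fun a ha b hb hab => ?_,
    by simp [hF.zero, hF'.zero], by simp [hF.one, hF'.one]⟩
  have h2 := hF.strictMono ha hb hab
  have h3 := hF'.strictMono ha hb hab
  rcases h0.eq_or_lt with rfl | h0
  · linarith
  · have := mul_lt_mul_of_pos_left h2 h0
    have := mul_le_mul_of_nonneg_left h3.le (sub_nonneg.2 h1)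
    linarith

/-! ### Slopes of the monotone interpolant -/

/-- A weighted harmonic mean lies between the two secants. Each weight exceeds a third of the total,
which keeps the mean strictly below three times either secant. -/
theorem interiorSlope_bounds {a b δ δ' : ℝ} (ha : 0 < a) (hb : 0 < b) (hδ : 0 < δ) (hδ' : 0 < δ') :
    0 ≤ interiorSlope a b δ δ' ∧ interiorSlope a b δ δ' < 3 * δ ∧
      interiorSlope a b δ δ' < 3 * δ' ∧ |interiorSlope a b δ δ' - δ| ≤ |δ - δ'| ∧
      |interiorSlope a b δ δ' - δ'| ≤ |δ - δ'| := by
  have hden : 0 < (2 * b + a) * δ' + (b + 2 * a) * δ := by positivity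
  have e : interiorSlope a b δ δ' =
      ((2 * b + a) + (b + 2 * a)) * (δ * δ') / ((2 * b + a) * δ' + (b + 2 * a) * δ) := by
    rw [interiorSlope, if_neg (not_le.2 (mul_pos hδ hδ'))]
    field_simp
  have e1 : interiorSlope a b δ δ' - δ =
      (b + 2 * a) * δ / ((2 * b + a) * δ' + (b + 2 * a) * δ) * (δ' - δ) := by
    rw [e]; field_simp; ring
  have e2 : interiorSlope a b δ δ' - δ' =
      (2 * b + a) * δ' / ((2 * b + a) * δ' + (b + 2 * a) * δ) * (δ - δ') := by
    rw [e]; field_simp; ring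
  have p1 : 0 < a * δ := mul_pos ha hδ
  have p2 : 0 < a * δ' := mul_pos ha hδ'
  have p3 : 0 < b * δ := mul_pos hb hδ
  have p4 : 0 < b * δ' := mul_pos hb hδ'
  refine ⟨by rw [e]; positivity, ?_, ?_, ?_, ?_⟩
  · rw [e, div_lt_iff₀ hden]
    have := mul_pos hδ (add_pos (add_pos p4 p1) (add_pos p1 p3))
    nlinarith
  · rw [e, div_lt_iff₀ hden]
    have := mul_pos hδ' (add_pos (add_pos p1 p4) (add_pos p2 p4))
    nlinarith
  · rw [e1, abs_mul, abs_sub_comm δ δ']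
    refine mul_le_of_le_one_left (abs_nonneg _) ?_
    rw [abs_of_pos (by positivity), div_le_one hden]
    linarith
  · rw [e2, abs_mul]
    refine mul_le_of_le_one_left (abs_nonneg _) ?_
    rw [abs_of_pos (by positivity), div_le_one hden]
    linarith

/-- For positive secants the raw slope is below `2 * δ`, so the limiter at `3 * δ` never acts.
Clamping a nonpositive raw slope to zero only moves it closer to `δ`. -/
theorem endSlope_bounds {a b δ δ' : ℝ} (ha : 0 < a) (hb : 0 < b) (hδ : 0 < δ) (hδ' : 0 < δ') :
    0 ≤ endSlope a b δ δ' ∧ endSlope a b δ δ' < 3 * δ ∧ |endSlope a b δ δ' - δ| ≤ |δ - δ'| := by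
  have hab : 0 < a + b := add_pos ha hb
  have hlt : rawEndSlope a b δ δ' < 2 * δ := by
    rw [rawEndSlope, div_lt_iff₀ hab]
    have := mul_pos ha hδ'
    have := mul_pos hb hδ
    linarith
  have hd : |rawEndSlope a b δ δ' - δ| ≤ |δ - δ'| := by
    have : rawEndSlope a b δ δ' - δ = a / (a + b) * (δ - δ') := by
      rw [rawEndSlope]; field_simp; ring
    rw [this, abs_mul]
    refine mul_le_of_le_one_left (abs_nonneg _) ?_
    rw [abs_of_pos (by positivity), div_le_one hab]
    linarith
  rw [endSlope]
  split_ifs with h1 h2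
  · refine ⟨le_rfl, by linarith, ?_⟩
    have h3 : rawEndSlope a b δ δ' ≤ 0 := by
      by_contra h; exact absurd h1 (not_le.2 (mul_pos (not_le.1 h) hδ))
    rw [abs_le] at hd
    rw [zero_sub, abs_neg, abs_of_pos hδ]
    linarith
  · exfalso
    rw [abs_of_pos hδ, abs_of_pos (pos_of_mul_pos_left (not_le.1 h1) hδ.le)] at h2
    linarith
  · exact ⟨(pos_of_mul_pos_left (not_le.1 h1) hδ.le).le, by linarith, hd⟩

/-! ### The interpolant of increasing data. -/

/-- Increasing knots in `[0,1]` with all secants in `[m, M]`, `m > 0`. -/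
structure IncreasingData (N : ℕ) (z y : ℕ → ℝ) (m M : ℝ) : Prop where
  one_le : 1 ≤ N
  zero : z 0 = 0
  one : z N = 1
  lt : ∀ n < N, z n < z (n + 1)
  y_zero : y 0 = 0
  m_pos : 0 < m
  lower : ∀ n < N, m ≤ secant z y n
  upper : ∀ n < N, secant z y n ≤ M

section Pchip

variable {N : ℕ} {z y : ℕ → ℝ} {m M : ℝ}

theorem IncreasingData.gap_pos (h : IncreasingData N z y m M) {n : ℕ} (hn : n < N) : 0 < gap z n :=
  sub_pos.2 (h.lt n hn)

theorem IncreasingData.secant_pos (h : IncreasingData N z y m M) {n : ℕ} (hn : n < N) :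
    0 < secant z y n :=
  h.m_pos.trans_le (h.lower n hn)

theorem IncreasingData.secant_mul_gap (h : IncreasingData N z y m M) {n : ℕ} (hn : n < N) :
    secant z y n * gap z n = y (n + 1) - y n :=
  div_mul_cancel₀ _ (h.gap_pos hn).ne'

theorem IncreasingData.le_of_le (h : IncreasingData N z y m M) {i j : ℕ} (hij : i ≤ j)
    (hj : j ≤ N) : z i ≤ z j := by
  induction j, hij using Nat.le_induction with
  | base => exact le_rfl
  | succ j _ ih => exact (ih (by omega)).trans (h.lt j (by omega)).le

/-- Here `n` is either end of the `i`-th interval, so every Hermite piece has both its end slopes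
compared with its own secant. -/
theorem IncreasingData.knotSlope_bounds (h : IncreasingData N z y m M) {ε : ℝ} (hε : 0 ≤ ε)
    (hd : ∀ i, i + 1 < N → |secant z y i - secant z y (i + 1)| ≤ ε) {i n : ℕ} (hi : i < N)
    (hn : n = i ∨ n = i + 1) :
    0 ≤ knotSlope N z y n ∧ knotSlope N z y n < 3 * secant z y i ∧
      |knotSlope N z y n - secant z y i| ≤ ε := by
  have hp := h.secant_pos hi
  rw [knotSlope]
  split_ifs with h1 h2 h3
  · obtain rfl : i = 0 := by omega
    exact ⟨hp.le, by linarith, by simpa using hε⟩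
  · obtain rfl : i = 0 := by omega
    have h0 : 1 < N := by have := h.one_le; omega
    have hb := endSlope_bounds (h.gap_pos hi) (h.gap_pos h0) hp (h.secant_pos h0)
    exact ⟨hb.1, hb.2.1, hb.2.2.trans (hd 0 h0)⟩
  · obtain rfl : i = N - 1 := by omega
    have h0 : N - 2 < N := by omega
    have hb := endSlope_bounds (h.gap_pos hi) (h.gap_pos h0) hp (h.secant_pos h0)
    refine ⟨hb.1, hb.2.1, hb.2.2.trans ?_⟩
    have := hd (N - 2) (by omega)
    rwa [show N - 2 + 1 = N - 1 by omega, abs_sub_comm] at this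
  · rcases hn with rfl | rfl
    · have h0 : n - 1 < N := by omega
      have hb := interiorSlope_bounds (h.gap_pos h0) (h.gap_pos hi) (h.secant_pos h0) hp
      refine ⟨hb.1, hb.2.2.1, hb.2.2.2.2.trans ?_⟩
      have := hd (n - 1) (by omega)
      rwa [show n - 1 + 1 = n by omega] at this
    · have h0 : i + 1 < N := by omega
      have hb := interiorSlope_bounds (h.gap_pos hi) (h.gap_pos h0) hp (h.secant_pos h0)
      exact ⟨hb.1, hb.2.1, hb.2.2.2.1.trans (hd i h0)⟩

/-- Derivative of a Hermite piece in the normalized coordinate `θ`. -/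
def hermiteSlope (δ d₀ d₁ θ : ℝ) : ℝ :=
  6 * θ * (1 - θ) * δ + (1 - θ) * (1 - 3 * θ) * d₀ + θ * (3 * θ - 2) * d₁

theorem IncreasingData.hasDerivAt_hermitePiece (h : IncreasingData N z y m M) {n : ℕ} (hn : n < N)
    (x : ℝ) : HasDerivAt (hermitePiece N z y n)
      (hermiteSlope (secant z y n) (knotSlope N z y n) (knotSlope N z y (n + 1))
        ((x - z n) / gap z n)) x := by
  have hg := h.gap_pos hn
  have hθ : HasDerivAt (fun x => (x - z n) / gap z n) (1 / gap z n) x :=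
    ((hasDerivAt_id x).sub_const (z n)).div_const _
  have hθ2 := hθ.fun_pow 2
  have hθ3 := hθ.fun_pow 3
  have h1 := (((hθ3.const_mul 2).sub (hθ2.const_mul 3)).add_const 1).mul_const (y n)
  have h2 := (((hθ3.sub (hθ2.const_mul 2)).add hθ).mul_const (gap z n)).mul_const
    (knotSlope N z y n)
  have h3 := ((hθ3.const_mul (-2)).add (hθ2.const_mul 3)).mul_const (y (n + 1))
  have h4 := ((hθ3.sub hθ2).mul_const (gap z n)).mul_const (knotSlope N z y (n + 1))
  refine (((h1.add h2).add h3).add h4).congr_deriv ?_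
  rw [hermiteSlope, secant]
  have hne := hg.ne'
  generalize (x - z n) / gap z n = θ
  generalize gap z n = γ at hne
  field_simp
  norm_num
  ring

/-- The slope is affine in `d₀` and in `d₁`, so on the square `[0, 3δ]²` it interpolates its corner
values, which are nonnegative. The corner `(0, 0)` has a positive value and positive weight. -/
theorem hermiteSlope_pos {δ d₀ d₁ θ : ℝ} (h0 : 0 ≤ d₀) (h0' : d₀ < 3 * δ)
    (h1 : 0 ≤ d₁) (h1' : d₁ < 3 * δ) (hθ : 0 < θ) (hθ' : θ < 1) : 0 < hermiteSlope δ d₀ d₁ θ := by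
  have hδ : 0 < 3 * δ := h0.trans_lt h0'
  have e : 3 * δ * hermiteSlope δ d₀ d₁ θ = (3 * δ - d₀) * (3 * δ - d₁) * (2 * (θ * (1 - θ)))
      + d₀ * (3 * δ - d₁) * (1 - θ) ^ 2 + (3 * δ - d₀) * d₁ * θ ^ 2
      + d₀ * d₁ * (1 - 2 * θ) ^ 2 := by
    rw [hermiteSlope]; ring
  have p0 : 0 < 3 * δ - d₀ := sub_pos.2 h0'
  have p1 : 0 < 3 * δ - d₁ := sub_pos.2 h1'
  have p2 : 0 < 1 - θ := sub_pos.2 hθ'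
  refine pos_of_mul_pos_right (a := 3 * δ) ?_ hδ.le
  rw [e]
  positivity

theorem hermiteSlope_coeff {θ : ℝ} (h0 : 0 ≤ θ) (h1 : θ ≤ 1) :
    |(1 - θ) * (1 - 3 * θ)| ≤ 1 ∧ |θ * (3 * θ - 2)| ≤ 1 := by
  constructor <;> rw [abs_le] <;> constructor <;>
    nlinarith [sq_nonneg (3 * θ - 2), sq_nonneg (3 * θ - 1)]

/-- The three coefficients of `hermiteSlope` sum to one, so only deviations of the end slopes from
`δ` remain. -/
theorem hermiteSlope_near {δ d₀ d₁ θ ε : ℝ} (h0 : |d₀ - δ| ≤ ε) (h1 : |d₁ - δ| ≤ ε)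
    (hθ : 0 ≤ θ) (hθ' : θ ≤ 1) : |hermiteSlope δ d₀ d₁ θ - δ| ≤ 2 * ε := by
  have e : hermiteSlope δ d₀ d₁ θ - δ =
      (1 - θ) * (1 - 3 * θ) * (d₀ - δ) + θ * (3 * θ - 2) * (d₁ - δ) := by
    rw [hermiteSlope]; ring
  obtain ⟨c0, c1⟩ := hermiteSlope_coeff hθ hθ'
  rw [e]
  refine (abs_add_le _ _).trans ?_
  rw [abs_mul, abs_mul _ (d₁ - δ)]
  have := mul_le_of_le_one_left (abs_nonneg (d₀ - δ)) c0
  have := mul_le_of_le_one_left (abs_nonneg (d₁ - δ)) c1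
  linarith

theorem hermitePiece_left (N : ℕ) (z y : ℕ → ℝ) (n : ℕ) : hermitePiece N z y n (z n) = y n := by
  simp [hermitePiece]

theorem IncreasingData.hermitePiece_right (h : IncreasingData N z y m M) {n : ℕ} (hn : n < N) :
    hermitePiece N z y n (z (n + 1)) = y (n + 1) := by
  have : (z (n + 1) - z n) / gap z n = 1 := div_self (h.gap_pos hn).ne'
  simp only [hermitePiece, this]
  ring

/-- At a shared interior knot the definition selects the right piece, and both pieces take the data
value there; the cap `N - 1` keeps the last piece in force at `z N`. -/
theorem IncreasingData.pchip_eq (h : IncreasingData N z y m M) {n : ℕ} (hn : n < N) {x : ℝ}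
    (hx : x ∈ Icc (z n) (z (n + 1))) : pchip N z y x = hermitePiece N z y n x := by
  classical
  have key : ∀ n < N, z n ≤ x → (n + 1 < N → x < z (n + 1)) →
      pchip N z y x = hermitePiece N z y n x := by
    intro n hn h1 h2
    have : Nat.findGreatest (fun n => z n ≤ x) (N - 1) = n := by
      rw [Nat.findGreatest_eq_iff]
      refine ⟨by omega, fun _ => h1, fun k hk hk' hle => ?_⟩
      have h3 : z (n + 1) ≤ z k := h.le_of_le (by omega) (by omega)
      linarith [h2 (by omega)]
    rw [pchip]
    convert rfl using 2
    convert this.symm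
  by_cases hlast : n + 1 < N
  · rcases hx.2.lt_or_eq with hlt | heq
    · exact key n hn hx.1 fun _ => hlt
    · rw [key (n + 1) hlast heq.ge fun h' => by rw [heq]; exact h.lt (n + 1) hlast, heq,
        hermitePiece_left, h.hermitePiece_right hn]
  · exact key n hn hx.1 fun h' => absurd h' hlast

theorem IncreasingData.pchip_zero (h : IncreasingData N z y m M) : pchip N z y 0 = 0 := by
  have h0 : 0 < N := h.one_le
  rw [h.pchip_eq h0 (by rw [h.zero]; exact ⟨le_rfl, by rw [← h.zero]; exact (h.lt 0 h0).le⟩)]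
  have := hermitePiece_left N z y 0
  rwa [h.zero, h.y_zero] at this

theorem IncreasingData.pchip_one (h : IncreasingData N z y m M) : pchip N z y 1 = y N := by
  obtain ⟨n, rfl⟩ : ∃ n, N = n + 1 := ⟨N - 1, by have := h.one_le; omega⟩
  have hn : n < n + 1 := by omega
  have h1 := h.hermitePiece_right hn
  rw [h.one] at h1
  rw [← h1]
  exact h.pchip_eq hn (by rw [h.one]; exact ⟨by rw [← h.one]; exact (h.lt n hn).le, le_rfl⟩)

/-- Monotonicity on each knot interval gives monotonicity. -/
theorem IncreasingData.monotoneOn_of_pieces (h : IncreasingData N z y m M) {F : ℝ → ℝ}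
    (hF : ∀ n < N, MonotoneOn F (Icc (z n) (z (n + 1)))) : MonotoneOn F (Icc 0 1) := by
  have : ∀ n ≤ N, MonotoneOn F (Icc (z 0) (z n)) := by
    intro n
    induction n with
    | zero => intro _; simp
    | succ n ih =>
      intro hn
      have h1 : z 0 ≤ z n := h.le_of_le (Nat.zero_le n) (by omega)
      have h2 : z n ≤ z (n + 1) := (h.lt n (by omega)).le
      rw [← Icc_union_Icc_eq_Icc h1 h2]
      exact (ih (by omega)).union_right (hF n (by omega)) (isGreatest_Icc h1) (isLeast_Icc h2)
  have := this N le_rfl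
  rwa [h.zero, h.one] at this

theorem IncreasingData.strictMonoOn_of_pieces (h : IncreasingData N z y m M) {F : ℝ → ℝ}
    (hF : ∀ n < N, StrictMonoOn F (Icc (z n) (z (n + 1)))) : StrictMonoOn F (Icc 0 1) := by
  have : ∀ n ≤ N, StrictMonoOn F (Icc (z 0) (z n)) := by
    intro n
    induction n with
    | zero => intro _; simp
    | succ n ih =>
      intro hn
      have h1 : z 0 ≤ z n := h.le_of_le (Nat.zero_le n) (by omega)
      have h2 : z n ≤ z (n + 1) := (h.lt n (by omega)).le
      rw [← Icc_union_Icc_eq_Icc h1 h2]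
      exact (ih (by omega)).union (hF n (by omega)) (isGreatest_Icc h1) (isLeast_Icc h2)
  have := this N le_rfl
  rwa [h.zero, h.one] at this

theorem IncreasingData.coord_mem (h : IncreasingData N z y m M) {n : ℕ} (hn : n < N) {x : ℝ}
    (hx : x ∈ Icc (z n) (z (n + 1))) : 0 ≤ (x - z n) / gap z n ∧ (x - z n) / gap z n ≤ 1 := by
  have hg := h.gap_pos hn
  refine ⟨div_nonneg (sub_nonneg.2 hx.1) hg.le, (div_le_one hg).2 ?_⟩
  rw [gap]; linarith [hx.2]

theorem IncreasingData.abs_secant_sub_le (h : IncreasingData N z y m M) {i : ℕ} (hi : i + 1 < N) :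
    |secant z y i - secant z y (i + 1)| ≤ M - m := by
  rw [abs_le]
  constructor <;>
    linarith [h.lower i (by omega), h.lower (i + 1) hi, h.upper i (by omega), h.upper (i + 1) hi]

theorem IncreasingData.m_le_M (h : IncreasingData N z y m M) : m ≤ M :=
  (h.lower 0 h.one_le).trans (h.upper 0 h.one_le)

theorem IncreasingData.pchip_strictMonoOn (h : IncreasingData N z y m M) :
    StrictMonoOn (pchip N z y) (Icc 0 1) := by
  refine h.strictMonoOn_of_pieces fun n hn => ?_
  refine StrictMonoOn.congr (f₁ := hermitePiece N z y n) ?_ fun x hx => (h.pchip_eq hn hx).symm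
  refine strictMonoOn_of_hasDerivWithinAt_pos (convex_Icc _ _)
    (fun x _ => (h.hasDerivAt_hermitePiece hn x).continuousAt.continuousWithinAt)
    (fun x _ => (h.hasDerivAt_hermitePiece hn x).hasDerivWithinAt) fun x hx => ?_
  rw [interior_Icc] at hx
  -- Only the sign and the factor-three bound of the knot slopes matter here; `M - m` is a crude
  -- admissible bound on secant differences.
  have hε : 0 ≤ M - m := sub_nonneg.2 h.m_le_M
  have b0 := h.knotSlope_bounds hε (fun i hi => h.abs_secant_sub_le hi) hn (Or.inl rfl)
  have b1 := h.knotSlope_bounds hε (fun i hi => h.abs_secant_sub_le hi) hn (Or.inr rfl)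
  have hg := h.gap_pos hn
  refine hermiteSlope_pos b0.1 b0.2.1 b1.1 b1.2.1 (div_pos (sub_pos.2 hx.1) hg)
    ((div_lt_one hg).2 ?_)
  rw [gap]; linarith [hx.2]

/-- The factor `8` is `2 + 3 + 3`: a coefficient at most `2` on the secant and two knot slopes of at
most three secants each. -/
theorem IncreasingData.pchip_upper (h : IncreasingData N z y m M) {a b : ℝ}
    (ha : a ∈ Icc (0 : ℝ) 1) (hb : b ∈ Icc (0 : ℝ) 1) (hab : a ≤ b) :
    pchip N z y b - pchip N z y a ≤ 8 * M * (b - a) := by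
  have hmono : MonotoneOn (fun x => 8 * M * x - pchip N z y x) (Icc 0 1) := by
    refine h.monotoneOn_of_pieces fun n hn a ha b hb hab => ?_
    rw [h.pchip_eq hn ha, h.pchip_eq hn hb]
    have := sub_le_of_hasDerivWithinAt_le (C := 8 * M) hab
      (fun x _ => (h.hasDerivAt_hermitePiece hn x).hasDerivWithinAt) fun x hx => ?_
    · linarith
    have hx' : x ∈ Icc (z n) (z (n + 1)) := ⟨ha.1.trans hx.1, hx.2.trans hb.2⟩
    have hε : 0 ≤ M - m := sub_nonneg.2 h.m_le_M
    have b0 := h.knotSlope_bounds hε (fun i hi => h.abs_secant_sub_le hi) hn (Or.inl rfl)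
    have b1 := h.knotSlope_bounds hε (fun i hi => h.abs_secant_sub_le hi) hn (Or.inr rfl)
    obtain ⟨t0, t1⟩ := h.coord_mem hn hx'
    obtain ⟨c0, c1⟩ := hermiteSlope_coeff t0 t1
    have hδ := h.secant_pos hn
    have hδM := h.upper n hn
    rw [hermiteSlope]
    set θ := (x - z n) / gap z n
    have p1 : 6 * θ * (1 - θ) * secant z y n ≤ 2 * secant z y n :=
      mul_le_mul_of_nonneg_right (by nlinarith [sq_nonneg (2 * θ - 1)]) hδ.le
    have p2 := mul_le_mul_of_nonneg_right (abs_le.1 c0).2 b0.1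
    have p3 := mul_le_mul_of_nonneg_right (abs_le.1 c1).2 b1.1
    linarith [b0.2.1, b1.2.1]
  have := hmono ha hb hab
  simp only at this
  linarith

/-- Monotone interpolation alone allows vanishing knot slopes. A positive lower bound comes from
closeness of neighbouring secants, which keeps the derivative within `2 * ε` of the secant. -/
theorem IncreasingData.pchip_lower (h : IncreasingData N z y m M) {ε : ℝ} (hε : 0 ≤ ε)
    (hd : ∀ i, i + 1 < N → |secant z y i - secant z y (i + 1)| ≤ ε) {a b : ℝ}
    (ha : a ∈ Icc (0 : ℝ) 1) (hb : b ∈ Icc (0 : ℝ) 1) (hab : a ≤ b) :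
    (m - 2 * ε) * (b - a) ≤ pchip N z y b - pchip N z y a := by
  have hmono : MonotoneOn (fun x => pchip N z y x - (m - 2 * ε) * x) (Icc 0 1) := by
    refine h.monotoneOn_of_pieces fun n hn a ha b hb hab => ?_
    rw [h.pchip_eq hn ha, h.pchip_eq hn hb]
    have := le_sub_of_le_hasDerivWithinAt (C := m - 2 * ε) hab
      (fun x _ => (h.hasDerivAt_hermitePiece hn x).hasDerivWithinAt) fun x hx => ?_
    · linarith
    have hx' : x ∈ Icc (z n) (z (n + 1)) := ⟨ha.1.trans hx.1, hx.2.trans hb.2⟩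
    have b0 := h.knotSlope_bounds hε hd hn (Or.inl rfl)
    have b1 := h.knotSlope_bounds hε hd hn (Or.inr rfl)
    obtain ⟨t0, t1⟩ := h.coord_mem hn hx'
    have := (abs_le.1 (hermiteSlope_near b0.2.2 b1.2.2 t0 t1)).1
    linarith [h.lower n hn]
  have := hmono ha hb hab
  simp only at this
  linarith

/-- The interpolant is close to the broken line through the data. -/
theorem IncreasingData.pchip_near (h : IncreasingData N z y m M) {ε : ℝ} (hε : 0 ≤ ε)
    (hd : ∀ i, i + 1 < N → |secant z y i - secant z y (i + 1)| ≤ ε) {n : ℕ} (hn : n < N) {x : ℝ}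
    (hx : x ∈ Icc (z n) (z (n + 1))) :
    |pchip N z y x - (y n + secant z y n * (x - z n))| ≤ 2 * ε * (x - z n) := by
  have b0 := h.knotSlope_bounds hε hd hn (Or.inl rfl)
  have b1 := h.knotSlope_bounds hε hd hn (Or.inr rfl)
  have hsub : ∀ t ∈ Icc (z n) x, t ∈ Icc (z n) (z (n + 1)) := fun t ht => ⟨ht.1, ht.2.trans hx.2⟩
  have hs : ∀ t ∈ Icc (z n) x, _ := fun t ht => abs_le.1 (hermiteSlope_near b0.2.2 b1.2.2
    (h.coord_mem hn (hsub t ht)).1 (h.coord_mem hn (hsub t ht)).2)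
  have h1 := sub_le_of_hasDerivWithinAt_le (C := secant z y n + 2 * ε) hx.1
    (fun t _ => (h.hasDerivAt_hermitePiece hn t).hasDerivWithinAt)
    fun t ht => by linarith [(hs t ht).2]
  have h2 := le_sub_of_le_hasDerivWithinAt (C := secant z y n - 2 * ε) hx.1
    (fun t _ => (h.hasDerivAt_hermitePiece hn t).hasDerivWithinAt)
    fun t ht => by linarith [(hs t ht).1]
  rw [hermitePiece_left] at h1 h2
  rw [h.pchip_eq hn hx, abs_le]
  constructor <;> linarith

theorem IncreasingData.last_bounds (h : IncreasingData N z y m M) : m ≤ y N ∧ y N ≤ M := by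
  have : ∀ n ≤ N, m * z n ≤ y n ∧ y n ≤ M * z n := by
    intro n
    induction n with
    | zero => intro _; simp [h.zero, h.y_zero]
    | succ n ih =>
      intro hn
      have h1 := ih (by omega)
      have h2 := h.secant_mul_gap (n := n) (by omega)
      have hg := (h.gap_pos (n := n) (by omega)).le
      have h3 := mul_le_mul_of_nonneg_right (h.lower n (by omega)) hg
      have h4 := mul_le_mul_of_nonneg_right (h.upper n (by omega)) hg
      rw [h2, gap] at h3 h4
      constructor <;> linarith [h1.1, h1.2]
  simpa [h.one] using this N le_rfl

theorem IncreasingData.isCDF (h : IncreasingData N z y m M) :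
    IsCDF fun x => pchip N z y x / y N := by
  have hN := h.m_pos.trans_le h.last_bounds.1
  have hmono := h.pchip_strictMonoOn
  refine ⟨?_, fun a ha b hb hab => div_lt_div_of_pos_right (hmono ha hb hab) hN,
    by simp [h.pchip_zero], by simp only [h.pchip_one]; exact div_self hN.ne'⟩
  refine ContinuousOn.div_const ?_ _
  have hM : 0 ≤ 8 * M := by linarith [h.m_pos, h.m_le_M]
  refine LipOn.continuousOn ⟨8 * M, hM, fun a ha b hb => ?_⟩
  rw [Real.norm_eq_abs]
  rcases le_total a b with hab | hab
  · rw [abs_sub_comm, abs_sub_comm a b, abs_of_nonneg (sub_nonneg.2 hab),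
      abs_of_nonneg (sub_nonneg.2 (hmono.monotoneOn ha hb hab))]
    exact h.pchip_upper ha hb hab
  · rw [abs_of_nonneg (sub_nonneg.2 hab), abs_of_nonneg (sub_nonneg.2 (hmono.monotoneOn hb ha hab))]
    exact h.pchip_upper hb ha hab

end Pchip

end SURF

namespace SURF

namespace Problem

variable {d p k q : ℕ} {P : Problem d p k q} {G : ℝ → E 2} {Lx Lf K c : ℝ}

/-! ### The rebuilt distribution function for one sample -/

theorem FrontBounds.chord_upper (hB : P.FrontBounds G Lx Lf K c) {a b : ℝ}
    (ha : a ∈ Icc (0 : ℝ) 1) (hb : b ∈ Icc (0 : ℝ) 1) (hab : a ≤ b) :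
    ‖P.fPF b - P.fPF a‖ ≤ P.vMax * (b - a) := by
  have h := (convex_Icc (0 : ℝ) 1).norm_image_sub_le_of_norm_hasDerivWithin_le
    (C := P.vMax) hB.deriv (fun w hw => by rw [← hB.speed_eq hw]; exact hB.le_vMax hw) ha hb
  rwa [Real.norm_of_nonneg (sub_nonneg.2 hab)] at h

theorem FrontBounds.c_le_vMax (hB : P.FrontBounds G Lx Lf K c) : c ≤ P.vMax :=
  (hB.c_le_speed (w := 0) (by simp)).trans (hB.le_vMax (by simp))

/-- A quasi-uniform sample of weights `z` whose points `u` are `e`-close to the solution path. -/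
structure Sample (P : Problem d p k q) (Lf c Λ A : ℝ) (N : ℕ) (z : ℕ → ℝ) (u : ℕ → E d)
    (e : ℝ) : Prop where
  Λ_pos : 0 < Λ
  A_nonneg : 0 ≤ A
  one_le : 1 ≤ N
  zero : z 0 = 0
  one : z N = 1
  gap_lower : ∀ n < N, 1 / (Λ * N) ≤ gap z n
  gap_upper : ∀ n < N, gap z n ≤ A / N
  mem : ∀ n ≤ N, u n ∈ P.U
  err : ∀ n ≤ N, ‖P.g (u n) - P.xStar (z n)‖ ≤ e
  err_le_one : e ≤ 1
  small : 4 * Lf * Λ * (N * e) ≤ c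

variable {Λ A e : ℝ} {N : ℕ} {z : ℕ → ℝ} {u : ℕ → E d}

theorem Sample.N_pos (hS : P.Sample Lf c Λ A N z u e) : (0 : ℝ) < N :=
  Nat.cast_pos.2 hS.one_le

theorem Sample.e_nonneg (hS : P.Sample Lf c Λ A N z u e) : 0 ≤ e :=
  (norm_nonneg _).trans (hS.err 0 (Nat.zero_le _))

theorem Sample.gap_pos (hS : P.Sample Lf c Λ A N z u e) {n : ℕ} (hn : n < N) : 0 < gap z n :=
  (by have := hS.N_pos; have := hS.Λ_pos; positivity : 0 < 1 / (Λ * N)).trans_le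
    (hS.gap_lower n hn)

theorem Sample.le_of_le (hS : P.Sample Lf c Λ A N z u e) {i j : ℕ} (hij : i ≤ j) (hj : j ≤ N) :
    z i ≤ z j := by
  induction j, hij using Nat.le_induction with
  | base => exact le_rfl
  | succ j _ ih => exact (ih (by omega)).trans (sub_nonneg.1 (hS.gap_pos (n := j) (by omega)).le)

theorem Sample.z_mem (hS : P.Sample Lf c Λ A N z u e) {n : ℕ} (hn : n ≤ N) :
    z n ∈ Icc (0 : ℝ) 1 :=
  ⟨hS.zero ▸ hS.le_of_le (Nat.zero_le n) hn, hS.one ▸ hS.le_of_le hn le_rfl⟩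

theorem Sample.chord_noise (hS : P.Sample Lf c Λ A N z u e) (hB : P.FrontBounds G Lx Lf K c)
    {n : ℕ} (hn : n < N) :
    |‖P.hVec (u (n + 1)) - P.hVec (u n)‖ - ‖P.fPF (z (n + 1)) - P.fPF (z n)‖| ≤ 2 * Lf * e := by
  have h : ∀ i ≤ N, ‖P.hVec (u i) - P.fPF (z i)‖ ≤ Lf * e := fun i hi =>
    (hB.objective _ (hS.mem i hi) _ (hS.z_mem hi) ((hS.err i hi).trans hS.err_le_one)).trans
      (mul_le_mul_of_nonneg_left (hS.err i hi) hB.Lf_nonneg)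
  refine (abs_norm_sub_norm_le _ _).trans ?_
  rw [sub_sub_sub_comm]
  refine (norm_sub_le _ _).trans ?_
  linarith [h (n + 1) (by omega), h n hn.le]

/-- Gaps are at least `1 / (Λ N)`, so an absolute error `e` becomes a relative error of order `N e`.
This is why smallness is required of `N e`. -/
theorem Sample.noise_le_gap (hS : P.Sample Lf c Λ A N z u e) (hB : P.FrontBounds G Lx Lf K c)
    {n : ℕ} (hn : n < N) :
    2 * Lf * e ≤ c / 2 * gap z n ∧ 2 * Lf * e ≤ 2 * Lf * Λ * (N * e) * gap z n := by
  have hN := hS.N_pos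
  have hΛ := hS.Λ_pos
  have h1 : 1 ≤ gap z n * (Λ * N) := by
    have := hS.gap_lower n hn
    rwa [div_le_iff₀ (by positivity)] at this
  have h2 : 0 ≤ 2 * Lf * e := mul_nonneg (mul_nonneg two_pos.le hB.Lf_nonneg) hS.e_nonneg
  have h3 := mul_le_mul_of_nonneg_left h1 h2
  have h4 := mul_le_mul_of_nonneg_right hS.small (hS.gap_pos hn).le
  constructor <;> linarith

/-- Exact chords divided by gaps lie in `[c, vMax]`, and the noise is at most `c / 2` per unit gap.
-/
theorem Sample.increasingData (hS : P.Sample Lf c Λ A N z u e) (hB : P.FrontBounds G Lx Lf K c) :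
    IncreasingData N z (P.chord u) (c / 2) (2 * P.vMax) := by
  have hsec : ∀ n < N, c / 2 ≤ secant z (P.chord u) n ∧ secant z (P.chord u) n ≤ 2 * P.vMax := by
    intro n hn
    have hg := hS.gap_pos hn
    have hzz : z n ≤ z (n + 1) := (sub_pos.1 hg).le
    have h0 := hS.z_mem hn.le
    have h1 := hS.z_mem (n := n + 1) hn
    have hc := abs_le.1 (hS.chord_noise hB hn)
    have hl := hB.chord _ h0 _ h1 hzz
    have hu := hB.chord_upper h0 h1 hzz
    have hs := (hS.noise_le_gap hB hn).1
    have hv := mul_le_mul_of_nonneg_right hB.c_le_vMax hg.le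
    rw [secant, le_div_iff₀ hg, div_le_iff₀ hg]
    simp only [chord, Finset.sum_range_succ, add_sub_cancel_left]
    simp only [gap] at *
    constructor
    · linarith [hc.1]
    · have := mul_nonneg hB.vMax_pos.le hg.le
      linarith [hc.2]
  exact ⟨hS.one_le, hS.zero, hS.one, fun n hn => sub_pos.1 (hS.gap_pos hn), by simp [chord],
    half_pos hB.c_pos, fun n hn => (hsec n hn).1, fun n hn => (hsec n hn).2⟩

/-- Third-order agreement of measured chords and arc length. -/
theorem Sample.chord_arc (hS : P.Sample Lf c Λ A N z u e) (hB : P.FrontBounds G Lx Lf K c)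
    {n : ℕ} (hn : n < N) :
    |‖P.hVec (u (n + 1)) - P.hVec (u n)‖ - (P.arc (z (n + 1)) - P.arc (z n))|
      ≤ K ^ 2 / (2 * c) * gap z n ^ 3 + 2 * Lf * e := by
  have h1 := hS.chord_noise hB hn
  have h2 := hB.chord_arc (hS.z_mem hn.le) (hS.z_mem (n := n + 1) hn)
    (sub_pos.1 (hS.gap_pos hn))
  refine (abs_sub_le _ _ _).trans ((add_le_add h1 h2).trans (le_of_eq ?_))
  rw [gap]; ring

theorem Sample.gap_le_one (hS : P.Sample Lf c Λ A N z u e) {n : ℕ} (hn : n < N) :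
    gap z n ≤ 1 := by
  have h0 := hS.z_mem hn.le
  have h1 := hS.z_mem (n := n + 1) hn
  rw [gap]; linarith [h0.1, h1.2]

/-- Measured secants approximate the speed at both end points of a knot interval. -/
theorem Sample.secant_near (hS : P.Sample Lf c Λ A N z u e) (hB : P.FrontBounds G Lx Lf K c)
    {n : ℕ} (hn : n < N) {x : ℝ} (hx : x ∈ Icc (z n) (z (n + 1))) :
    |secant z (P.chord u) n - P.speed x|
      ≤ (K + K ^ 2 / (2 * c)) * A / N + 2 * Lf * Λ * (N * e) := by
  have hg := hS.gap_pos hn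
  have hK := hB.K_nonneg
  have hc := hB.c_pos
  have h1 := hS.chord_arc hB hn
  have h2 := hB.arc_taylor (hS.z_mem hn.le) (hS.z_mem (n := n + 1) hn) hx
  have h3 := (hS.noise_le_gap hB hn).2
  have h4 : secant z (P.chord u) n - P.speed x =
      (‖P.hVec (u (n + 1)) - P.hVec (u n)‖ - P.speed x * gap z n) / gap z n := by
    rw [secant, eq_div_iff hg.ne', sub_mul, div_mul_cancel₀ _ hg.ne']
    simp [chord, Finset.sum_range_succ]
  rw [h4, abs_div, abs_of_pos hg, div_le_iff₀ hg]
  change |_ - _ - _ * gap z n| ≤ K * gap z n ^ 2 at h2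
  have h5 : |‖P.hVec (u (n + 1)) - P.hVec (u n)‖ - P.speed x * gap z n| ≤
      K ^ 2 / (2 * c) * gap z n ^ 3 + 2 * Lf * e + K * gap z n ^ 2 := by
    rw [abs_le] at *
    constructor <;> linarith [h1.1, h1.2, h2.1, h2.2]
  have hg1 := hS.gap_le_one hn
  have hgA := hS.gap_upper n hn
  set γ := gap z n
  have h6 : K ^ 2 / (2 * c) * γ ^ 3 ≤ K ^ 2 / (2 * c) * γ ^ 2 :=
    mul_le_mul_of_nonneg_left (pow_le_pow_of_le_one hg.le hg1 (by norm_num)) (by positivity)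
  have h7 : (K + K ^ 2 / (2 * c)) * γ * γ ≤ (K + K ^ 2 / (2 * c)) * (A / N) * γ :=
    mul_le_mul_of_nonneg_right (mul_le_mul_of_nonneg_left hgA (by positivity)) hg.le
  rw [mul_div_assoc, add_mul]
  nlinarith

theorem Sample.secant_diff (hS : P.Sample Lf c Λ A N z u e) (hB : P.FrontBounds G Lx Lf K c)
    {i : ℕ} (hi : i + 1 < N) :
    |secant z (P.chord u) i - secant z (P.chord u) (i + 1)|
      ≤ 2 * ((K + K ^ 2 / (2 * c)) * A / N + 2 * Lf * Λ * (N * e)) := by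
  have h1 := hS.secant_near hB (n := i) (by omega)
    (right_mem_Icc.2 (hS.le_of_le (Nat.le_succ i) hi.le))
  have h2 := hS.secant_near hB hi (left_mem_Icc.2 (hS.le_of_le (Nat.le_succ (i + 1)) hi))
  rw [abs_le] at *
  constructor <;> linarith [h1.1, h1.2, h2.1, h2.2]

/-- At most `N` chord errors of order `N⁻³` add up to `N⁻²`, and as many noise terms to `N e`. -/
theorem Sample.chord_total (hS : P.Sample Lf c Λ A N z u e) (hB : P.FrontBounds G Lx Lf K c)
    {n : ℕ} (hn : n ≤ N) :
    |P.chord u n - P.arc (z n)| ≤ K ^ 2 / (2 * c) * A ^ 3 / N ^ 2 + 2 * Lf * (N * e) := by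
  have hN := hS.N_pos
  have hc := hB.c_pos
  have hA := hS.A_nonneg
  have he := hS.e_nonneg
  have hLf := hB.Lf_nonneg
  set B := K ^ 2 / (2 * c) * (A / N) ^ 3 + 2 * Lf * e with hBdef
  have hB0 : 0 ≤ B := by positivity
  have key : ∀ n ≤ N, |P.chord u n - P.arc (z n)| ≤ n * B := by
    intro n
    induction n with
    | zero => intro _; simp [chord, hS.zero, arc_zero]
    | succ n ih =>
      intro hn
      have h1 := ih (by omega)
      have h2 := hS.chord_arc hB (n := n) hn
      have h3 : gap z n ^ 3 ≤ (A / N) ^ 3 :=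
        pow_le_pow_left₀ (hS.gap_pos hn).le (hS.gap_upper n hn) 3
      have h4 := mul_le_mul_of_nonneg_left h3 (by positivity : 0 ≤ K ^ 2 / (2 * c))
      have h5 : P.chord u (n + 1) = P.chord u n + ‖P.hVec (u (n + 1)) - P.hVec (u n)‖ := by
        simp [chord, Finset.sum_range_succ]
      rw [h5]
      push_cast
      rw [abs_le] at *
      constructor <;> linarith [h1.1, h1.2, h2.1, h2.2]
  refine (key n hn).trans ((mul_le_mul_of_nonneg_right (Nat.cast_le.2 hn) hB0).trans
    (le_of_eq ?_))
  rw [hBdef]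
  field_simp

/-- Error of the rebuilt arc-length function. -/
theorem Sample.pchip_error (hS : P.Sample Lf c Λ A N z u e) (hB : P.FrontBounds G Lx Lf K c)
    {x : ℝ} (hx : x ∈ Icc (0 : ℝ) 1) :
    |pchip N z (P.chord u) x - P.arc x| ≤
      (5 * A * ((K + K ^ 2 / (2 * c)) * A) + K ^ 2 / (2 * c) * A ^ 3 + K * A ^ 2) / N ^ 2
        + (10 * A * Lf * Λ + 2 * Lf) * (N * e) := by
  have hN := hS.N_pos
  have hA := hS.A_nonneg
  have he := hS.e_nonneg
  have hLf := hB.Lf_nonneg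
  have hΛ := hS.Λ_pos
  have hK := hB.K_nonneg
  have hc := hB.c_pos
  have hI := hS.increasingData hB
  obtain ⟨n, hn, hxn⟩ : ∃ n < N, x ∈ Icc (z n) (z (n + 1)) := by
    have : ∀ m ≤ N, x ≤ z m → 0 < m → ∃ n < N, x ∈ Icc (z n) (z (n + 1)) := by
      intro m
      induction m with
      | zero => intro _ _ h; exact absurd h (lt_irrefl 0)
      | succ m ih =>
        intro hm hxm _
        rcases le_or_gt (z m) x with h | h
        · exact ⟨m, hm, h, hxm⟩
        · rcases Nat.eq_zero_or_pos m with rfl | hpos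
          · rw [hS.zero] at h; exact absurd hx.1 (not_le.2 h)
          · exact ih (by omega) h.le hpos
    exact this N le_rfl (by rw [hS.one]; exact hx.2) hS.one_le
  set ε₀ := (K + K ^ 2 / (2 * c)) * A / N + 2 * Lf * Λ * (N * e) with hε₀
  have hε : 0 ≤ ε₀ := by positivity
  have hxg : x - z n ≤ A / N := by
    have := hS.gap_upper n hn
    rw [gap] at this
    linarith [hxn.2]
  have hx0 : 0 ≤ x - z n := sub_nonneg.2 hxn.1
  have h1 := hI.pchip_near (by positivity : 0 ≤ 2 * ε₀) (fun i hi => hS.secant_diff hB hi) hn hxn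
  have h2 := hS.chord_total hB hn.le
  have h3 := hB.arc_taylor (hS.z_mem hn.le) hx (x := z n) (left_mem_Icc.2 hxn.1)
  have h4 := hS.secant_near hB hn (left_mem_Icc.2 (hxn.1.trans hxn.2))
  have h5 : |(secant z (P.chord u) n - P.speed (z n)) * (x - z n)| ≤ ε₀ * (A / N) := by
    rw [abs_mul, abs_of_nonneg hx0]
    exact mul_le_mul h4 hxg hx0 hε
  have h6 : 2 * (2 * ε₀) * (x - z n) ≤ 4 * (ε₀ * (A / N)) := by
    have := mul_le_mul_of_nonneg_left hxg hε
    linarith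
  have h7 : K * (x - z n) ^ 2 ≤ K * (A / N) ^ 2 :=
    mul_le_mul_of_nonneg_left (pow_le_pow_left₀ hx0 hxg 2) hK
  -- Four sources: interpolant against broken line (four units of `ε₀ A / N`), secant against speed
  -- (one unit), chords against arc up to the left knot, and the Taylor remainder of the arc.
  have h8 : |pchip N z (P.chord u) x - P.arc x| ≤ 5 * (ε₀ * (A / N))
      + (K ^ 2 / (2 * c) * A ^ 3 / N ^ 2 + 2 * Lf * (N * e)) + K * (A / N) ^ 2 := by
    rw [abs_le] at *
    constructor <;> linarith [h1.1, h1.2, h2.1, h2.2, h3.1, h3.2, h5.1, h5.2]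
  refine h8.trans ?_
  have hN1 : (1 : ℝ) ≤ N := Nat.one_le_cast.2 hS.one_le
  have h9 : 10 * A * Lf * Λ * e ≤ 10 * A * Lf * Λ * (N * e) :=
    mul_le_mul_of_nonneg_left (le_mul_of_one_le_left he hN1) (by positivity)
  have h10 : 5 * (ε₀ * (A / N)) =
      5 * A * ((K + K ^ 2 / (2 * c)) * A) / N ^ 2 + 10 * A * Lf * Λ * e := by
    rw [hε₀]; field_simp; ring
  have h11 : K * (A / N) ^ 2 = K * A ^ 2 / N ^ 2 := by rw [div_pow, mul_div_assoc]
  rw [h10, h11, add_div, add_div, add_mul]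
  linarith

theorem Sample.rebuilt_isCDF (hS : P.Sample Lf c Λ A N z u e) (hB : P.FrontBounds G Lx Lf K c) :
    IsCDF (P.rebuilt N z u) :=
  (hS.increasingData hB).isCDF

/-- Normalization adds the error of the total length, weighted by `P.Phi x ≤ 1`. Two errors divided
by a total of at least `c / 2` give the factor `4 / c`. -/
theorem Sample.rebuilt_error (hS : P.Sample Lf c Λ A N z u e) (hB : P.FrontBounds G Lx Lf K c)
    {x : ℝ} (hx : x ∈ Icc (0 : ℝ) 1) :
    |P.rebuilt N z u x - P.Phi x| ≤ 4 / c *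
      ((5 * A * ((K + K ^ 2 / (2 * c)) * A) + K ^ 2 / (2 * c) * A ^ 3 + K * A ^ 2) / N ^ 2
        + (10 * A * Lf * Λ + 2 * Lf) * (N * e)) := by
  have hI := hS.increasingData hB
  have hc := hB.c_pos
  have hy := hI.last_bounds.1
  have hy0 : 0 < P.chord u N := hI.m_pos.trans_le hy
  have hs := hB.arc_one_pos
  have h1 := hS.pchip_error hB hx
  have h2 := hS.pchip_error hB (x := 1) (by simp)
  rw [hI.pchip_one] at h2
  set Er := (5 * A * ((K + K ^ 2 / (2 * c)) * A) + K ^ 2 / (2 * c) * A ^ 3 + K * A ^ 2) / N ^ 2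
    + (10 * A * Lf * Λ + 2 * Lf) * (N * e)
  have hΦ := hB.isCDF_Phi.mem_Icc hx
  have e1 : P.rebuilt N z u x - P.Phi x = ((pchip N z (P.chord u) x - P.arc x)
      + P.Phi x * (P.arc 1 - P.chord u N)) / P.chord u N := by
    rw [rebuilt, Phi]; field_simp; ring
  rw [e1, abs_div, abs_of_pos hy0, div_le_iff₀ hy0]
  have hEr : 0 ≤ Er := (abs_nonneg _).trans h1
  have h3 : |P.Phi x * (P.arc 1 - P.chord u N)| ≤ Er := by
    rw [abs_mul, abs_of_nonneg hΦ.1, abs_sub_comm]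
    exact (mul_le_of_le_one_left (abs_nonneg _) hΦ.2).trans h2
  refine (abs_add_le _ _).trans ((add_le_add h1 h3).trans ?_)
  have h4 : Er + Er = 4 / c * Er * (c / 2) := by field_simp; ring
  rw [h4]
  exact mul_le_mul_of_nonneg_left hy (by positivity)

theorem Sample.rebuilt_upper (hS : P.Sample Lf c Λ A N z u e) (hB : P.FrontBounds G Lx Lf K c)
    {a b : ℝ} (ha : a ∈ Icc (0 : ℝ) 1) (hb : b ∈ Icc (0 : ℝ) 1) (hab : a ≤ b) :
    P.rebuilt N z u b - P.rebuilt N z u a ≤ 32 * P.vMax / c * (b - a) := by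
  have hI := hS.increasingData hB
  have hc := hB.c_pos
  have hv := hB.vMax_pos
  have hy := hI.last_bounds.1
  have hy0 : 0 < P.chord u N := hI.m_pos.trans_le hy
  rw [rebuilt, rebuilt, ← sub_div, div_le_iff₀ hy0]
  refine (hI.pchip_upper ha hb hab).trans ?_
  have h1 : 8 * (2 * P.vMax) * (b - a) = 32 * P.vMax / c * (b - a) * (c / 2) := by
    field_simp; ring
  rw [h1]
  have := sub_nonneg.2 hab
  exact mul_le_mul_of_nonneg_left hy (by positivity)

/-- Secants are at least `c / 2` and neighbours differ by at most `c / 8`, so slopes are at least `c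
/ 4`; the total length is at most `2 * P.vMax`. -/
theorem Sample.rebuilt_lower (hS : P.Sample Lf c Λ A N z u e) (hB : P.FrontBounds G Lx Lf K c)
    (hε : (K + K ^ 2 / (2 * c)) * A / N + 2 * Lf * Λ * (N * e) ≤ c / 16)
    {a b : ℝ} (ha : a ∈ Icc (0 : ℝ) 1) (hb : b ∈ Icc (0 : ℝ) 1) (hab : a ≤ b) :
    c / (8 * P.vMax) * (b - a) ≤ P.rebuilt N z u b - P.rebuilt N z u a := by
  have hI := hS.increasingData hB
  have hc := hB.c_pos
  have hv := hB.vMax_pos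
  have hy := hI.last_bounds
  have hy0 : 0 < P.chord u N := hI.m_pos.trans_le hy.1
  rw [rebuilt, rebuilt, ← sub_div, le_div_iff₀ hy0]
  have h1 := hI.pchip_lower (ε := c / 8) (by positivity)
    (fun i hi => (hS.secant_diff hB hi).trans (by linarith)) ha hb hab
  refine le_trans ?_ h1
  have h2 : (c / 2 - 2 * (c / 8)) * (b - a) = c / (8 * P.vMax) * (b - a) * (2 * P.vMax) := by
    field_simp; ring
  rw [h2]
  have := sub_nonneg.2 hab
  exact mul_le_mul_of_nonneg_left hy.2 (by positivity)

end Problem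

end SURF

namespace SURF

namespace Problem

variable {d p k q : ℕ} {P : Problem d p k q} {G : ℝ → E 2} {Lx Lf K c : ℝ}

/-! ### One outer iteration -/

/-- The state of the distribution function maintained by the iteration: Lipschitz with constant
`Λ` and, for large `N`, with slope at least `ℓ`. -/
structure GoodCDF (F : ℝ → ℝ) (Λ ℓ N₀ N : ℝ) : Prop where
  isCDF : IsCDF F
  upper : ∀ a ∈ Icc (0 : ℝ) 1, ∀ b ∈ Icc (0 : ℝ) 1, a ≤ b → F b - F a ≤ Λ * (b - a)
  lower : N₀ ≤ N → ∀ a ∈ Icc (0 : ℝ) 1, ∀ b ∈ Icc (0 : ℝ) 1, a ≤ b → ℓ * (b - a) ≤ F b - F a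

theorem div_mem_Icc {n N : ℕ} (hN : 1 ≤ N) (hn : n ≤ N) : (n / N : ℝ) ∈ Icc (0 : ℝ) 1 := by
  have : (0 : ℝ) < N := Nat.cast_pos.2 hN
  exact ⟨by positivity, (div_le_one this).2 (Nat.cast_le.2 hn)⟩

theorem le_innerErr (R : Run d) (t : ℕ) {n : ℕ} (hn : n ≤ R.N) :
    ‖P.g (P.iterate R t n) - P.xStar (P.weight R t n)‖ ≤ P.innerErr R t :=
  Finset.le_sup' (fun n => ‖P.g (P.iterate R t n) - P.xStar (P.weight R t n)‖)
    (Finset.mem_range.2 (Nat.lt_succ_of_le hn))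

theorem innerErr_le {R : Run d} {t : ℕ} {b : ℝ}
    (h : ∀ n ≤ R.N, ‖P.g (P.iterate R t n) - P.xStar (P.weight R t n)‖ ≤ b) :
    P.innerErr R t ≤ b :=
  Finset.sup'_le _ _ fun n hn => h n (Nat.le_of_lt_succ (Finset.mem_range.1 hn))

theorem innerErr_nonneg (R : Run d) (t : ℕ) : 0 ≤ P.innerErr R t :=
  (norm_nonneg _).trans (le_innerErr R t (Nat.zero_le _))

theorem abs_sub_le_one {F F' : ℝ → ℝ} (hF : IsCDF F) (hF' : IsCDF F') {w : ℝ}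
    (hw : w ∈ Icc (0 : ℝ) 1) : |F w - F' w| ≤ 1 := by
  have h1 := hF.mem_Icc hw
  have h2 := hF'.mem_Icc hw
  rw [abs_le]
  constructor <;> linarith [h1.1, h1.2, h2.1, h2.2]

theorem le_cdfErr {R : Run d} {t : ℕ} (h : IsCDF (P.cdf R t)) (hΦ : IsCDF P.Phi) {w : ℝ}
    (hw : w ∈ Icc (0 : ℝ) 1) : |P.cdf R t w - P.Phi w| ≤ P.cdfErr R t :=
  le_ciSup (f := fun w : Icc (0 : ℝ) 1 => |P.cdf R t w - P.Phi w|)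
    ⟨1, by rintro _ ⟨w, rfl⟩; exact abs_sub_le_one h hΦ w.2⟩ ⟨w, hw⟩

theorem cdfErr_le {R : Run d} {t : ℕ} {b : ℝ}
    (h : ∀ w ∈ Icc (0 : ℝ) 1, |P.cdf R t w - P.Phi w| ≤ b) : P.cdfErr R t ≤ b :=
  ciSup_le fun w => h w w.2

theorem cdfErr_nonneg (R : Run d) (t : ℕ) : 0 ≤ P.cdfErr R t :=
  Real.iSup_nonneg fun _ => abs_nonneg _

theorem cdf_succ (R : Run d) (t : ℕ) (w : ℝ) : P.cdf R (t + 1) w =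
    R.α * P.rebuilt R.N (P.weight R t) (P.iterate R t) w + (1 - R.α) * P.cdf R t w := rfl

theorem weight_mem {R : Run d} {t : ℕ} (hN : 1 ≤ R.N) (h : IsCDF (P.cdf R t)) {n : ℕ}
    (hn : n ≤ R.N) : P.weight R t n ∈ Icc (0 : ℝ) 1 :=
  h.quantile_mem (div_mem_Icc hN hn)

theorem cdf_weight {R : Run d} {t : ℕ} (hN : 1 ≤ R.N) (h : IsCDF (P.cdf R t)) {n : ℕ}
    (hn : n ≤ R.N) : P.cdf R t (P.weight R t n) = n / R.N :=
  h.apply_quantile (div_mem_Icc hN hn)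

/-- Consecutive weights are `1 / N` apart in distribution value, so an upper slope bound limits gaps
from below and conversely. For few knots the gap bound is trivial once `A ≥ N`, which is the first
alternative. -/
theorem GoodCDF.sample {R : Run d} {t : ℕ} {Λ ℓ N₀ A : ℝ}
    (h : GoodCDF (P.cdf R t) Λ ℓ N₀ R.N) (hN : 1 ≤ R.N) (hΛ : 0 < Λ) (hℓ : 0 < ℓ) (hA : 0 ≤ A)
    (hA' : (R.N : ℝ) ≤ A ∨ N₀ ≤ R.N ∧ 1 / ℓ ≤ A)
    (hU : ∀ n ≤ R.N, P.iterate R t n ∈ P.U) (he : P.innerErr R t ≤ 1)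
    (hs : 4 * Lf * Λ * (R.N * P.innerErr R t) ≤ c) :
    P.Sample Lf c Λ A R.N (P.weight R t) (P.iterate R t) (P.innerErr R t) := by
  have hN0 : (0 : ℝ) < R.N := Nat.cast_pos.2 hN
  have hstep : ∀ n < R.N, P.cdf R t (P.weight R t (n + 1)) - P.cdf R t (P.weight R t n)
      = 1 / R.N := fun n hn => by
    rw [cdf_weight hN h.isCDF hn, cdf_weight hN h.isCDF hn.le]; push_cast; ring
  have hlt : ∀ n < R.N, P.weight R t n < P.weight R t (n + 1) := fun n hn => by
    refine (h.isCDF.strictMono.lt_iff_lt (weight_mem hN h.isCDF hn.le)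
      (weight_mem (n := n + 1) hN h.isCDF hn)).1 ?_
    have : (0 : ℝ) < 1 / R.N := by positivity
    linarith [hstep n hn]
  refine ⟨hΛ, hA, hN, ?_, ?_, fun n hn => ?_, fun n hn => ?_, hU, fun n hn => le_innerErr R t hn,
    he, hs⟩
  · rw [weight, Nat.cast_zero, zero_div]
    simpa [h.isCDF.zero] using h.isCDF.quantile_eq (w := 0) (by simp)
  · rw [weight, div_self hN0.ne']
    simpa [h.isCDF.one] using h.isCDF.quantile_eq (w := 1) (by simp)
  · have h1 := h.upper _ (weight_mem hN h.isCDF hn.le) _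
      (weight_mem (n := n + 1) hN h.isCDF hn) (hlt n hn).le
    rw [hstep n hn, div_le_iff₀ hN0] at h1
    rw [gap, div_le_iff₀ (by positivity)]
    linarith
  · rw [le_div_iff₀ hN0]
    rcases hA' with hA' | ⟨hN₀, hA'⟩
    · have h0 := weight_mem hN h.isCDF hn.le
      have h1 := weight_mem (n := n + 1) hN h.isCDF hn
      have : gap (P.weight R t) n ≤ 1 := by rw [gap]; linarith [h0.1, h1.2]
      exact (mul_le_of_le_one_left hN0.le this).trans hA'
    · refine le_trans ?_ hA'
      have h1 := h.lower hN₀ _ (weight_mem hN h.isCDF hn.le) _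
        (weight_mem (n := n + 1) hN h.isCDF hn) (hlt n hn).le
      rw [hstep n hn, le_div_iff₀ hN0] at h1
      rw [le_div_iff₀ hℓ, gap]
      linarith

/-- Error recursions of the outer iteration, with constants depending only on the problem. -/
theorem FrontBounds.exists_outer_step (hB : P.FrontBounds G Lx Lf K c) :
    ∃ Λ ℓ N₀ c₁ A B : ℝ, 0 < ℓ ∧ 0 < N₀ ∧ 0 < c₁ ∧ 0 < A ∧ 0 < B ∧
      (∀ N : ℝ, GoodCDF (fun w => w) Λ ℓ N₀ N) ∧
      ∀ (R : Run d) (t : ℕ), 1 ≤ R.N → 0 < R.α → R.α ≤ 1 →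
        GoodCDF (P.cdf R t) Λ ℓ N₀ R.N → (∀ n ≤ R.N, P.iterate R t n ∈ P.U) →
        R.N * P.innerErr R t ≤ c₁ →
        GoodCDF (P.cdf R (t + 1)) Λ ℓ N₀ R.N ∧
        P.cdfErr R (t + 1) ≤ (1 - R.α) * P.cdfErr R t
          + R.α * (A / R.N ^ 2 + B * (R.N * P.innerErr R t)) ∧
        (N₀ ≤ R.N → ∀ n ≤ R.N, |P.weight R (t + 1) n - P.weight R t n| ≤
          R.α / ℓ * (P.cdfErr R t + (A / R.N ^ 2 + B * (R.N * P.innerErr R t)))) := by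
  have hc := hB.c_pos
  have hv := hB.vMax_pos
  have hcv := hB.c_le_vMax
  have hLf := hB.Lf_nonneg
  have hK := hB.K_nonneg
  -- `Λ` and `ℓ` are the slope bounds of the rebuilt function, hence preserved by convex
  -- combination; `ℓ ≤ 1 ≤ Λ` admits the identity as start.
  set Λ := 32 * P.vMax / c with hΛdef
  set ℓ := c / (8 * P.vMax) with hℓdef
  have hΛ1 : 1 ≤ Λ := by rw [hΛdef, le_div_iff₀ hc]; linarith
  have hΛ : 0 < Λ := by linarith
  have hℓ : 0 < ℓ := by positivity
  have hℓ1 : ℓ ≤ 1 := by rw [hℓdef, div_le_iff₀ (by positivity)]; linarith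
  set B₁ := (K + K ^ 2 / (2 * c)) * (1 / ℓ)
  have hB₁ : 0 ≤ B₁ := by positivity
  -- The threshold `N₀` and the bound `c₁` each keep their part of the secant error below `c / 32`,
  -- as `Sample.rebuilt_lower` requires.
  set N₀ := 32 * B₁ / c + 1 with hN₀def
  have hN₀ : 0 < N₀ := by positivity
  set A₀ := 1 / ℓ + N₀ with hA₀def
  have hA₀ : 0 < A₀ := by positivity
  set c₁ := min 1 (c / (64 * (Lf * Λ + 1))) with hc₁def
  have hc₁ : 0 < c₁ := by positivity
  have hc₁' : 64 * (Lf * Λ) * c₁ ≤ c := by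
    have h1 : c₁ ≤ c / (64 * (Lf * Λ + 1)) := min_le_right _ _
    rw [le_div_iff₀ (by positivity)] at h1
    linarith
  set A := 4 / c * (5 * A₀ * ((K + K ^ 2 / (2 * c)) * A₀) + K ^ 2 / (2 * c) * A₀ ^ 3
    + K * A₀ ^ 2) + 1 with hAdef
  set B := 4 / c * (10 * A₀ * Lf * Λ + 2 * Lf) + 1 with hBdef
  have hA : 0 < A := by positivity
  have hBp : 0 < B := by positivity
  refine ⟨Λ, ℓ, N₀, c₁, A, B, hℓ, hN₀, hc₁, hA, hBp, fun N => ⟨⟨continuousOn_id, fun _ _ _ _ h => h,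
    rfl, rfl⟩, fun a _ b _ hab => ?_, fun _ a _ b _ hab => ?_⟩, ?_⟩
  · exact le_mul_of_one_le_left (sub_nonneg.2 hab) hΛ1
  · exact mul_le_of_le_one_left (sub_nonneg.2 hab) hℓ1
  intro R t hN hα hα1 hgood hU he
  have hN0 : (0 : ℝ) < R.N := Nat.cast_pos.2 hN
  have hN1 : (1 : ℝ) ≤ R.N := Nat.one_le_cast.2 hN
  set e := P.innerErr R t with hedef
  have he0 : 0 ≤ e := innerErr_nonneg R t
  have he1 : e ≤ 1 :=
    (le_mul_of_one_le_left he0 hN1).trans (he.trans (min_le_left _ _))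
  have hLΛ : 0 ≤ Lf * Λ := by positivity
  have hLe : 64 * (Lf * Λ) * (R.N * e) ≤ c :=
    (mul_le_mul_of_nonneg_left he (by positivity)).trans hc₁'
  have hLe0 : 0 ≤ Lf * Λ * (R.N * e) := by positivity
  have hS := hgood.sample (A := A₀) (Lf := Lf) (c := c) hN hΛ hℓ hA₀.le (by
    rcases le_total N₀ R.N with h | h
    · exact Or.inr ⟨h, by rw [hA₀def]; linarith⟩
    · exact Or.inl (h.trans (by rw [hA₀def]; have : 0 < 1 / ℓ := by positivity
                                linarith))) hU he1 (by rw [← hedef]; linarith)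
  have hcomb : IsCDF (P.cdf R (t + 1)) :=
    (hS.rebuilt_isCDF hB).convexComb hgood.isCDF hα.le hα1
  have herr : ∀ w ∈ Icc (0 : ℝ) 1, |P.rebuilt R.N (P.weight R t) (P.iterate R t) w - P.Phi w| ≤
      A / R.N ^ 2 + B * (R.N * e) := by
    intro w hw
    refine (hS.rebuilt_error hB hw).trans ?_
    rw [mul_add, ← mul_div_assoc, ← mul_assoc (4 / c)]
    refine add_le_add (div_le_div_of_nonneg_right (by rw [hAdef]; linarith) (by positivity))
      (mul_le_mul_of_nonneg_right (by rw [hBdef]; linarith) (by positivity))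
  have hα1' : 0 ≤ 1 - R.α := sub_nonneg.2 hα1
  have hgood' : GoodCDF (P.cdf R (t + 1)) Λ ℓ N₀ R.N := by
    refine ⟨hcomb, fun a ha b hb hab => ?_, fun hNN a ha b hb hab => ?_⟩
    · rw [cdf_succ, cdf_succ]
      have h1 := mul_le_mul_of_nonneg_left (hS.rebuilt_upper hB ha hb hab) hα.le
      have h2 := mul_le_mul_of_nonneg_left (hgood.upper a ha b hb hab) hα1'
      linarith
    · rw [cdf_succ, cdf_succ]
      -- The sharper gap constant avoids a circle: `A₀` contains `N₀`, which was itself chosen from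
      -- `1 / ℓ`.
      have hS' := hgood.sample (A := 1 / ℓ) (Lf := Lf) (c := c) hN hΛ hℓ (by positivity)
        (Or.inr ⟨hNN, le_rfl⟩) hU he1 (by rw [← hedef]; linarith)
      have hsmall : (K + K ^ 2 / (2 * c)) * (1 / ℓ) / R.N + 2 * Lf * Λ * (R.N * e) ≤ c / 16 := by
        have h1 : B₁ / R.N ≤ c / 32 := by
          rw [div_le_iff₀ hN0]
          have : 32 * B₁ / c ≤ R.N := by linarith
          rw [div_le_iff₀ hc] at this
          linarith
        linarith
      have h1 := mul_le_mul_of_nonneg_left (hS'.rebuilt_lower hB hsmall ha hb hab) hα.le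
      have h2 := mul_le_mul_of_nonneg_left (hgood.lower hNN a ha b hb hab) hα1'
      linarith
  refine ⟨hgood', cdfErr_le fun w hw => ?_, fun hNN n hn => ?_⟩
  · have h1 := le_cdfErr hgood.isCDF hB.isCDF_Phi hw
    have h2 := herr w hw
    have e1 : P.cdf R (t + 1) w - P.Phi w =
        R.α * (P.rebuilt R.N (P.weight R t) (P.iterate R t) w - P.Phi w)
          + (1 - R.α) * (P.cdf R t w - P.Phi w) := by
      rw [cdf_succ]; ring
    rw [e1]
    refine (abs_add_le _ _).trans ?_
    rw [abs_mul, abs_mul, abs_of_pos hα, abs_of_nonneg hα1']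
    have h3 := mul_le_mul_of_nonneg_left h1 hα1'
    have h4 := mul_le_mul_of_nonneg_left h2 hα.le
    linarith
  · set w := P.weight R t n
    set w' := P.weight R (t + 1) n
    have hw : w ∈ Icc (0 : ℝ) 1 := weight_mem hN hgood.isCDF hn
    have hw' : w' ∈ Icc (0 : ℝ) 1 := weight_mem hN hcomb hn
    have hFw : P.cdf R t w = n / R.N := cdf_weight hN hgood.isCDF hn
    have hFw' : P.cdf R (t + 1) w' = n / R.N := cdf_weight hN hcomb hn
    have h1 := le_cdfErr hgood.isCDF hB.isCDF_Phi hw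
    have h2 := herr w hw
    -- Both weights have distribution value `n / N` at their own times, so the increment equals the
    -- change of the distribution function at `w`; the lower slope bound turns it into a
    -- displacement.
    have h3 : |P.cdf R (t + 1) w' - P.cdf R (t + 1) w| ≤
        R.α * (P.cdfErr R t + (A / R.N ^ 2 + B * (R.N * e))) := by
      have e1 : P.cdf R (t + 1) w' - P.cdf R (t + 1) w = R.α *
          ((P.cdf R t w - P.Phi w) -
            (P.rebuilt R.N (P.weight R t) (P.iterate R t) w - P.Phi w)) := by
        rw [hFw', ← hFw, cdf_succ]; ring
      rw [e1, abs_mul, abs_of_pos hα]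
      refine mul_le_mul_of_nonneg_left ?_ hα.le
      exact (abs_sub _ _).trans (add_le_add h1 h2)
    have h4 : ℓ * |w' - w| ≤ |P.cdf R (t + 1) w' - P.cdf R (t + 1) w| := by
      rcases le_total w w' with h | h
      · rw [abs_of_nonneg (sub_nonneg.2 h)]
        exact (hgood'.lower hNN w hw w' hw' h).trans (le_abs_self _)
      · rw [abs_sub_comm, abs_of_nonneg (sub_nonneg.2 h), abs_sub_comm]
        exact (hgood'.lower hNN w' hw' w hw h).trans (le_abs_self _)
    rw [div_mul_eq_mul_div, le_div_iff₀ hℓ, mul_comm]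
    exact h4.trans h3

/-! ### Reduction to a recursion for two real sequences. -/

/-- The coupled recursion for the distribution error `D` and the inner error `e`; it holds at every
step at which the iteration is in a good state and the inner error is small. -/
structure ErrorRecursion (N₀ c₁ A B Q N α η : ℝ) (D e : ℕ → ℝ) (Good : ℕ → Prop) : Prop where
  zero : Good 0
  D_nonneg : ∀ t, 0 ≤ D t
  D_le_one : ∀ t, Good t → D t ≤ 1
  e_nonneg : ∀ t, 0 ≤ e t
  good_succ : ∀ t, Good t → N * e t ≤ c₁ → Good (t + 1)
  D_succ : ∀ t, Good t → N * e t ≤ c₁ →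
    D (t + 1) ≤ (1 - α) * D t + α * (A / N ^ 2 + B * (N * e t))
  e_succ : ∀ t, Good t → N * e t ≤ c₁ → e (t + 1) ≤ η * (e t + Q)
  e_succ' : N₀ ≤ N → ∀ t, Good t → N * e t ≤ c₁ →
    e (t + 1) ≤ η * (e t + Q * (α * (D t + (A / N ^ 2 + B * (N * e t)))))

/-- A warm start is off by the old inner error plus the motion of the target, which is Lipschitz in
the weight. The constant `Q` serves both the crude displacement bound `1` and the refined one. -/
theorem FrontBounds.exists_errorRecursion (hB : P.FrontBounds G Lx Lf K c) :
    ∃ N₀ c₁ A B Q : ℝ, 0 < N₀ ∧ 0 < c₁ ∧ 0 < A ∧ 0 < B ∧ 0 < Q ∧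
      ∀ (R : Run d) (η : ℝ), 1 ≤ R.N → 0 < R.α → R.α ≤ 1 → 0 ≤ η →
        (∀ n ≤ R.N, P.iterate R 0 n ∈ P.U) → P.WarmContraction R η →
        ∃ Good : ℕ → Prop, (∀ t, Good t → IsCDF (P.cdf R t)) ∧
          ErrorRecursion N₀ c₁ A B Q R.N R.α η (P.cdfErr R) (P.innerErr R) Good := by
  obtain ⟨Λ, ℓ, N₀, c₁, A, B, hℓ, hN₀, hc₁, hA, hBp, hinit, hstep⟩ := hB.exists_outer_step
  have hLx := hB.Lx_nonneg
  refine ⟨N₀, c₁, A, B, Lx + Lx / ℓ + 1, hN₀, hc₁, hA, hBp, by positivity, ?_⟩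
  intro R η hN hα hα1 hη hU hwarm
  have hN0 : (0 : ℝ) < R.N := Nat.cast_pos.2 hN
  have hUt : ∀ t, ∀ n ≤ R.N, P.iterate R t n ∈ P.U := by
    intro t
    cases t with
    | zero => exact hU
    | succ t => exact fun n hn => (hwarm t n hn).1
  -- contraction of the inner error in terms of the displacement of the weights
  have hinner : ∀ t (δ : ℝ), IsCDF (P.cdf R t) → IsCDF (P.cdf R (t + 1)) →
      (∀ n ≤ R.N, |P.weight R (t + 1) n - P.weight R t n| ≤ δ) →
      P.innerErr R (t + 1) ≤ η * (P.innerErr R t + Lx * δ) := by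
    intro t δ h h' hδ
    refine innerErr_le fun n hn => (hwarm t n hn).2.trans (mul_le_mul_of_nonneg_left ?_ hη)
    have h1 := le_innerErr (P := P) R t hn
    have h2 := hB.xStar_lip _ (weight_mem hN h hn) _ (weight_mem hN h' hn)
    rw [abs_sub_comm] at h2
    have h3 := mul_le_mul_of_nonneg_left (hδ n hn) hLx
    calc _ = ‖(P.g (P.iterate R t n) - P.xStar (P.weight R t n))
          + (P.xStar (P.weight R t n) - P.xStar (P.weight R (t + 1) n))‖ := by congr 1; abel
      _ ≤ _ := (norm_add_le _ _).trans (by linarith)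
  have hweight : ∀ t, IsCDF (P.cdf R t) → IsCDF (P.cdf R (t + 1)) → ∀ n ≤ R.N,
      |P.weight R (t + 1) n - P.weight R t n| ≤ 1 := by
    intro t h h' n hn
    have h1 := weight_mem hN h hn
    have h2 := weight_mem hN h' hn
    rw [abs_le]
    constructor <;> linarith [h1.1, h1.2, h2.1, h2.2]
  refine ⟨fun t => GoodCDF (P.cdf R t) Λ ℓ N₀ R.N, fun t h => h.isCDF, hinit R.N, cdfErr_nonneg R,
    fun t h => cdfErr_le fun w hw => abs_sub_le_one h.isCDF hB.isCDF_Phi hw, innerErr_nonneg R,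
    fun t h he => (hstep R t hN hα hα1 h (hUt t) he).1,
    fun t h he => (hstep R t hN hα hα1 h (hUt t) he).2.1, fun t h he => ?_, fun hNN t h he => ?_⟩
  · have h' := (hstep R t hN hα hα1 h (hUt t) he).1.isCDF
    refine (hinner t 1 h.isCDF h' (hweight t h.isCDF h')).trans
      (mul_le_mul_of_nonneg_left ?_ hη)
    have : 0 ≤ Lx / ℓ := by positivity
    linarith
  · obtain ⟨h1, -, h3⟩ := hstep R t hN hα hα1 h (hUt t) he
    refine (hinner t _ h.isCDF h1.isCDF (h3 hNN)).trans (mul_le_mul_of_nonneg_left ?_ hη)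
    have h4 : 0 ≤ R.α * (P.cdfErr R t + (A / R.N ^ 2 + B * (R.N * P.innerErr R t))) := by
      have := cdfErr_nonneg (P := P) R t
      have := innerErr_nonneg (P := P) R t
      positivity
    have h5 : Lx * (R.α / ℓ * (P.cdfErr R t + (A / R.N ^ 2 + B * (R.N * P.innerErr R t)))) =
        Lx / ℓ * (R.α * (P.cdfErr R t + (A / R.N ^ 2 + B * (R.N * P.innerErr R t)))) := by
      ring
    rw [h5]
    have := mul_nonneg hLx h4
    linarith

end Problem

end SURF

namespace SURF

namespace Problem

/-! ### Analysis of the error recursion -/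

/-- The constant `4 * r` is the fixed point of the recursion. -/
theorem geometric_recursion {α r : ℝ} {L : ℕ → ℝ} (hα1 : α ≤ 1) (hr : 0 ≤ r)
    (h : ∀ t, L (t + 1) ≤ (1 - α / 4) * L t + α * r) (t : ℕ) :
    L t ≤ (1 - α / 4) ^ t * L 0 + 4 * r := by
  induction t with
  | zero => simp [hr]
  | succ t ih =>
    have h1 := mul_le_mul_of_nonneg_left ih (by linarith : 0 ≤ 1 - α / 4)
    rw [pow_succ']
    linarith [h t]

theorem halving_recursion {r : ℝ} {e : ℕ → ℝ} (hr : 0 ≤ r) {t₀ : ℕ}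
    (h : ∀ t ≥ t₀, e (t + 1) ≤ 1 / 2 * e t + r) (j : ℕ) :
    e (t₀ + j) ≤ (1 / 2) ^ j * e t₀ + 2 * r := by
  induction j with
  | zero => simp [hr]
  | succ j ih =>
    have := h (t₀ + j) (Nat.le_add_right _ _)
    rw [pow_succ', ← add_assoc]
    linarith

variable {N₀ c₁ A B Q N α η : ℝ} {D e : ℕ → ℝ} {Good : ℕ → Prop}

namespace ErrorRecursion

/-- The recursion inequalities are conditional on a good state and a small inner error, so the two
are carried through one induction. -/
theorem invariant_of_step (hR : ErrorRecursion N₀ c₁ A B Q N α η D e Good) (h0 : N * e 0 ≤ c₁)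
    (hs : ∀ t, Good t → N * e t ≤ c₁ → N * e (t + 1) ≤ c₁) (t : ℕ) :
    Good t ∧ N * e t ≤ c₁ := by
  induction t with
  | zero => exact ⟨hR.zero, h0⟩
  | succ t ih => exact ⟨hR.good_succ t ih.1 ih.2, hs t ih.1 ih.2⟩

theorem e_le (hR : ErrorRecursion N₀ c₁ A B Q N α η D e Good) (hN : 1 ≤ N) {t : ℕ}
    (h : N * e t ≤ c₁) : e t ≤ c₁ :=
  (le_mul_of_one_le_left (hR.e_nonneg t) hN).trans h

/-- For few knots every bound follows from boundedness of the errors. -/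
theorem trivial_bound (hR : ErrorRecursion N₀ c₁ A B Q N α η D e Good) (hN : 1 ≤ N) (hN₀ : N ≤ N₀)
    {C b F : ℝ} (hα1 : α ≤ 1) (hC : 0 ≤ C) {t : ℕ} (hg : Good t) (hCe : C * e t ≤ b)
    (hF : (1 + b) * N₀ ^ 2 ≤ F) (hb : 0 ≤ b) :
    D t + C * e t ≤ (1 - α / 4) ^ t * (D 0 + C * e 0) + F / N ^ 2 := by
  have h1 : 1 + b ≤ F / N ^ 2 := by
    rw [le_div_iff₀ (by positivity)]
    refine le_trans (mul_le_mul_of_nonneg_left ?_ (by positivity)) hF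
    exact pow_le_pow_left₀ (by positivity) hN₀ 2
  have h2 : 0 ≤ (1 - α / 4) ^ t * (D 0 + C * e 0) :=
    mul_nonneg (pow_nonneg (by linarith) _)
      (add_nonneg (hR.D_nonneg 0) (mul_nonneg hC (hR.e_nonneg 0)))
  linarith [hR.D_le_one t hg]

/-- Invariance of the inner accuracy when the contraction factor is of order `1/N`. -/
theorem invariant_small (hR : ErrorRecursion N₀ c₁ A B Q N α η D e Good) (hN : 1 ≤ N)
    (hη : 0 ≤ η) (hQ : 0 < Q) {x : ℝ} (hx : N * η ≤ x) (hx1 : x * (c₁ + Q) ≤ c₁)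
    (h0 : N * e 0 ≤ c₁) (t : ℕ) : Good t ∧ N * e t ≤ c₁ := by
  refine hR.invariant_of_step h0 (fun t hg he => ?_) t
  have h1 := mul_le_mul_of_nonneg_left (hR.e_succ t hg he) (by linarith : 0 ≤ N)
  have h2 : N * η * (e t + Q) ≤ x * (c₁ + Q) :=
    mul_le_mul hx (by linarith [hR.e_le hN he]) (add_nonneg (hR.e_nonneg t) hQ.le)
      ((mul_nonneg (by linarith) hη).trans hx)
  linarith

/-- Lyapunov decay when the contraction factor is of order `1/N`. -/
theorem lyapunov_small (hR : ErrorRecursion N₀ c₁ A B Q N α η D e Good) (hN : 1 ≤ N)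
    (hα : 0 < α) (hα1 : α ≤ 1 / 2) (hη : 0 ≤ η) (hA : 0 < A) (hB : 0 < B) (hQ : 0 < Q)
    (hc₁ : 0 < c₁) {x κ F : ℝ}
    (hx : N * η ≤ x) (hx1 : x * (c₁ + Q) ≤ c₁) (hx2 : κ * x * Q ≤ 1 / 4) (hx3 : x ≤ 1 / 8)
    (hκ : 4 * B ≤ κ) (hF : 5 * A ≤ F) (hF' : (1 + κ * c₁) * N₀ ^ 2 ≤ F)
    (h0 : N * e 0 ≤ c₁) (t : ℕ) :
    D t + κ * N * e t ≤ (1 - α / 4) ^ t * (D 0 + κ * N * e 0) + F / N ^ 2 := by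
  have hinv := hR.invariant_small hN hη hQ hx hx1 h0
  have hκ0 : 0 < κ := by linarith
  have hN0 : 0 < N := by linarith
  rcases le_total N₀ N with hNN | hNN
  · have hrec : ∀ t, D (t + 1) + κ * N * e (t + 1) ≤
        (1 - α / 4) * (D t + κ * N * e t) + α * (5 / 4 * (A / N ^ 2)) := by
      intro t
      obtain ⟨hg, he⟩ := hinv t
      have h1 := hR.D_succ t hg he
      have h2 := mul_le_mul_of_nonneg_left (hR.e_succ' hNN t hg he)
        (by positivity : 0 ≤ κ * N)
      have he0 := hR.e_nonneg t
      have hD0 := hR.D_nonneg t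
      set S := D t + (A / N ^ 2 + B * (N * e t)) with hS
      have hS0 : 0 ≤ S := by positivity
      -- The displacement feeds back at most `α S / 4`, the memory term at most an eighth of `κ N
      -- e`, and the choice of `κ` bounds the noise in `D` by `α / 4` of it; together these leave
      -- the decay `1 - α / 4`.
      have h3 : κ * N * (η * (e t + Q * (α * S))) ≤ κ * x * (e t + Q * (α * S)) := by
        have : κ * (N * η) ≤ κ * x := mul_le_mul_of_nonneg_left hx hκ0.le
        have := mul_le_mul_of_nonneg_right this
          (by positivity : 0 ≤ e t + Q * (α * S))
        linarith
      have h4 : κ * x * Q * (α * S) ≤ 1 / 4 * (α * S) :=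
        mul_le_mul_of_nonneg_right hx2 (by positivity)
      have h5 : κ * x * e t ≤ κ * (1 / 8) * (N * e t) := by
        refine mul_le_mul (mul_le_mul_of_nonneg_left hx3 hκ0.le)
          (le_mul_of_one_le_left he0 hN) he0 (by positivity)
      have h6 : B * (N * e t) ≤ κ / 4 * (N * e t) :=
        mul_le_mul_of_nonneg_right (by linarith) (by positivity)
      have hY : 0 ≤ κ * (N * e t) := by positivity
      have hZ : 0 ≤ A / N ^ 2 := by positivity
      have h7 := mul_le_mul_of_nonneg_left h6 hα.le
      have h8 := mul_le_mul_of_nonneg_right hα1 hY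
      have h9 := mul_nonneg hα.le hD0
      rw [hS] at h3 h4 h2
      linarith
    have := geometric_recursion (L := fun t => D t + κ * N * e t) (by linarith)
      (by positivity) hrec t
    refine this.trans (add_le_add_right ?_ _)
    rw [show 4 * (5 / 4 * (A / N ^ 2)) = 5 * A / N ^ 2 by ring]
    exact div_le_div_of_nonneg_right hF (by positivity)
  · refine hR.trivial_bound hN hNN (by linarith) (by positivity) (hinv t).1
      (b := κ * c₁) ?_ hF' (by positivity)
    rw [mul_assoc]
    exact mul_le_mul_of_nonneg_left (hinv t).2 hκ0.le

/-- Admissible contraction factors of order one, for damping of order `1/N`. -/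
structure ModerateContraction (N₀ c₁ A B Q N α η M s : ℝ) : Prop where
  M_pos : 0 < M
  s_pos : 0 < s
  half : η * (1 + M * α * (N / s)) ≤ 1 / 2
  quarter : η * ((1 + 4 * B * α * N) * M) ≤ 1 / 4
  M_ge : Q ≤ M
  M_ge' : Q * B * s ≤ M
  M_ge'' : (1 + A) * Q * s ≤ c₁ * M
  M_ge''' : (c₁ + Q) * N₀ ≤ 4 * M * c₁

section Moderate

variable {M s : ℝ}

/-- Because `M / s ≥ Q B`, the first condition on `η` also covers the feedback of the inner error
through the weights it displaces. -/
theorem ModerateContraction.eta_mul_le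
    (hM : ModerateContraction N₀ c₁ A B Q N α η M s) (hN : 1 ≤ N) (hα : 0 < α) (hη : 0 ≤ η) :
    η * (1 + Q * B * α * N) ≤ 1 / 2 := by
  refine le_trans (mul_le_mul_of_nonneg_left ?_ hη) hM.half
  have hs := hM.s_pos
  have h1 : Q * B ≤ M / s := by rw [le_div_iff₀ hs]; exact hM.M_ge'
  have h2 := mul_le_mul_of_nonneg_right h1 (by positivity : 0 ≤ α * N)
  have h3 : M * α * (N / s) = M / s * (α * N) := by ring
  rw [h3]
  linarith

theorem ModerateContraction.eta_le_half
    (hM : ModerateContraction N₀ c₁ A B Q N α η M s) (hN : 1 ≤ N) (hα : 0 < α) (hη : 0 ≤ η) :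
    η ≤ 1 / 2 := by
  refine le_trans (le_mul_of_one_le_right hη ?_) hM.half
  have := hM.s_pos
  have := hM.M_pos
  have : 0 ≤ M * α * (N / s) := by positivity
  linarith

/-- The inner error recursion without the distribution error. -/
theorem e_succ_moderate (hR : ErrorRecursion N₀ c₁ A B Q N α η D e Good)
    (hα : 0 < α) (hη : 0 ≤ η) (hQ : 0 < Q) (hNN : N₀ ≤ N)
    {t : ℕ} (hg : Good t) (he : N * e t ≤ c₁) {b : ℝ} (hD : D t + A / N ^ 2 ≤ b) :
    e (t + 1) ≤ η * (1 + Q * B * α * N) * e t + η * α * (Q * b) := by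
  have h1 := hR.e_succ' hNN t hg he
  have h2 : η * (Q * α) * (D t + A / N ^ 2) ≤ η * (Q * α) * b :=
    mul_le_mul_of_nonneg_left hD (by positivity)
  linarith

/-- For `N ≥ N₀` the old error is halved and the displacement contributes at most `c₁ / 2`, by
`half` and `M_ge''`. For fewer knots `η ≤ 1 / (4 M)` and the crude recursion suffice. -/
theorem invariant_moderate (hR : ErrorRecursion N₀ c₁ A B Q N α η D e Good) (hN : 1 ≤ N)
    (hα : 0 < α) (hη : 0 ≤ η) (hA : 0 < A) (hB : 0 < B) (hQ : 0 < Q) (hc₁ : 0 < c₁)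
    (hM : ModerateContraction N₀ c₁ A B Q N α η M s) (h0 : N * e 0 ≤ c₁) (t : ℕ) :
    Good t ∧ N * e t ≤ c₁ := by
  have hN0 : 0 < N := by linarith
  have hs := hM.s_pos
  have hMp := hM.M_pos
  refine hR.invariant_of_step h0 (fun t hg he => ?_) t
  have he0 := hR.e_nonneg t
  rcases le_total N₀ N with hNN | hNN
  · have h1 := hR.e_succ_moderate hα hη hQ hNN hg he (b := 1 + A) (add_le_add
      (hR.D_le_one t hg) (div_le_self hA.le (one_le_pow₀ hN)))
    have h2 := mul_le_mul_of_nonneg_right (hM.eta_mul_le hN hα hη) he0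
    have h3 : N * (η * α * (Q * (1 + A))) ≤ c₁ / 2 := by
      have h4 : η * (M * α * (N / s)) ≤ 1 / 2 := by
        have := hM.half
        linarith
      have h5 := mul_le_mul_of_nonneg_left h4 hc₁.le
      have h6 := mul_le_mul_of_nonneg_left hM.M_ge'' (by positivity : 0 ≤ N * η * α / s)
      have e1 : N * η * α / s * ((1 + A) * Q * s) = N * (η * α * (Q * (1 + A))) := by
        field_simp
      have e2 : N * η * α / s * (c₁ * M) = c₁ * (η * (M * α * (N / s))) := by
        field_simp
      rw [e1, e2] at h6
      linarith
    have h7 := mul_le_mul_of_nonneg_left h1 hN0.le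
    have h8 := mul_le_mul_of_nonneg_left h2 hN0.le
    linarith
  · have h1 := hR.e_succ t hg he
    have h2 : η * (4 * M) ≤ 1 := by
      have h3 : η * M ≤ η * ((1 + 4 * B * α * N) * M) :=
        mul_le_mul_of_nonneg_left (le_mul_of_one_le_left hMp.le
          (by have : 0 ≤ 4 * B * α * N := by positivity
              linarith)) hη
      linarith [hM.quarter]
    have h4 : N * (η * (e t + Q)) ≤ N₀ * (η * (c₁ + Q)) := by
      refine mul_le_mul hNN (mul_le_mul_of_nonneg_left ?_ hη) (by positivity) (by linarith)
      linarith [hR.e_le hN he]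
    have h5 := mul_le_mul_of_nonneg_left hM.M_ge''' hη
    have h6 := mul_le_mul_of_nonneg_right h2 hc₁.le
    have h7 := mul_le_mul_of_nonneg_left h1 hN0.le
    linarith

/-- The weight `1 + 4 B α N` absorbs the noise in `D` into a quarter of the weighted inner error;
memory and feedback take a half, and three quarters is at most `1 - α / 4`. The `quarter` condition
limits the displacement to `α / 4` of `D + A / N²`. -/
theorem lyapunov_moderate (hR : ErrorRecursion N₀ c₁ A B Q N α η D e Good) (hN : 1 ≤ N)
    (hα : 0 < α) (hα1 : α ≤ 1) (hη : 0 ≤ η) (hA : 0 < A) (hB : 0 < B) (hQ : 0 < Q) (hc₁ : 0 < c₁)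
    (hM : ModerateContraction N₀ c₁ A B Q N α η M s) (h0 : N * e 0 ≤ c₁) {a₂ F : ℝ}
    (ha₂ : α * N ≤ a₂) (hF : 5 * A ≤ F)
    (hF' : (1 + (1 + 4 * B * a₂) * c₁) * N₀ ^ 2 ≤ F) (t : ℕ) :
    D t + (1 + 4 * B * α * N) * e t ≤
      (1 - α / 4) ^ t * (D 0 + (1 + 4 * B * α * N) * e 0) + F / N ^ 2 := by
  have hinv := hR.invariant_moderate hN hα hη hA hB hQ hc₁ hM h0
  have hN0 : 0 < N := by linarith
  set C := 1 + 4 * B * α * N with hC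
  have hC0 : 0 < C := by positivity
  rcases le_total N₀ N with hNN | hNN
  · have hrec : ∀ t, D (t + 1) + C * e (t + 1) ≤
        (1 - α / 4) * (D t + C * e t) + α * (5 / 4 * (A / N ^ 2)) := by
      intro t
      obtain ⟨hg, he⟩ := hinv t
      have h1 := hR.D_succ t hg he
      have he0 := hR.e_nonneg t
      have hD0 := hR.D_nonneg t
      have h2 := mul_le_mul_of_nonneg_left (hR.e_succ_moderate hα hη hQ hNN hg he le_rfl) hC0.le
      have hZ : 0 ≤ A / N ^ 2 := by positivity
      have h3 : C * (η * α * (Q * (D t + A / N ^ 2))) ≤ 1 / 4 * (α * (D t + A / N ^ 2)) := by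
        have h4 : η * (C * Q) ≤ 1 / 4 :=
          (mul_le_mul_of_nonneg_left (mul_le_mul_of_nonneg_left hM.M_ge hC0.le) hη).trans
            hM.quarter
        have := mul_le_mul_of_nonneg_right h4 (by positivity : 0 ≤ α * (D t + A / N ^ 2))
        linarith
      have h5 : C * (η * (1 + Q * B * α * N) * e t) ≤ C * (1 / 2 * e t) :=
        mul_le_mul_of_nonneg_left
          (mul_le_mul_of_nonneg_right (hM.eta_mul_le hN hα hη) he0) hC0.le
      have h6 : α * (B * (N * e t)) ≤ 1 / 4 * (C * e t) := by rw [hC]; linarith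
      have h7 : α * (C * e t) ≤ C * e t := mul_le_of_le_one_left (by positivity) hα1
      have h8 : 0 ≤ α * D t := mul_nonneg hα.le hD0
      linarith
    have := geometric_recursion (L := fun t => D t + C * e t) hα1 (by positivity) hrec t
    refine this.trans (add_le_add_right ?_ _)
    rw [show 4 * (5 / 4 * (A / N ^ 2)) = 5 * A / N ^ 2 by ring]
    exact div_le_div_of_nonneg_right hF (by positivity)
  · have ha₂0 : 0 ≤ a₂ := (by positivity : 0 ≤ α * N).trans ha₂
    refine hR.trivial_bound hN hNN hα1 hC0.le (hinv t).1
      (b := (1 + 4 * B * a₂) * c₁) ?_ hF' (by positivity)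
    refine mul_le_mul ?_ (hR.e_le hN (hinv t).2) (hR.e_nonneg t) (by positivity)
    rw [hC]
    have := mul_le_mul_of_nonneg_left ha₂ (by positivity : 0 ≤ 4 * B)
    linarith

/-- The number `5` exceeds `3 / log 2`. -/
theorem half_pow_le {j : ℕ} (hN : 1 ≤ N) (hj : 5 * Real.log (N + 1) ≤ (j : ℝ) + 1) :
    (1 / 2 : ℝ) ^ j ≤ 2 / N ^ 3 := by
  have hN0 : 0 < N := by linarith
  have hlog : 0 ≤ Real.log (N + 1) := Real.log_nonneg (by linarith)
  have h1 : (N + 1) ^ 3 ≤ (2 : ℝ) ^ (j + 1) := by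
    rw [← Real.log_le_log_iff (by positivity) (by positivity), Real.log_pow, Real.log_pow]
    have h2 := Real.log_two_gt_d9
    push_cast
    nlinarith
  have h3 : N ^ 3 ≤ 2 ^ (j + 1) :=
    (pow_le_pow_left₀ hN0.le (by linarith) 3).trans h1
  rw [one_div, inv_pow, le_div_iff₀ (by positivity), inv_mul_le_iff₀ (by positivity)]
  rw [pow_succ (2 : ℝ)] at h3
  linarith

/-- After the distribution error has settled, the inner error becomes of order `α η N⁻²`. -/
theorem e_final_moderate (hR : ErrorRecursion N₀ c₁ A B Q N α η D e Good) (hN : 1 ≤ N)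
    (hα : 0 < α) (hη : 0 ≤ η) (hA : 0 < A) (hB : 0 < B) (hQ : 0 < Q) (hc₁ : 0 < c₁)
    (hN₀ : 0 < N₀) (hM : ModerateContraction N₀ c₁ A B Q N α η M s) (h0 : N * e 0 ≤ c₁)
    {a₁ a₂ F : ℝ}
    (ha₁ : 0 < a₁) (ha₁' : a₁ ≤ α * N) (ha₂ : α * N ≤ a₂) {t₀ : ℕ}
    (hF0 : 0 ≤ F) (hF : ∀ t ≥ t₀, D t ≤ F / N ^ 2) {t : ℕ}
    (ht : (t₀ : ℝ) + 5 * Real.log (N + 1) ≤ t) :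
    e t ≤ ((1 + Q * B * a₂) * (2 * c₁ / a₁ + Q * (F + A)) + Q * (F + A)
      + (c₁ + Q) * N₀ ^ 3 / a₁) * (α * η / N ^ 2) := by
  have hinv := hR.invariant_moderate hN hα hη hA hB hQ hc₁ hM h0
  have hN0 : 0 < N := by linarith
  have ha₂0 : 0 ≤ a₂ := ha₁.le.trans (ha₁'.trans ha₂)
  have hlog2 : Real.log 2 ≤ Real.log (N + 1) :=
    Real.log_le_log two_pos (by linarith)
  have hlog := Real.log_two_gt_d9
  -- The halving phase of length `j` brings the error only to order `α N⁻²`; the last step is kept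
  -- apart because it supplies the factor `η`.
  obtain ⟨j, rfl⟩ : ∃ j, t = t₀ + j + 1 := by
    have : (t₀ : ℝ) + 1 ≤ t := by linarith
    have : t₀ + 1 ≤ t := by exact_mod_cast this
    exact ⟨t - t₀ - 1, by omega⟩
  push_cast at ht
  obtain ⟨hg, he⟩ := hinv (t₀ + j)
  have hW : 0 ≤ Q * (F + A) := by positivity
  -- The lower bound on the damping trades a factor `1 / N` for `α`.
  have hfrac : 1 / N ^ 3 ≤ α / (a₁ * N ^ 2) := by
    rw [div_le_div_iff₀ (by positivity) (by positivity)]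
    have := mul_le_mul_of_nonneg_right ha₁' (by positivity : 0 ≤ N ^ 2)
    linarith
  have hX : 0 ≤ α * η / N ^ 2 := by positivity
  rcases le_total N₀ N with hNN | hNN
  · have hstep : ∀ t ≥ t₀, e (t + 1) ≤
        η * (1 + Q * B * α * N) * e t + Q * (F + A) * (α * η / N ^ 2) := by
      intro t ht
      have h1 := hR.e_succ_moderate hα hη hQ hNN (hinv t).1 (hinv t).2
        (b := (F + A) / N ^ 2) (by rw [add_div]; exact add_le_add (hF t ht) le_rfl)
      refine h1.trans (le_of_eq ?_)
      ring
    have hhalf := halving_recursion (e := e) (r := Q * (F + A) * (α * η / N ^ 2)) (by positivity)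
      (fun t ht => (hstep t ht).trans (add_le_add
        (mul_le_mul_of_nonneg_right (hM.eta_mul_le hN hα hη) (hR.e_nonneg t)) le_rfl)) j
    have hpow : (1 / 2 : ℝ) ^ j * e t₀ ≤ 2 * c₁ / a₁ * (α / N ^ 2) := by
      have h1 : (1 / 2 : ℝ) ^ j * e t₀ ≤ 2 / N ^ 3 * c₁ :=
        mul_le_mul (half_pow_le hN (by linarith)) (hR.e_le hN (hinv t₀).2) (hR.e_nonneg _)
          (by positivity)
      have h2 := mul_le_mul_of_nonneg_left hfrac (by positivity : 0 ≤ 2 * c₁)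
      have e1 : 2 * c₁ * (1 / N ^ 3) = 2 / N ^ 3 * c₁ := by ring
      have e2 : 2 * c₁ * (α / (a₁ * N ^ 2)) = 2 * c₁ / a₁ * (α / N ^ 2) := by
        field_simp
      rw [e1, e2] at h2
      exact h1.trans h2
    have hη2 : 2 * (Q * (F + A) * (α * η / N ^ 2)) ≤ Q * (F + A) * (α / N ^ 2) := by
      have h1 := mul_le_mul_of_nonneg_right (hM.eta_le_half hN hα hη)
        (by positivity : 0 ≤ Q * (F + A) * (α / N ^ 2))
      have e1 : Q * (F + A) * (α * η / N ^ 2) = η * (Q * (F + A) * (α / N ^ 2)) := by ring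
      rw [e1]
      linarith
    have hlast := hstep (t₀ + j) (Nat.le_add_right _ _)
    have h3 : e (t₀ + j) ≤ (2 * c₁ / a₁ + Q * (F + A)) * (α / N ^ 2) := by linarith
    have h4 : η * (1 + Q * B * α * N) * e (t₀ + j) ≤
        η * (1 + Q * B * a₂) * ((2 * c₁ / a₁ + Q * (F + A)) * (α / N ^ 2)) := by
      refine mul_le_mul (mul_le_mul_of_nonneg_left ?_ hη) h3 (hR.e_nonneg _) (by positivity)
      have := mul_le_mul_of_nonneg_left ha₂ (by positivity : 0 ≤ Q * B)
      linarith
    have h5 : η * (1 + Q * B * a₂) * ((2 * c₁ / a₁ + Q * (F + A)) * (α / N ^ 2)) =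
        (1 + Q * B * a₂) * (2 * c₁ / a₁ + Q * (F + A)) * (α * η / N ^ 2) := by ring
    have h6 : 0 ≤ (c₁ + Q) * N₀ ^ 3 / a₁ * (α * η / N ^ 2) := by positivity
    rw [add_mul, add_mul]
    linarith
  · have h1 := hR.e_succ _ hg he
    have h2 : η * (e (t₀ + j) + Q) ≤ η * (c₁ + Q) :=
      mul_le_mul_of_nonneg_left (by linarith [hR.e_le hN he]) hη
    have h3 : 1 ≤ N₀ ^ 3 / a₁ * (α / N ^ 2) := by
      have h4 : N ^ 3 ≤ N₀ ^ 3 := pow_le_pow_left₀ hN0.le hNN 3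
      have h5 : N ^ 3 * (1 / N ^ 3) ≤ N₀ ^ 3 * (α / (a₁ * N ^ 2)) :=
        mul_le_mul h4 hfrac (by positivity) (by positivity)
      have e1 : N ^ 3 * (1 / N ^ 3) = 1 := by field_simp
      have e2 : N₀ ^ 3 * (α / (a₁ * N ^ 2)) = N₀ ^ 3 / a₁ * (α / N ^ 2) := by field_simp
      rwa [e1, e2] at h5
    have h6 := mul_le_mul_of_nonneg_left h3 (by positivity : 0 ≤ η * (c₁ + Q))
    have h7 : 0 ≤ ((1 + Q * B * a₂) * (2 * c₁ / a₁ + Q * (F + A)) + Q * (F + A))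
        * (α * η / N ^ 2) := by positivity
    have e3 : η * (c₁ + Q) * (N₀ ^ 3 / a₁ * (α / N ^ 2)) =
        (c₁ + Q) * N₀ ^ 3 / a₁ * (α * η / N ^ 2) := by ring
    rw [e3] at h6
    rw [add_mul]
    linarith

end Moderate

end ErrorRecursion

end Problem

end SURF

namespace SURF

namespace Problem

/-! ### Assembly of the two regimes. -/

/-- Consequences of a Lyapunov bound at the level of the final accuracy. -/
theorem bounds_of_lyapunov {D e C x F r : ℝ} (hD : 0 ≤ D) (he : 0 ≤ e) (hC : 0 ≤ C)
    (h : D + C * e ≤ x + F / r) (hx : x ≤ F / r) :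
    D ≤ 2 * F / r ∧ C * e ≤ 2 * F / r := by
  have e1 : 2 * F / r = F / r + F / r := by ring
  rw [e1]
  constructor <;> linarith [mul_nonneg hC he]

end Problem

end SURF

theorem mainTheorem2 {d p k q : ℕ} (P : SURF.Problem d p k q)
    (hreg : P.HiddenRegular) (hcon : P.ConstraintRegular) (htrade : P.NonzeroTradeoff) :
    -- the Pareto-front geometry is well defined
    (DifferentiableOn ℝ P.fPF (Set.Icc 0 1) ∧ 0 < P.vMin ∧
      (∀ w ∈ Set.Icc (0 : ℝ) 1, P.vMin ≤ P.speed w ∧ P.speed w ≤ P.vMax) ∧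
      0 < P.arc 1 ∧ SURF.IsCDF P.Phi) ∧
    ∃ C₂ > 0, ∃ C₃ > 0, ∃ C₄ > 0,
      -- regime (i)
      (∃ F₁ > 0, ∃ F₂ > 0, ∃ F₃ > 0, ∃ F₄ > 0, ∀ D > 0, ∃ c > 0,
        ∀ (R : SURF.Run d) (ηK : ℝ), 1 ≤ R.N → 0 < R.α → R.α ≤ 1 / 2 → 0 ≤ ηK →
          ηK ≤ c * min (P.vMin ^ 2 / P.vMax * (R.N : ℝ)⁻¹) (P.arc 1 / (R.α * R.N)) →
          P.InitialContraction R ηK D → P.WarmContraction R ηK →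
          ∀ C : ℝ, C = (4 * C₂ / P.arc 1 + P.vMax / P.vMin ^ 2) * R.N →
            (∀ t, SURF.IsCDF (P.cdf R t)) ∧
            (∀ t, P.lyapunov R C t
              ≤ (1 - R.α / 4) ^ t * P.lyapunov R C 0 + F₁ / (R.N : ℝ) ^ 2) ∧
            (∀ t, P.innerErr R t ≤ F₂ * (P.vMin ^ 2 / P.vMax * (R.N : ℝ)⁻¹)) ∧
            (∀ t, (1 - R.α / 4) ^ t * P.lyapunov R C 0 ≤ F₁ / (R.N : ℝ) ^ 2 →
              P.cdfErr R t ≤ F₃ / (R.N : ℝ) ^ 2 ∧ P.innerErr R t ≤ F₄ / (R.N : ℝ) ^ 3)) ∧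
      -- regime (ii)
      (∀ a₁ > 0, ∀ a₂ > 0, ∃ c > 0, ∃ F₁ > 0, ∃ F₂ > 0, ∃ F₃ > 0, ∃ F₄ > 0, ∃ L > 0,
        ∀ (R : SURF.Run d) (ηK : ℝ), 1 ≤ R.N → R.α ≤ 1 →
          a₁ / (R.N : ℝ) ≤ R.α → R.α ≤ a₂ / (R.N : ℝ) → 0 ≤ ηK →
          ηK ≤ min (1 / 2 * (1 + C₃ * C₄ * R.α * (R.N / P.arc 1))⁻¹)
            (1 / 4 * ((1 + 4 * C₂ * R.α * R.N / P.arc 1) * (C₃ * C₄))⁻¹) →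
          (∀ n ≤ R.N, P.iterate R 0 n ∈ P.U) →
          P.innerErr R 0 ≤ c * (P.vMin ^ 2 / P.vMax * (R.N : ℝ)⁻¹) →
          P.WarmContraction R ηK →
          ∀ C : ℝ, C = 1 + 4 * C₂ * R.α * R.N / P.arc 1 →
            (∀ t, SURF.IsCDF (P.cdf R t)) ∧
            (∀ t, P.lyapunov R C t
              ≤ (1 - R.α / 4) ^ t * P.lyapunov R C 0 + F₁ / (R.N : ℝ) ^ 2) ∧
            (∀ t₀, (1 - R.α / 4) ^ t₀ * P.lyapunov R C 0 ≤ F₁ / (R.N : ℝ) ^ 2 →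
              (∀ t ≥ t₀, P.cdfErr R t ≤ F₂ / (R.N : ℝ) ^ 2) ∧
              (∀ t : ℕ, (t₀ : ℝ) + L * Real.log (R.N + 1) ≤ t →
                P.innerErr R t ≤ F₃ * (R.α * ηK / (R.N : ℝ) ^ 2) ∧
                P.innerErr R t ≤ F₄ / (R.N : ℝ) ^ 3))) := by
  open SURF.Problem in
  obtain ⟨G, Lx, Lf, K, c, hB⟩ := exists_frontBounds hreg hcon htrade
  obtain ⟨N₀, c₁, A, B, Q, hN₀, hc₁, hA, hB0, hQ, hrec⟩ := hB.exists_errorRecursion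
  refine ⟨hB.geometry, ?_⟩
  have hs := hB.arc_one_pos
  have hvm := hB.vMin_pos
  have hvM := hB.vMax_pos
  set s := P.arc 1
  set v := P.vMin ^ 2 / P.vMax with hv
  have hv0 : 0 < v := by positivity
  -- Each summand provides one of the lower bounds on `M` in `ErrorRecursion.ModerateContraction`.
  set M := Q + Q * B * s + (1 + A) * Q * s / c₁ + (c₁ + Q) * N₀ / (4 * c₁) with hM
  have hQB : 0 < Q * B * s := by positivity
  have hM1 : 0 < (1 + A) * Q * s / c₁ := by positivity
  have hM2 : 0 < (c₁ + Q) * N₀ / (4 * c₁) := by positivity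
  have hM0 : 0 < M := by positivity
  -- With `C₂ = B s` the quotient `C₂ / s` is the noise constant `B`; `C₃` and `C₄` enter only
  -- through their product.
  refine ⟨B * s, by positivity, M, hM0, 1, one_pos, ?_, ?_⟩
  · set κ := 4 * B + P.vMax / P.vMin ^ 2 with hκ
    have hvr : 0 < P.vMax / P.vMin ^ 2 := by positivity
    have hκ0 : 0 < κ := by positivity
    set F₁ := 5 * A + (1 + κ * c₁) * N₀ ^ 2 with hF₁
    have hF0 : 0 < (1 + κ * c₁) * N₀ ^ 2 := by positivity
    have hF₁0 : 0 < F₁ := by positivity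
    refine ⟨F₁, hF₁0, c₁ / v, by positivity, 2 * F₁, by positivity, 2 * F₁ / κ, by positivity, ?_⟩
    intro D hD
    set x := min (1 / 8) (min (c₁ / (c₁ + Q)) (1 / (4 * (κ * Q)))) with hx
    have hx0 : 0 < x := by positivity
    have hx1 : x * (c₁ + Q) ≤ c₁ := by
      rw [← le_div_iff₀ (by positivity)]
      exact (min_le_right _ _).trans (min_le_left _ _)
    have hx2 : κ * x * Q ≤ 1 / 4 := by
      have h : x ≤ 1 / (4 * (κ * Q)) := (min_le_right _ _).trans (min_le_right _ _)
      rw [le_div_iff₀ (by positivity)] at h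
      linarith
    -- The first entry gives `N η ≤ x`; the second makes the initial solve from distance `D` reach
    -- `N e ≤ c₁`.
    refine ⟨min (x / v) (c₁ / (D * v)), by positivity, ?_⟩
    intro R η hN hα hα1 hη hηle hinit hwarm C hC
    have hNpos : (0 : ℝ) < R.N := Nat.cast_pos.2 hN
    have hN1 : (1 : ℝ) ≤ R.N := Nat.one_le_cast.2 hN
    have hη1 : R.N * η ≤ min (x / v) (c₁ / (D * v)) * v := by
      have h1 := hηle.trans (mul_le_mul_of_nonneg_left (min_le_left _ _) (by positivity))
      have h2 := mul_le_mul_of_nonneg_left h1 hNpos.le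
      refine h2.trans (le_of_eq ?_)
      field_simp
    have hηx : R.N * η ≤ x := hη1.trans (by
      rw [← le_div_iff₀ hv0]; exact min_le_left _ _)
    have hηD : R.N * (η * D) ≤ c₁ := by
      have h1 := mul_le_mul_of_nonneg_right hη1 hD.le
      have h2 : min (x / v) (c₁ / (D * v)) ≤ c₁ / (D * v) := min_le_right _ _
      rw [le_div_iff₀ (by positivity)] at h2
      linarith
    have h0 : R.N * P.innerErr R 0 ≤ c₁ := by
      refine le_trans (mul_le_mul_of_nonneg_left (innerErr_le fun n hn => ?_) hNpos.le) hηD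
      exact (hinit n hn).2.2.2.trans (mul_le_mul_of_nonneg_left (hinit n hn).2.2.1 hη)
    obtain ⟨Good, hgood, hR⟩ := hrec R η hN hα (by linarith) hη (fun n hn => (hinit n hn).2.1) hwarm
    have hinv := hR.invariant_small hN1 hη hQ hηx hx1 h0
    have hlyap := hR.lyapunov_small hN1 hα hα1 hη hA hB0 hQ hc₁ hηx hx1 hx2 (min_le_left _ _)
      (F := F₁) (by rw [hκ]; linarith) (by rw [hF₁]; linarith) (by rw [hF₁]; linarith) h0
    have hCe : C = κ * R.N := by
      rw [hC, hκ]
      field_simp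
    subst hCe
    refine ⟨fun t => hgood t (hinv t).1, hlyap, fun t => ?_, fun t ht => ?_⟩
    · have h1 : c₁ / v * (v * (R.N : ℝ)⁻¹) = c₁ / R.N := by field_simp
      rw [h1, le_div_iff₀ hNpos, mul_comm]
      exact (hinv t).2
    · obtain ⟨h1, h2⟩ := bounds_of_lyapunov (hR.D_nonneg t) (hR.e_nonneg t)
        (by positivity : 0 ≤ κ * R.N) (hlyap t) ht
      refine ⟨h1, ?_⟩
      -- The weight `κ N` on the inner error gains the extra power of `N`.
      rw [le_div_iff₀ (by positivity)] at h2
      rw [le_div_iff₀ (by positivity), le_div_iff₀ hκ0]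
      linarith
  · intro a₁ ha₁ a₂ ha₂
    set F₁ := 5 * A + (1 + (1 + 4 * B * a₂) * c₁) * N₀ ^ 2 with hF₁
    have hF0 : 0 < (1 + (1 + 4 * B * a₂) * c₁) * N₀ ^ 2 := by positivity
    have hF₁0 : 0 < F₁ := by positivity
    set F₃ := (1 + Q * B * a₂) * (2 * c₁ / a₁ + Q * (2 * F₁ + A)) + Q * (2 * F₁ + A)
      + (c₁ + Q) * N₀ ^ 3 / a₁ with hF₃
    have hF₃0 : 0 < F₃ := by positivity
    refine ⟨c₁ / v, by positivity, F₁, hF₁0, 2 * F₁, by positivity, F₃, hF₃0, F₃ * a₂,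
      by positivity, 5, by norm_num, ?_⟩
    intro R η hN hα1 hαl hαu hη hηle hU he0 hwarm C hC
    have hNpos : (0 : ℝ) < R.N := Nat.cast_pos.2 hN
    have hN1 : (1 : ℝ) ≤ R.N := Nat.one_le_cast.2 hN
    have hα : 0 < R.α := lt_of_lt_of_le (by positivity) hαl
    rw [div_le_iff₀ hNpos] at hαl
    rw [le_div_iff₀ hNpos] at hαu
    have h0 : R.N * P.innerErr R 0 ≤ c₁ := by
      have h1 : c₁ / v * (v * (R.N : ℝ)⁻¹) = c₁ / R.N := by field_simp
      rw [h1, le_div_iff₀ hNpos] at he0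
      linarith
    have hCe : C = 1 + 4 * B * R.α * R.N := by
      rw [hC]
      field_simp
    have hmod : ErrorRecursion.ModerateContraction N₀ c₁ A B Q R.N R.α η M s := by
      refine ⟨hM0, hs, ?_, ?_, ?_, ?_, ?_, ?_⟩
      · have h1 := hηle.trans (min_le_left _ _)
        rw [mul_one, ← div_eq_mul_inv, le_div_iff₀ (by positivity)] at h1
        exact h1
      · have h1 := hηle.trans (min_le_right _ _)
        rw [mul_one, ← div_eq_mul_inv, le_div_iff₀ (by positivity), ← hC, hCe] at h1
        exact h1
      · linarith
      · linarith
      · have : (1 + A) * Q * s / c₁ ≤ M := by linarith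
        rw [div_le_iff₀ hc₁] at this
        linarith
      · have : (c₁ + Q) * N₀ / (4 * c₁) ≤ M := by linarith
        rw [div_le_iff₀ (by positivity)] at this
        linarith
    subst hCe
    obtain ⟨Good, hgood, hR⟩ := hrec R η hN hα hα1 hη hU hwarm
    have hinv := hR.invariant_moderate hN1 hα hη hA hB0 hQ hc₁ hmod h0
    have hlyap := hR.lyapunov_moderate hN1 hα hα1 hη hA hB0 hQ hc₁ hmod h0 hαu
      (F := F₁) (by rw [hF₁]; linarith) (by rw [hF₁]; linarith)
    refine ⟨fun t => hgood t (hinv t).1, hlyap, fun t₀ ht₀ => ?_⟩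
    have hD : ∀ t ≥ t₀, P.cdfErr R t ≤ 2 * F₁ / (R.N : ℝ) ^ 2 := by
      intro t ht
      have hL0 : 0 ≤ P.lyapunov R (1 + 4 * B * R.α * R.N) 0 :=
        add_nonneg (hR.D_nonneg 0) (mul_nonneg (by positivity) (hR.e_nonneg 0))
      have h1 : (1 - R.α / 4) ^ t * P.lyapunov R (1 + 4 * B * R.α * R.N) 0 ≤ F₁ / (R.N : ℝ) ^ 2 :=
        (mul_le_mul_of_nonneg_right
          (pow_le_pow_of_le_one (by linarith) (by linarith) ht) hL0).trans ht₀
      exact (bounds_of_lyapunov (hR.D_nonneg t) (hR.e_nonneg t) (by positivity) (hlyap t) h1).1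
    refine ⟨hD, fun t ht => ?_⟩
    have h1 := hR.e_final_moderate hN1 hα hη hA hB0 hQ hc₁ hN₀ hmod h0 ha₁ hαl hαu
      (by positivity) hD ht
    refine ⟨h1, h1.trans ?_⟩
    have hη1 := hmod.eta_le_half hN1 hα hη
    rw [← hF₃, mul_div_assoc F₃ a₂]
    refine mul_le_mul_of_nonneg_left ?_ hF₃0.le
    rw [div_le_div_iff₀ (by positivity) (by positivity)]
    -- The upper bound on the damping and `η ≤ 1 / 2` turn `α η N⁻²` into `N⁻³`.
    have h2 : R.α * η * R.N ≤ a₂ := by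
      have := mul_le_mul hαu hη1 hη ha₂.le
      linarith
    have h3 := mul_le_mul_of_nonneg_right h2 (by positivity : 0 ≤ (R.N : ℝ) ^ 2)
    linarith
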